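/- **Setting.** Let $(M,d)$ be a complete separable metric space, $m$ a Radon (locally finite Borel) measure on $M$, and $p\in(1,\infty)$. Write $B(x,r)=\{y: d(x,y)<r\}$. Let $(\mathcal E,\mathcal F)$ be a mixed local and nonlocal $p$-energy form on $(M,m)$ with jump measure $j$. This means: $\mathcal F$ is a linear subspace of $L^p(M,m)$; $\mathcal E:\mathcal F\to[0,\infty)$ and $\mathcal E^{1/p}$ is a semi-norm; with $\mathcal E_1(u)=\mathcal E(u)+\|u\|_{L^p}^p$, the space $(\mathcal F,\mathcal E_1^{1/p})$ is complete and $\mathcal F\cap C_c(M)$ is dense both in it and in $(C_c(M),\|\cdot\|_{\sup})$; for $u,v\in\mathcal F$ we have $u\wedge v,u\vee v\in\mathcal F$ and $\mathcal E(u\wedge v)+\mathcal E(u\vee v)\le\mathcal E(u)+\mathcal E(v)$; $j$ is a symmetric Radon measure on $M\times M$ off the diagonal such that $\mathcal E^{(L)}(u):=\mathcal E(u)-\int|u(x)-u(y)|^p\,dj(x,y)$ (the integral being finite) defines on $\mathcal F\cap C_c(M)$ a functional whose $1/p$-th power is a (finite, non-negative) semi-norm and which * is strongly local: $\mathcal E^{(L)}(u+v)=\mathcal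 E^{(L)}(u)+\mathcal E^{(L)}(v)$ whenever $\operatorname{supp}_m u$, $\operatorname{supp}_m v$ are compact and $\operatorname{supp}_m u\cap\operatorname{supp}_m(v+a)=\emptyset$ for some $a\in\mathbb R$, where $\operatorname{supp}_m f$ is the support of the measure $|f|\,dm$; * is Markovian: if $\psi\in C(\mathbb R)$, $\psi(0)=0$ and $|\psi(s)-\psi(t)|\le|s-t|$ for all $s,t$, then $\psi\circ u\in\mathcal F\cap C_c(M)$ and $\mathcal E^{(L)}(\psi\circ u)\le\mathcal E^{(L)}(u)$ for $u\in\mathcal F\cap C_c(M)$; * satisfies the $p$-Clarkson inequality: $\mathcal E^{(L)}(u+v)+\mathcal E^{(L)}(u-v)$ is $\ge$ (if $p\le2$), respectively $\le$ (if $p\ge2$), $2\big(\mathcal E^{(L)}(u)^{1/(p-1)}+\mathcal E^{(L)}(v)^{1/(p-1)}\big)^{p-1}$. For open $A\subset M$ let $\operatorname{Cap}_1(A)=\inf\{\mathcal E_1(u): u\in\mathcal F,\ u\ge1\ m\text{-a.e. on }A\}$. A function $u$ is quasi-continuous if for every $\epsilon>0$ there is an open $G$ with $\operatorname{Cap}_1(G)<\epsilon$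 such that $u|_{M\setminus G}$ is continuous. Every $u\in\mathcal F$ has a quasi-continuous version $\widetilde u$, and $\mathcal E^{(L)}$ is extended to $\mathcal F$ by $\mathcal E^{(L)}(u)=\mathcal E(u)-\int|\widetilde u(x)-\widetilde u(y)|^p\,dj(x,y)$. Put $\mathcal E^{(L)}(u;v)=\frac1p\frac{d}{dt}\mathcal E^{(L)}(u+tv)\big|_{t=0}$. **Energy measures.** For $u\in\mathcal F\cap L^\infty$, $\Gamma^{(L)}\langle u\rangle$ is the $p$-energy measure of the strongly local part, i.e. the finite Borel measure determined by $$\int_M f\,d\Gamma^{(L)}\langle u\rangle=\mathcal E^{(L)}(u;uf)-\Big(\frac{p-1}{p}\Big)^{p-1}\mathcal E^{(L)}\big(|u|^{\frac p{p-1}};f\big),\qquad f\in\mathcal F\cap C_c(M).$$ For open $\Omega\subset M$ let $\Gamma^{(J)}_\Omega\langle u\rangle(A)=\int_{A\times\Omega}|\widetilde u(x)-\widetilde u(y)|^p\,dj(x,y)$ and $\Gamma_\Omega\langle u\rangle=\Gamma^{(L)}\langle u\rangle+\Gamma^{(J)}_\Omega\langle u\rangle$. Let $\mathcal F'=\{u+a:u\in\mathcal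 F,\ a\in\mathbb R\}$, and for $u\in\mathcal F$, $a\in\mathbb R$ put $\widetilde{u+a}=\widetilde u+a$ and $\Gamma_\Omega\langle u+a\rangle=\Gamma_\Omega\langle u\rangle$. **Conditions.** Fix $\overline R\in(0,\operatorname{diam}M]$ (possibly $\infty$) and a scale function $W:M\times[0,\infty)\to[0,\infty)$: $W(x,\cdot)$ is strictly increasing, $W(x,0)=0$, $W(x,\infty)=\infty$, and there are $C\ge1$ and $0<\beta_1\le\beta_2<\infty$ with $C^{-1}(R/r)^{\beta_1}\le W(x,R)/W(y,r)\le C(R/r)^{\beta_2}$ whenever $0<r\le R<\infty$ and $d(x,y)\le R$. For open $U\subset V$ let $\operatorname{cutoff}(U,V)$ be the set of $\phi\in\mathcal F\cap C_c(M)$ with $0\le\phi\le1$, $\phi=1$ on $U$ and $\phi=0$ off $V$. * (TJ): there are a kernel $J(x,dy)$ and $C_{\rm TJ}\in(0,\infty)$ with $dj(x,y)=J(x,dy)\,dm(x)$ and $J(x,B(x,r)^c)\le C_{\rm TJ}/W(x,r)$ for all $x\in M$, $r>0$. * (CS): there are $\eta_0,C\in(0,\infty)$ such that for all $x_0\in M$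 and $R,r>0$ with $R+2r<\overline R$, with $B_0=B(x_0,R)$, $B_1=B(x_0,R+r)$, $\Omega=B(x_0,R+2r)$, there is $\phi\in\operatorname{cutoff}(B_0,B_1)$ such that for all $u\in\mathcal F'\cap L^\infty(M,m)$ $$\int_\Omega|\widetilde u|^p\,d\Gamma_\Omega\langle\phi\rangle\le\eta_0\int_\Omega d\Gamma_\Omega\langle u\rangle+\sup_{x\in\Omega}\frac{C}{W(x,r)}\int_\Omega|u|^p\,dm .$$ * ($\widetilde{\rm CS}_\eta$), for $\eta\in(0,\infty)$: there is $C_\eta\in(0,\infty)$ such that for all $x_0,R,r,B_0,B_1,\Omega$ as in (CS) there is $\phi\in\operatorname{cutoff}(B_0,B_1)$ such that for all $u\in\mathcal F'\cap L^\infty(M,m)$ $$\int_\Omega|\widetilde u|^p\,d\Gamma_\Omega\langle\phi\rangle\le\eta\int_\Omega\phi^p\,d\Gamma_\Omega\langle u\rangle+\sup_{x\in\Omega}\frac{C_\eta}{W(x,r)}\int_\Omega|u|^p\,dm .$$ **Proposition.** If (TJ) and (CS) hold, then ($\widetilde{\rm CS}_\eta$) holds for every $\eta\in(0,\infty)$.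 -/

import Mathlib

open MeasureTheory Filter Topology ProbabilityTheory
open scoped ENNReal

noncomputable section

namespace PEnergy

/-! ### General properties of a functional `E` on a space `D` of functions

Elements of `L^p(M,m)` are handled through their representatives `M → ℝ`. -/

section Basic

variable {M : Type*}

/-- `E` takes values in `[0,∞)` on the linear space `D`, and `E^{1/p}` is a semi-norm on `D`. -/
structure IsEnergyOn (p : ℝ) (D : Submodule ℝ (M → ℝ)) (E : (M → ℝ) → ℝ) : Prop where
  nonneg : ∀ u ∈ D, 0 ≤ E u
  smul : ∀ (a : ℝ), ∀ u ∈ D, E (a • u) ^ (1 / p) = |a| * E u ^ (1 / p)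
  triangle : ∀ u ∈ D, ∀ v ∈ D, E (u + v) ^ (1 / p) ≤ E u ^ (1 / p) + E v ^ (1 / p)

/-- The Markovian property: normal contractions operate on `D` and do not increase `E`. -/
def IsMarkovian (D : Submodule ℝ (M → ℝ)) (E : (M → ℝ) → ℝ) : Prop :=
  ∀ ψ : ℝ → ℝ, Continuous ψ → ψ 0 = 0 → (∀ s t, |ψ s - ψ t| ≤ |s - t|) →
    ∀ u ∈ D, ψ ∘ u ∈ D ∧ E (ψ ∘ u) ≤ E u

/-- The `p`-Clarkson inequality. -/
def Clarkson (p : ℝ) (D : Submodule ℝ (M → ℝ)) (E : (M → ℝ) → ℝ) : Prop :=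
  ∀ u ∈ D, ∀ v ∈ D,
    (p ≤ 2 → 2 * (E u ^ (1 / (p - 1)) + E v ^ (1 / (p - 1))) ^ (p - 1) ≤ E (u + v) + E (u - v)) ∧
    (2 ≤ p → E (u + v) + E (u - v) ≤ 2 * (E u ^ (1 / (p - 1)) + E v ^ (1 / (p - 1))) ^ (p - 1))

/-- Strong sub-additivity. -/
def StronglySubadditive (D : Submodule ℝ (M → ℝ)) (E : (M → ℝ) → ℝ) : Prop :=
  ∀ u ∈ D, ∀ v ∈ D, u ⊓ v ∈ D ∧ u ⊔ v ∈ D ∧ E (u ⊓ v) + E (u ⊔ v) ≤ E u + E v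

/-- `supp_m f`, the support of the measure `|f| dm`. -/
def msupport [TopologicalSpace M] [MeasurableSpace M] (m : Measure M) (f : M → ℝ) : Set M :=
  (m.withDensity fun x => ENNReal.ofReal |f x|).support

/-- Strong locality. -/
def StronglyLocal [TopologicalSpace M] [MeasurableSpace M] (m : Measure M)
    (D : Submodule ℝ (M → ℝ)) (E : (M → ℝ) → ℝ) : Prop :=
  ∀ u ∈ D, ∀ v ∈ D, IsCompact (msupport m u) → IsCompact (msupport m v) →
    ∀ a : ℝ, Disjoint (msupport m u) (msupport m fun x => v x + a) → E (u + v) = E u + E v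

/-- The continuous functions with compact support that belong to `D`. -/
def ccPart [TopologicalSpace M] (D : Submodule ℝ (M → ℝ)) : Submodule ℝ (M → ℝ) where
  carrier := {f | f ∈ D ∧ Continuous f ∧ HasCompactSupport f}
  add_mem' := fun ha hb =>
    ⟨D.add_mem ha.1 hb.1, ha.2.1.add hb.2.1, ha.2.2.add hb.2.2⟩
  zero_mem' := ⟨D.zero_mem, continuous_const, HasCompactSupport.zero⟩
  smul_mem' := fun c _ ha =>
    ⟨D.smul_mem c ha.1, ha.2.1.const_smul c, ha.2.2.smul_left (f := fun _ => c)⟩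

/-- `E_1(u) = E(u) + ‖u‖_{L^p}^p`. -/
def energyOne [MeasurableSpace M] (m : Measure M) (p : ℝ) (E : (M → ℝ) → ℝ) (u : M → ℝ) : ℝ :=
  E u + ∫ x, |u x| ^ p ∂m

/-- The jump energy `∫∫ |w(x) - w(y)|^p dj(x,y)`. -/
def jumpEnergy [MeasurableSpace M] (p : ℝ) (j : Measure (M × M)) (w : M → ℝ) : ℝ :=
  ∫ z, |w z.1 - w z.2| ^ p ∂j

/-- The local part of the energy. It is used for continuous `w` in the domain and, more generally,
for quasi-continuous `w` in the domain. -/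
def localPart [MeasurableSpace M] (p : ℝ) (j : Measure (M × M)) (E : (M → ℝ) → ℝ)
    (w : M → ℝ) : ℝ :=
  E w - jumpEnergy p j w

end Basic

variable {M : Type*} [MetricSpace M] [MeasurableSpace M]

/-- A mixed local and nonlocal `p`-energy form `(E, F)` on `(M, m)`, with its jump measure `j`.

The domain `F`, a linear subspace of `L^p(M,m)`, is given by the set of all representatives of its
elements. The jump measure, which lives on the complement of the diagonal, is viewed as a measure
on `M × M` that does not charge the diagonal and is Radon (locally finite) off the diagonal. -/
structure MixedForm (m : Measure M) (p : ℝ) where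
  /-- the domain `F` -/
  dom : Submodule ℝ (M → ℝ)
  /-- the energy, meaningful on `dom` -/
  energy : (M → ℝ) → ℝ
  /-- the jump measure -/
  jump : Measure (M × M)
  memLp : ∀ u ∈ dom, MemLp u (ENNReal.ofReal p) m
  dom_congr : ∀ u ∈ dom, ∀ v : M → ℝ, u =ᵐ[m] v → v ∈ dom
  energy_congr : ∀ u ∈ dom, ∀ v : M → ℝ, u =ᵐ[m] v → energy u = energy v
  isEnergy : IsEnergyOn p dom energy
  /-- closedness: `(F, E_1^{1/p})` is complete -/
  closed : ∀ u : ℕ → M → ℝ, (∀ n, u n ∈ dom) →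
    (∀ ε > 0, ∃ N, ∀ n ≥ N, ∀ k ≥ N, energyOne m p energy (u n - u k) < ε) →
    ∃ v ∈ dom, Tendsto (fun n => energyOne m p energy (u n - v)) atTop (𝓝 0)
  /-- regularity: `F ∩ C_c(M)` is dense in `(F, E_1^{1/p})` -/
  regular_dom : ∀ u ∈ dom, ∀ ε > 0, ∃ f ∈ ccPart dom, energyOne m p energy (u - f) < ε
  /-- regularity: `F ∩ C_c(M)` is dense in `C_c(M)` for the uniform norm -/
  regular_cc : ∀ g : M → ℝ, Continuous g → HasCompactSupport g →
    ∀ ε > 0, ∃ f ∈ ccPart dom, ∀ x, |g x - f x| < ε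
  subadditive : StronglySubadditive dom energy
  jump_diag : jump {z | z.1 = z.2} = 0
  jump_radon : ∀ z : M × M, z.1 ≠ z.2 → ∃ U ∈ 𝓝 z, jump U < ∞
  jump_symm : jump.map Prod.swap = jump
  /-- the jump energy is finite on `F ∩ C_c(M)` -/
  jump_integrable : ∀ u ∈ ccPart dom, Integrable (fun z : M × M => |u z.1 - u z.2| ^ p) jump
  local_isEnergy : IsEnergyOn p (ccPart dom) (localPart p jump energy)
  local_stronglyLocal : StronglyLocal m (ccPart dom) (localPart p jump energy)
  local_markovian : IsMarkovian (ccPart dom) (localPart p jump energy)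
  local_clarkson : Clarkson p (ccPart dom) (localPart p jump energy)

namespace MixedForm

variable {m : Measure M} {p : ℝ} (𝓔 : MixedForm m p)

/-! ### Capacity and quasi-continuity -/

/-- The capacity `Cap_1(A)` of an open set `A`. -/
def cap (A : Set M) : ℝ≥0∞ :=
  ⨅ u : M → ℝ, ⨅ _ : u ∈ 𝓔.dom ∧ ∀ᵐ x ∂m, x ∈ A → 1 ≤ u x,
    ENNReal.ofReal (energyOne m p 𝓔.energy u)

/-- Quasi-continuity: `u` is continuous on the complement of open sets of arbitrarily small
capacity. -/
def QuasiContinuous (u : M → ℝ) : Prop :=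
  ∀ ε : ℝ≥0∞, 0 < ε → ∃ G : Set M, IsOpen G ∧ 𝓔.cap G < ε ∧ ContinuousOn u Gᶜ

/-! ### Energy measures -/

/-- `E^{(L)}(u; v) = (1/p) d/dt E^{(L)}(u + t v)` at `t = 0`, for quasi-continuous `u`, `v`
in the domain. -/
def localPair (u v : M → ℝ) : ℝ :=
  1 / p * deriv (fun t : ℝ => localPart p 𝓔.jump 𝓔.energy (u + t • v)) 0

/-- `μ` is the `p`-energy measure of the strongly local part at the bounded quasi-continuous
function `u` of the domain: a finite Borel measure such that, for every `f ∈ F ∩ C_c(M)`,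
`∫ f dμ = E^{(L)}(u; u f) - ((p-1)/p)^{p-1} E^{(L)}(|u|^{p/(p-1)}; f)`.
(For `p = 2` this is the usual `∫ f dμ = E^{(L)}(u, u f) - (1/2) E^{(L)}(u^2, f)`.) By density of
`F ∩ C_c(M)` in `C_c(M)` there is at most one such measure when `M` is locally compact. -/
def IsLocalEnergyMeasure (u : M → ℝ) (μ : Measure M) : Prop :=
  IsFiniteMeasure μ ∧ ∀ f ∈ ccPart 𝓔.dom,
    ∫ x, f x ∂μ = 𝓔.localPair u (u * f) -
      ((p - 1) / p) ^ (p - 1) * 𝓔.localPair (fun x => |u x| ^ (p / (p - 1))) f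

open Classical in
/-- `Γ^{(L)}⟨u⟩`, for a bounded quasi-continuous `u` in the domain. -/
def localEnergyMeasure (u : M → ℝ) : Measure M :=
  if h : ∃ μ : Measure M, 𝓔.IsLocalEnergyMeasure u μ then h.choose else 0

/-- `Γ^{(J)}_Ω⟨u⟩(A) = ∫_{A × Ω} |u(x) - u(y)|^p dj(x,y)`, for a quasi-continuous `u`. -/
def jumpEnergyMeasure (Ω : Set M) (u : M → ℝ) : Measure M :=
  ((𝓔.jump.restrict (Set.univ ×ˢ Ω)).withDensity
    fun z => ENNReal.ofReal (|u z.1 - u z.2| ^ p)).map Prod.fst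

/-- `Γ_Ω⟨u⟩ = Γ^{(L)}⟨u⟩ + Γ^{(J)}_Ω⟨u⟩`, for a bounded quasi-continuous `u` in the domain.
For a constant `a`, the energy measure of `u + a` is by definition that of `u`. -/
def energyMeasure (Ω : Set M) (u : M → ℝ) : Measure M :=
  𝓔.localEnergyMeasure u + 𝓔.jumpEnergyMeasure Ω u

/-- `cutoff(U, V)`. -/
def cutoff (U V : Set M) : Set (M → ℝ) :=
  {φ | φ ∈ ccPart 𝓔.dom ∧ (∀ x, 0 ≤ φ x ∧ φ x ≤ 1) ∧ (∀ x ∈ U, φ x = 1) ∧ ∀ x ∉ V, φ x = 0}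

end MixedForm

/-- `W : M × [0,∞) → [0,∞)` is a scale function (values at negative radii are irrelevant). -/
structure IsScaleFunction (W : M → ℝ → ℝ) : Prop where
  strictMono : ∀ x, StrictMonoOn (W x) (Set.Ici 0)
  zero : ∀ x, W x 0 = 0
  tendsto : ∀ x, Tendsto (W x) atTop atTop
  scaling : ∃ C β₁ β₂ : ℝ, 1 ≤ C ∧ 0 < β₁ ∧ β₁ ≤ β₂ ∧
    ∀ (x y : M) (r R : ℝ), 0 < r → r ≤ R → dist x y ≤ R →
      C⁻¹ * (R / r) ^ β₁ ≤ W x R / W y r ∧ W x R / W y r ≤ C * (R / r) ^ β₂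

namespace MixedForm

variable {m : Measure M} {p : ℝ} (𝓔 : MixedForm m p)

/-- Condition (TJ): `dj(x,y) = J(x,dy) dm(x)` for a kernel `J` with
`J(x, B(x,r)ᶜ) ≤ C / W(x,r)` for all `x` and `r > 0`. -/
def TJ (W : M → ℝ → ℝ) : Prop :=
  ∃ (J : Kernel M M) (C : ℝ), 0 < C ∧
    (∀ E : Set (M × M), MeasurableSet E → 𝓔.jump E = ∫⁻ x, J x (Prod.mk x ⁻¹' E) ∂m) ∧
    ∀ (x : M) (r : ℝ), 0 < r → J x (Metric.ball x r)ᶜ ≤ ENNReal.ofReal (C / W x r)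

/-- The inequality
`∫_Ω |u|^p dΓ_Ω⟨φ⟩ ≤ η ∫_Ω g dΓ_Ω⟨u⟩ + sup_{x ∈ Ω} C / W(x,r) ∫_Ω |u|^p dm`
for all `u ∈ F' ∩ L^∞`, where `F' = {v + a : v ∈ F, a ∈ ℝ}`. Each `u = v + a` is represented by
a quasi-continuous version, and `Γ_Ω⟨u⟩ = Γ_Ω⟨v⟩`. -/
def CutoffInequality (W : M → ℝ → ℝ) (η C r : ℝ) (Ω : Set M) (φ g : M → ℝ) : Prop :=
  ∀ v ∈ 𝓔.dom, 𝓔.QuasiContinuous v → MemLp v ∞ m → ∀ a : ℝ,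
    ∫⁻ x in Ω, ENNReal.ofReal (|v x + a| ^ p) ∂(𝓔.energyMeasure Ω φ) ≤
      ENNReal.ofReal η * ∫⁻ x in Ω, ENNReal.ofReal (g x) ∂(𝓔.energyMeasure Ω v) +
      (⨆ x ∈ Ω, ENNReal.ofReal (C / W x r)) *
        ∫⁻ x in Ω, ENNReal.ofReal (|v x + a| ^ p) ∂m

/-- The cutoff Sobolev inequality (CS). -/
def CS (Rbar : ℝ≥0∞) (W : M → ℝ → ℝ) : Prop :=
  ∃ η C : ℝ, 0 < η ∧ 0 < C ∧ ∀ (x₀ : M) (R r : ℝ), 0 < R → 0 < r →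
    ENNReal.ofReal (R + 2 * r) < Rbar →
    ∃ φ ∈ 𝓔.cutoff (Metric.ball x₀ R) (Metric.ball x₀ (R + r)),
      𝓔.CutoffInequality W η C r (Metric.ball x₀ (R + 2 * r)) φ (fun _ => 1)

/-- The improved cutoff Sobolev inequality with constant `η`: the energy term on the right-hand
side is weighted by `φ^p`. -/
def ImprovedCS (Rbar : ℝ≥0∞) (W : M → ℝ → ℝ) (η : ℝ) : Prop :=
  ∃ C : ℝ, 0 < C ∧ ∀ (x₀ : M) (R r : ℝ), 0 < R → 0 < r →
    ENNReal.ofReal (R + 2 * r) < Rbar →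
    ∃ φ ∈ 𝓔.cutoff (Metric.ball x₀ R) (Metric.ball x₀ (R + r)),
      𝓔.CutoffInequality W η C r (Metric.ball x₀ (R + 2 * r)) φ (fun x => φ x ^ p)

end MixedForm

end PEnergy

end

/-!
The improved cutoff function is a weighted sum `φ = ∑ (1 - θ) θ ^ n φ n` of the cutoff functions
`φ n` which condition (CS) gives for the balls `B(x₀, R n)`, `B(x₀, R n + r n)`, where the radii
`R n` increase from `R` to `R + r` and `R (n + 1) = R n + 2 * r n`. On the layer between the radii
`R n` and `R (n + 1)` the function `φ` is at least `θ ^ (n + 1)`, whereas the energy measure of `φ`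
there is only `((1 - θ) θ ^ n) ^ p` times that of `φ n`; so the inequality for `φ n` yields the
weight `φ ^ p`, with a constant `η₀ (1 - θ) ^ p / (θ ^ p (1 - θ ^ p))` which tends to `0` as
`θ → 1` because `p > 1` (`exists_ratio`, `Layers.tsum_weights_indicator_le`). The widths `r n`
decrease geometrically, at a rate chosen such that `∑ θ ^ (n p) / W(x, r n)` converges and is
comparable to `1 / W(x, r)`. Applied to the constant function `1`, (CS) bounds the energies of the
`φ n` (`MixedForm.ofReal_energy_le`), so that `φ` belongs to the domain (`Layers.layerSum_mem`).

What has to be proved is that the energy measure of `φ` is controlled by those of the `φ n`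
(`Layers.lintegral_energyMeasure_le`). For the jump part, this is an elementary estimate of
`|φ x - φ y|` (`Layers.increment`); the pairs of points which lie in different layers and are far
from each other are treated with (TJ). For the local part, `Γ⟨u₁ + u₂⟩ = Γ⟨u₁⟩ + Γ⟨u₂⟩` is needed
when `u₂` is equal to a constant `a` near the support of `u₁`
(`MixedForm.localEnergyMeasure_add`), and also the existence of energy measures, since
`localEnergyMeasure` is defined by a choice. Both rest on a study of the functional
`F_u(f) = E(u; u f) - ((p-1)/p)^{p-1} E(|u|^{p/(p-1)}; f)` for a nonnegative `u` in the domain.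

The Clarkson inequality makes the strongly local energy differentiable along lines, and the
derivative `E(u; v)` linear in `v` (`ClarksonEnergy.pair_add_right`). A function `u` is cut
along levels `i τ` into slices `u_i` which are separated by gaps of the range of negligible energy
(`LocalForm.FineLevels`); by strong locality `E(∑ s_i u_i; g) = ∑ E(s_i u_i; g)`, and
`E(s u_i; g) = s^{p-1} E(u_i; g)` for `s ≥ 0`. As the `(p-1)`-th power of the derivative of
`x ↦ (x + a)^{p/(p-1)}` is affine, a Riemann sum argument gives
`((p-1)/p)^{p-1} E((u + a)^{p/(p-1)} - a^{p/(p-1)}; g) =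
((p-1)/p)^{p-1} E(u^{p/(p-1)}; g) + a E(u; g)` (`LocalForm.pair_powShift`), which implies the
additivity of `F` on separated functions. The same argument shows that `F_u(f)` is the limit of
`E(w; w f)`, where `w = ∑ (-1)^i u_i` is a zigzag function of `u` with `0 ≤ w ≤ τ` and energy at
most that of `u` (`LocalForm.exists_zigzag`). Since `w` is uniformly small, the Markovian property
for a quadratic function of `w + K f` shows that `E(w; w f)` is almost nonnegative for `f ≥ 0`
(`LocalForm.le_pair_mul`). Hence `F_u` is a positive functional, bounded by `2 E(u) sup |f|`, and
it is represented by a measure.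
-/

noncomputable section

set_option linter.unusedSectionVars false

namespace PEnergy

/-! ### Convex functions of one variable -/

lemma hasDerivAt_of_eq {f g : ℝ → ℝ} {a b x : ℝ} (h : HasDerivAt f a x) (hfg : ∀ t, g t = f t)
    (hab : b = a) : HasDerivAt g b x := by
  obtain rfl : g = f := funext hfg
  exact hab ▸ h

/-- A convex function whose symmetric second difference at `0` is dominated by a function with
vanishing derivative is differentiable at `0`: its two one-sided derivatives agree. -/
lemma differentiableAt_zero_of_convexOn_of_symm_le {f g : ℝ → ℝ} (hf : ConvexOn ℝ Set.univ f)
    (hg : HasDerivAt g 0 0) (hg0 : g 0 = f 0) (h : ∀ t, f t + f (-t) ≤ 2 * g t) :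
    DifferentiableAt ℝ f 0 := by
  have h0 : (0 : ℝ) ∈ interior (Set.univ : Set ℝ) := by simp
  have hr := hf.hasDerivWithinAt_rightDeriv_of_mem_interior h0
  have hl := hf.hasDerivWithinAt_leftDeriv_of_mem_interior h0
  have hlr := hf.leftDeriv_le_rightDeriv_of_mem_interior h0
  set R := derivWithin f (Set.Ioi 0) 0
  set L := derivWithin f (Set.Iio 0) 0
  have hneg : HasDerivWithinAt (fun t => f (-t)) (-L) (Set.Ioi 0) 0 := by
    have hl' : HasDerivWithinAt f L (Set.Iio 0) (-(0 : ℝ)) := by simpa using hl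
    have := hl'.scomp (0 : ℝ) (h := fun t : ℝ => -t) (s := Set.Ioi 0)
      ((hasDerivAt_neg (0 : ℝ)).hasDerivWithinAt) (fun x hx => by simpa using hx)
    simpa [Function.comp_def] using this
  have hsum : HasDerivWithinAt (fun t => f t + f (-t) - 2 * g t) (R - L) (Set.Ioi 0) 0 := by
    have := (hr.add hneg).sub ((hg.const_mul 2).hasDerivWithinAt (s := Set.Ioi 0))
    rw [mul_zero, sub_zero, ← sub_eq_add_neg] at this
    exact this
  have hRL : R - L ≤ 0 := by
    rw [hasDerivWithinAt_iff_tendsto_slope' (by simp)] at hsum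
    refine le_of_tendsto hsum ?_
    filter_upwards [self_mem_nhdsWithin] with t ht
    have ht' : (0 : ℝ) < t := ht
    rw [slope_def_field]
    have h1 := h t
    apply div_nonpos_of_nonpos_of_nonneg
    · simp only [neg_zero, hg0]
      linarith
    · linarith
  have hRL' : L = R := le_antisymm hlr (by linarith)
  rw [hRL'] at hl
  have := (hasDerivWithinAt_Iio_iff_Iic.1 hl).union (hasDerivWithinAt_Ioi_iff_Ici.1 hr)
  rw [Set.Iic_union_Ici, hasDerivWithinAt_univ] at this
  exact this.differentiableAt

/-! ### The pairing of a convex `p`-homogeneous energy -/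

variable {M : Type*}

/-- The semi-norm `E^{1/p}` of an energy `E`. -/
def rootEnergy (p : ℝ) (E : (M → ℝ) → ℝ) (u : M → ℝ) : ℝ := E u ^ (1 / p)

/-- The pairing `E(u; v) = (1/p) d/dt E(u + t v)` at `t = 0`. -/
def pair (p : ℝ) (E : (M → ℝ) → ℝ) (u v : M → ℝ) : ℝ :=
  1 / p * deriv (fun t : ℝ => E (u + t • v)) 0

namespace IsEnergyOn

variable {p : ℝ} {D : Submodule ℝ (M → ℝ)} {E : (M → ℝ) → ℝ}

lemma root_nonneg (hE : IsEnergyOn p D E) {u : M → ℝ} (hu : u ∈ D) : 0 ≤ rootEnergy p E u :=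
  Real.rpow_nonneg (hE.nonneg u hu) _

lemma root_rpow (hE : IsEnergyOn p D E) (hp : 1 < p) {u : M → ℝ} (hu : u ∈ D) :
    rootEnergy p E u ^ p = E u := by
  rw [rootEnergy, ← Real.rpow_mul (hE.nonneg u hu), one_div_mul_cancel (by linarith),
    Real.rpow_one]

lemma root_smul (hE : IsEnergyOn p D E) (a : ℝ) {u : M → ℝ} (hu : u ∈ D) :
    rootEnergy p E (a • u) = |a| * rootEnergy p E u := hE.smul a u hu

lemma root_add_le (hE : IsEnergyOn p D E) {u v : M → ℝ} (hu : u ∈ D) (hv : v ∈ D) :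
    rootEnergy p E (u + v) ≤ rootEnergy p E u + rootEnergy p E v := hE.triangle u hu v hv

lemma root_neg (hE : IsEnergyOn p D E) {u : M → ℝ} (hu : u ∈ D) :
    rootEnergy p E (-u) = rootEnergy p E u := by
  simpa using hE.root_smul (-1) hu

lemma root_sub_le (hE : IsEnergyOn p D E) {u v : M → ℝ} (hu : u ∈ D) (hv : v ∈ D) :
    rootEnergy p E (u - v) ≤ rootEnergy p E u + rootEnergy p E v := by
  rw [sub_eq_add_neg, ← hE.root_neg hv]
  exact hE.root_add_le hu (D.neg_mem hv)

lemma root_zero (hE : IsEnergyOn p D E) : rootEnergy p E 0 = 0 := by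
  simpa using hE.root_smul 0 D.zero_mem

lemma root_sum_le (hE : IsEnergyOn p D E) {ι : Type*} (s : Finset ι) (u : ι → M → ℝ)
    (hu : ∀ i ∈ s, u i ∈ D) :
    rootEnergy p E (∑ i ∈ s, u i) ≤ ∑ i ∈ s, rootEnergy p E (u i) := by
  classical
  induction s using Finset.induction_on with
  | empty => simp [hE.root_zero]
  | insert a s ha ih =>
    rw [Finset.sum_insert ha, Finset.sum_insert ha]
    refine (hE.root_add_le (hu a (by simp))
      (D.sum_mem fun i hi => hu i (by simp [hi]))).trans ?_
    gcongr
    exact ih fun i hi => hu i (by simp [hi])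

lemma energy_zero (hE : IsEnergyOn p D E) (hp : 1 < p) : E 0 = 0 := by
  rw [← hE.root_rpow hp D.zero_mem, hE.root_zero, Real.zero_rpow (by linarith)]

lemma energy_smul (hE : IsEnergyOn p D E) (hp : 1 < p) (a : ℝ) {u : M → ℝ} (hu : u ∈ D) :
    E (a • u) = |a| ^ p * E u := by
  rw [← hE.root_rpow hp (D.smul_mem a hu), hE.root_smul a hu,
    Real.mul_rpow (abs_nonneg a) (hE.root_nonneg hu), hE.root_rpow hp hu]

lemma energy_neg (hE : IsEnergyOn p D E) (hp : 1 < p) {u : M → ℝ} (hu : u ∈ D) :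
    E (-u) = E u := by
  simpa using hE.energy_smul hp (-1) hu

lemma energy_le_of_root_le (hE : IsEnergyOn p D E) (hp : 1 < p) {u : M → ℝ} (hu : u ∈ D) {a : ℝ}
    (h : rootEnergy p E u ≤ a) : E u ≤ a ^ p := by
  rw [← hE.root_rpow hp hu]
  exact Real.rpow_le_rpow (hE.root_nonneg hu) h (by linarith)

lemma root_le_of_energy_le (hE : IsEnergyOn p D E) (hp : 1 < p) {u v : M → ℝ} (hu : u ∈ D)
    (h : E u ≤ E v) : rootEnergy p E u ≤ rootEnergy p E v :=
  Real.rpow_le_rpow (hE.nonneg u hu) h (by positivity)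

lemma line_mem {u v : M → ℝ} (hu : u ∈ D) (hv : v ∈ D) (t : ℝ) : u + t • v ∈ D :=
  D.add_mem hu (D.smul_mem t hv)

lemma convex_combo (hE : IsEnergyOn p D E) (hp : 1 < p) {u v : M → ℝ} (hu : u ∈ D) (hv : v ∈ D)
    {a b : ℝ} (ha : 0 ≤ a) (hb : 0 ≤ b) (hab : a + b = 1) :
    E (a • u + b • v) ≤ a * E u + b * E v := by
  have h1 : rootEnergy p E (a • u + b • v) ≤ a * rootEnergy p E u + b * rootEnergy p E v := by
    refine (hE.root_add_le (D.smul_mem a hu) (D.smul_mem b hv)).trans ?_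
    rw [hE.root_smul a hu, hE.root_smul b hv, abs_of_nonneg ha, abs_of_nonneg hb]
  refine (hE.energy_le_of_root_le hp (D.add_mem (D.smul_mem a hu) (D.smul_mem b hv)) h1).trans ?_
  have := (convexOn_rpow hp.le).2 (hE.root_nonneg hu) (hE.root_nonneg hv) ha hb hab
  simpa [hE.root_rpow hp hu, hE.root_rpow hp hv] using this

lemma convexOn_line (hE : IsEnergyOn p D E) (hp : 1 < p) {u v : M → ℝ} (hu : u ∈ D) (hv : v ∈ D) :
    ConvexOn ℝ Set.univ (fun t : ℝ => E (u + t • v)) := by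
  refine ⟨convex_univ, fun s _ t _ a b ha hb hab => ?_⟩
  have := hE.convex_combo hp (line_mem hu hv s) (line_mem hu hv t) ha hb hab
  have e : u + (a • s + b • t) • v = a • (u + s • v) + b • (u + t • v) := by
    ext x
    simp only [Pi.add_apply, Pi.smul_apply, smul_eq_mul]
    linear_combination (-u x) * hab
  change E (u + (a • s + b • t) • v) ≤ _
  rw [e]
  exact this

lemma abs_root_sub_root_le (hE : IsEnergyOn p D E) {u v : M → ℝ} (hu : u ∈ D) (hv : v ∈ D) :
    |rootEnergy p E u - rootEnergy p E v| ≤ rootEnergy p E (u - v) := by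
  have h1 := hE.root_add_le (D.sub_mem hu hv) hv
  have h2 := hE.root_add_le (D.sub_mem hv hu) hu
  rw [sub_add_cancel] at h1 h2
  rw [← neg_sub u v, hE.root_neg (D.sub_mem hu hv)] at h2
  rw [abs_le]
  constructor <;> linarith

end IsEnergyOn

/-- A convex `p`-homogeneous energy on `D` with `p > 1` that satisfies the `p`-Clarkson
inequality. -/
structure ClarksonEnergy (p : ℝ) (D : Submodule ℝ (M → ℝ)) (E : (M → ℝ) → ℝ) : Prop
    extends IsEnergyOn p D E where
  one_lt : 1 < p
  clarkson : Clarkson p D E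

namespace ClarksonEnergy

variable {p : ℝ} {D : Submodule ℝ (M → ℝ)} {E : (M → ℝ) → ℝ}

/-- The `p`-Clarkson inequality bounds the symmetric second difference of `t ↦ E(u + t v)` by a
function which is `o(t)`. -/
lemma differentiableAt_line (hE : ClarksonEnergy p D E)
    {u v : M → ℝ} (hu : u ∈ D) (hv : v ∈ D) :
    DifferentiableAt ℝ (fun t : ℝ => E (u + t • v)) 0 := by
  have hp := hE.one_lt
  have hp1 : 0 < p - 1 := by linarith
  have hEu := hE.nonneg u hu
  have hEv := hE.nonneg v hv
  rcases le_total p 2 with h2 | h2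
  · refine differentiableAt_zero_of_convexOn_of_symm_le (g := fun t => E u + |t| ^ p * E v)
      (hE.convexOn_line hp hu hv) ?_ ?_ ?_
    · simpa using ((hasDerivAt_abs_rpow 0 hp).mul_const (E v)).const_add (E u)
    · simp [Real.zero_rpow (by linarith : p ≠ 0)]
    · intro t
      have hA := hE.nonneg _ (IsEnergyOn.line_mem hu hv t)
      have hB := hE.nonneg _ (IsEnergyOn.line_mem hu hv (-t))
      have hcl := (hE.clarkson _ (IsEnergyOn.line_mem hu hv t)
        _ (IsEnergyOn.line_mem hu hv (-t))).1 h2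
      have e1 : u + t • v + (u + (-t) • v) = (2 : ℝ) • u := by
        ext x; simp; ring
      have e2 : u + t • v - (u + (-t) • v) = (2 * t) • v := by
        ext x; simp; ring
      rw [e1, e2, hE.energy_smul hp _ hu, hE.energy_smul hp _ hv, abs_mul,
        Real.mul_rpow (abs_nonneg _) (abs_nonneg _), abs_two] at hcl
      set A := E (u + t • v)
      set B := E (u + (-t) • v)
      have hα : 1 ≤ 1 / (p - 1) := by rw [le_div_iff₀ hp1]; linarith
      -- the power mean inequality turns the left-hand side into a multiple of `A + B`
      have hpm := (convexOn_rpow hα).2 hA hB (by norm_num : (0 : ℝ) ≤ 1 / 2)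
        (by norm_num : (0 : ℝ) ≤ 1 / 2) (by norm_num)
      simp only [smul_eq_mul] at hpm
      have hpm2 : 1 / 2 * A + 1 / 2 * B ≤
          (1 / 2 * (A ^ (1 / (p - 1)) + B ^ (1 / (p - 1)))) ^ (p - 1) := by
        have h3 := Real.rpow_le_rpow (Real.rpow_nonneg (by positivity) _) hpm hp1.le
        rw [← Real.rpow_mul (by positivity), one_div_mul_cancel hp1.ne', Real.rpow_one] at h3
        calc _ ≤ _ := h3
          _ = _ := by ring_nf
      rw [Real.mul_rpow (by norm_num) (by positivity)] at hpm2
      have h4 : (2 : ℝ) ^ p = 2 * 2 ^ (p - 1) := by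
        rw [Real.rpow_sub_one (by norm_num)]; ring
      have h5 : (1 / 2 : ℝ) ^ (p - 1) * 2 ^ (p - 1) = 1 := by
        rw [← Real.mul_rpow (by norm_num) (by norm_num)]; norm_num
      set S := (A ^ (1 / (p - 1)) + B ^ (1 / (p - 1))) ^ (p - 1)
      have hpow : (0 : ℝ) < (1 / 2 : ℝ) ^ (p - 1) := by positivity
      have h6 : S ≤ 2 ^ (p - 1) * (E u + |t| ^ p * E v) := by
        rw [h4] at hcl; nlinarith
      have h7 := mul_le_mul_of_nonneg_left h6 hpow.le
      rw [← mul_assoc, h5] at h7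
      linarith
  · refine differentiableAt_zero_of_convexOn_of_symm_le
      (g := fun t => (E u ^ (1 / (p - 1)) + |t| ^ (p / (p - 1)) * E v ^ (1 / (p - 1))) ^ (p - 1))
      (hE.convexOn_line hp hu hv) ?_ ?_ ?_
    · have hq : 1 < p / (p - 1) := by rw [lt_div_iff₀ hp1]; linarith
      have := (((hasDerivAt_abs_rpow 0 hq).mul_const (E v ^ (1 / (p - 1)))).const_add
        (E u ^ (1 / (p - 1)))).rpow_const (p := p - 1) (Or.inr (by linarith))
      simpa using this
    · simp only [abs_zero, zero_smul, add_zero]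
      rw [Real.zero_rpow (by positivity), zero_mul, add_zero, ← Real.rpow_mul hEu,
        one_div_mul_cancel hp1.ne', Real.rpow_one]
    · intro t
      have hcl := (hE.clarkson u hu (t • v) (D.smul_mem t hv)).2 h2
      rw [hE.energy_smul hp _ hv, Real.mul_rpow (by positivity) hEv,
        ← Real.rpow_mul (abs_nonneg t), mul_one_div] at hcl
      simpa [sub_eq_add_neg] using hcl

lemma hasDerivAt_line (hE : ClarksonEnergy p D E)
    {u v : M → ℝ} (hu : u ∈ D) (hv : v ∈ D) :
    HasDerivAt (fun t : ℝ => E (u + t • v)) (p * pair p E u v) 0 := by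
  have hp := hE.one_lt
  refine (hE.differentiableAt_line hu hv).hasDerivAt.congr_deriv ?_
  unfold pair
  field_simp

lemma pair_eq_of_hasDerivAt (hp : 1 < p) {u v : M → ℝ} {a : ℝ}
    (h : HasDerivAt (fun t : ℝ => E (u + t • v)) (p * a) 0) : pair p E u v = a := by
  unfold pair
  rw [h.deriv]
  field_simp

/-- Convexity: the tangent line at `u` lies below the energy. -/
lemma pair_le (hE : ClarksonEnergy p D E)
    {u v : M → ℝ} (hu : u ∈ D) (hv : v ∈ D) {t : ℝ} :
    p * (t * pair p E u v) ≤ E (u + t • v) - E u := by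
  have hp := hE.one_lt
  have hd := hE.hasDerivAt_line hu hv
  have hc := hE.convexOn_line hp hu hv
  rcases lt_trichotomy t 0 with ht | rfl | ht
  · have := hc.slope_le_of_hasDerivAt (Set.mem_univ t) (Set.mem_univ 0) ht hd
    rw [slope_def_field, div_le_iff₀ (by linarith)] at this
    simp at this
    linarith
  · simp
  · have := hc.le_slope_of_hasDerivAt (Set.mem_univ 0) (Set.mem_univ t) ht hd
    rw [slope_def_field, le_div_iff₀ (by linarith)] at this
    simp at this
    linarith

lemma pair_smul_right (hE : ClarksonEnergy p D E)
    {u v : M → ℝ} (hu : u ∈ D) (hv : v ∈ D) (a : ℝ) :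
    pair p E u (a • v) = a * pair p E u v := by
  have hp := hE.one_lt
  apply pair_eq_of_hasDerivAt hp
  have hd := hE.hasDerivAt_line hu hv
  have h0 : HasDerivAt (fun t : ℝ => E (u + t • v)) (p * pair p E u v) (0 * a) := by simpa using hd
  have := h0.comp (0 : ℝ) ((hasDerivAt_id (0 : ℝ)).mul_const a)
  exact hasDerivAt_of_eq this (fun t => by simp [smul_smul]) (by ring)

lemma pair_neg_right (hE : ClarksonEnergy p D E)
    {u v : M → ℝ} (hu : u ∈ D) (hv : v ∈ D) :
    pair p E u (-v) = - pair p E u v := by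
  simpa using hE.pair_smul_right hu hv (-1)

lemma pair_add_right_le (hE : ClarksonEnergy p D E)
    {u v w : M → ℝ} (hu : u ∈ D) (hv : v ∈ D) (hw : w ∈ D) :
    pair p E u (v + w) ≤ pair p E u v + pair p E u w := by
  have hp := hE.one_lt
  have h1 := hE.hasDerivAt_line hu (D.add_mem hv hw)
  have h2 := hE.hasDerivAt_line hu (D.smul_mem 2 hv)
  have h3 := hE.hasDerivAt_line hu (D.smul_mem 2 hw)
  rw [hE.pair_smul_right hu hv] at h2
  rw [hE.pair_smul_right hu hw] at h3
  have h4 := ((h2.const_mul (1 / 2)).add (h3.const_mul (1 / 2))).sub h1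
  have h5 := (h4.hasDerivWithinAt (s := Set.Ioi 0))
  rw [hasDerivWithinAt_iff_tendsto_slope' (by simp)] at h5
  have : 0 ≤ 1 / 2 * (p * (2 * pair p E u v)) + 1 / 2 * (p * (2 * pair p E u w)) -
      p * pair p E u (v + w) := by
    refine ge_of_tendsto h5 ?_
    filter_upwards [self_mem_nhdsWithin] with t ht
    have ht' : (0 : ℝ) < t := ht
    rw [slope_def_field]
    apply div_nonneg _ (by linarith)
    have := hE.convex_combo hp (IsEnergyOn.line_mem hu (D.smul_mem 2 hv) t)
      (IsEnergyOn.line_mem hu (D.smul_mem 2 hw) t)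
      (a := 1 / 2) (b := 1 / 2) (by norm_num) (by norm_num) (by norm_num)
    have e : (1 / 2 : ℝ) • (u + t • (2 : ℝ) • v) + (1 / 2 : ℝ) • (u + t • (2 : ℝ) • w)
        = u + t • (v + w) := by
      ext x; simp; ring
    rw [e] at this
    simp only [Pi.add_apply, Pi.sub_apply, zero_smul, add_zero]
    linarith
  have hp0 : 0 < p := by linarith
  nlinarith

lemma pair_add_right (hE : ClarksonEnergy p D E)
    {u v w : M → ℝ} (hu : u ∈ D) (hv : v ∈ D) (hw : w ∈ D) :
    pair p E u (v + w) = pair p E u v + pair p E u w := by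
  refine le_antisymm (hE.pair_add_right_le hu hv hw) ?_
  have := hE.pair_add_right_le hu (D.neg_mem hv) (D.neg_mem hw)
  rw [← neg_add, hE.pair_neg_right hu (D.add_mem hv hw), hE.pair_neg_right hu hv,
    hE.pair_neg_right hu hw] at this
  linarith

lemma pair_sub_right (hE : ClarksonEnergy p D E)
    {u v w : M → ℝ} (hu : u ∈ D) (hv : v ∈ D) (hw : w ∈ D) :
    pair p E u (v - w) = pair p E u v - pair p E u w := by
  rw [sub_eq_add_neg, hE.pair_add_right hu hv (D.neg_mem hw), hE.pair_neg_right hu hw,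
    sub_eq_add_neg]

lemma pair_self (hE : ClarksonEnergy p D E) {u : M → ℝ} (hu : u ∈ D) :
    pair p E u u = E u := by
  have hp := hE.one_lt
  apply pair_eq_of_hasDerivAt hp
  have h1 : HasDerivAt (fun t : ℝ => (1 + t) ^ p * E u) (p * E u) 0 := by
    have := (((hasDerivAt_id (0 : ℝ)).const_add 1).rpow_const (p := p)
      (Or.inr hp.le)).mul_const (E u)
    simpa using this
  refine h1.congr_of_eventuallyEq ?_
  filter_upwards [lt_mem_nhds (show (-1 : ℝ) < 0 by norm_num)] with t ht
  have e : u + t • u = (1 + t) • u := by ext x; simp; ring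
  rw [e, hE.energy_smul hp _ hu, abs_of_nonneg (by linarith)]

lemma pair_smul_left (hE : ClarksonEnergy p D E)
    {u v : M → ℝ} (hu : u ∈ D) (hv : v ∈ D) {a : ℝ} (ha : 0 ≤ a) :
    pair p E (a • u) v = a ^ (p - 1) * pair p E u v := by
  have hp := hE.one_lt
  apply pair_eq_of_hasDerivAt hp
  rcases ha.eq_or_lt with rfl | ha
  · have h1 : HasDerivAt (fun t : ℝ => |t| ^ p * E v) 0 0 := by
      simpa using (hasDerivAt_abs_rpow 0 hp).mul_const (E v)
    have h2 : (0 : ℝ) ^ (p - 1) = 0 := Real.zero_rpow (by linarith)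
    simpa [h2, hE.energy_smul hp _ hv] using h1
  · have hd : HasDerivAt (fun t : ℝ => E (u + t • v)) (p * pair p E u v) (0 / a) := by
      simpa using hE.hasDerivAt_line hu hv
    have := (hd.comp (0 : ℝ) ((hasDerivAt_id (0 : ℝ)).div_const a)).const_mul (a ^ p)
    refine hasDerivAt_of_eq this (fun t => ?_) ?_
    · have e : a • u + t • v = a • (u + (t / a) • v) := by
        ext x; simp; field_simp
      rw [e, hE.energy_smul hp _ (IsEnergyOn.line_mem hu hv _), abs_of_pos ha]
      simp
    · rw [Real.rpow_sub_one ha.ne']; ring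

lemma pair_neg_left (hE : ClarksonEnergy p D E)
    {u v : M → ℝ} (hu : u ∈ D) (hv : v ∈ D) :
    pair p E (-u) v = - pair p E u v := by
  have hp := hE.one_lt
  rw [← hE.pair_neg_right hu hv]
  unfold pair
  congr 2
  ext t
  have e : -u + t • v = -(u + t • (-v)) := by ext x; simp; ring
  rw [e, hE.energy_neg hp (IsEnergyOn.line_mem hu (D.neg_mem hv) t)]

lemma pair_le_root (hE : ClarksonEnergy p D E)
    {u v : M → ℝ} (hu : u ∈ D) (hv : v ∈ D) :
    pair p E u v ≤ rootEnergy p E u ^ (p - 1) * rootEnergy p E v := by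
  have hp := hE.one_lt
  have h1 := hE.hasDerivAt_line hu hv
  set a := rootEnergy p E u
  set b := rootEnergy p E v
  have h2 : HasDerivAt (fun t : ℝ => (a + t * b) ^ p) (p * (a ^ (p - 1) * b)) 0 := by
    have := (((hasDerivAt_id (0 : ℝ)).mul_const b).const_add a).rpow_const (p := p) (Or.inr hp.le)
    exact hasDerivAt_of_eq this (fun t => by simp) (by simp; ring)
  have h5 := ((h2.sub h1).hasDerivWithinAt (s := Set.Ioi 0))
  rw [hasDerivWithinAt_iff_tendsto_slope' (by simp)] at h5
  have : 0 ≤ p * (a ^ (p - 1) * b) - p * pair p E u v := by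
    refine ge_of_tendsto h5 ?_
    filter_upwards [self_mem_nhdsWithin] with t ht
    have ht' : (0 : ℝ) < t := ht
    rw [slope_def_field]
    apply div_nonneg _ (by linarith)
    have h3 : E (u + t • v) ≤ (a + t * b) ^ p := by
      refine hE.energy_le_of_root_le hp (IsEnergyOn.line_mem hu hv t) ?_
      refine (hE.root_add_le hu (D.smul_mem t hv)).trans ?_
      rw [hE.root_smul t hv, abs_of_pos ht']
    have h4 : a ^ p = E u := hE.root_rpow hp hu
    simp [h4]
    linarith
  have hp0 : 0 < p := by linarith
  nlinarith

/-- Hölder's inequality `|E(u; v)| ≤ E(u)^{(p-1)/p} E(v)^{1/p}`. -/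
lemma abs_pair_le (hE : ClarksonEnergy p D E)
    {u v : M → ℝ} (hu : u ∈ D) (hv : v ∈ D) :
    |pair p E u v| ≤ rootEnergy p E u ^ (p - 1) * rootEnergy p E v := by
  refine abs_le'.2 ⟨hE.pair_le_root hu hv, ?_⟩
  rw [← hE.pair_neg_right hu hv, ← hE.root_neg hv]
  exact hE.pair_le_root hu (D.neg_mem hv)

lemma tendsto_energy (hE : ClarksonEnergy p D E) {u : M → ℝ} (hu : u ∈ D)
    {U : ℕ → M → ℝ} (hU : ∀ n, U n ∈ D)
    (h : Tendsto (fun n => rootEnergy p E (U n - u)) atTop (𝓝 0)) :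
    Tendsto (fun n => E (U n)) atTop (𝓝 (E u)) := by
  have hp := hE.one_lt
  have h1 : Tendsto (fun n => rootEnergy p E (U n)) atTop (𝓝 (rootEnergy p E u)) := by
    rw [tendsto_iff_dist_tendsto_zero]
    exact squeeze_zero (fun _ => dist_nonneg) (fun n => hE.abs_root_sub_root_le (hU n) hu) h
  have h2 := h1.rpow_const (p := p) (Or.inr (by linarith))
  simpa only [hE.root_rpow hp hu, fun n => hE.root_rpow hp (hU n)] using h2

/-- The pairing is continuous in its first argument. The upper bound on the limit comes from
difference quotients with a fixed increment `t > 0`, and the lower one by changing the sign of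
the second argument. -/
lemma tendsto_pair (hE : ClarksonEnergy p D E)
    {u g : M → ℝ} (hu : u ∈ D) (hg : g ∈ D) {U : ℕ → M → ℝ} (hU : ∀ n, U n ∈ D)
    (h : Tendsto (fun n => rootEnergy p E (U n - u)) atTop (𝓝 0)) :
    Tendsto (fun n => pair p E (U n) g) atTop (𝓝 (pair p E u g)) := by
  have hp := hE.one_lt
  have key : ∀ g ∈ D, ∀ ε > 0, ∀ᶠ n in atTop, pair p E (U n) g < pair p E u g + ε := by
    intro g hg ε hε
    have hd := (hE.hasDerivAt_line hu hg).hasDerivWithinAt (s := Set.Ioi 0)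
    rw [hasDerivWithinAt_iff_tendsto_slope' (by simp)] at hd
    have hp0 : 0 < p := by linarith
    have h1 := hd.eventually (gt_mem_nhds (show p * pair p E u g < p * (pair p E u g + ε) by
      nlinarith))
    obtain ⟨t, ht1, ht⟩ := (h1.and self_mem_nhdsWithin).exists
    have ht' : (0 : ℝ) < t := ht
    rw [slope_def_field, div_lt_iff₀ (by linarith)] at ht1
    simp only [zero_smul, add_zero, sub_zero] at ht1
    have h2 : Tendsto (fun n => E (U n + t • g) - E (U n)) atTop (𝓝 (E (u + t • g) - E u)) := by
      refine Tendsto.sub ?_ (hE.tendsto_energy hu hU h)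
      refine hE.tendsto_energy (IsEnergyOn.line_mem hu hg t)
        (fun n => IsEnergyOn.line_mem (hU n) hg t) ?_
      simpa using h
    filter_upwards [h2.eventually (gt_mem_nhds ht1)] with n hn
    have h3 := hE.pair_le (hU n) hg (t := t)
    have h4 : (p * t) * pair p E (U n) g < (p * t) * (pair p E u g + ε) := by
      nlinarith
    exact lt_of_mul_lt_mul_left h4 (by positivity)
  rw [Metric.tendsto_nhds]
  intro ε hε
  filter_upwards [key g hg ε hε, key (-g) (D.neg_mem hg) ε hε] with n h1 h2
  rw [hE.pair_neg_right hu hg, hE.pair_neg_right (hU n) hg] at h2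
  rw [Real.dist_eq, abs_lt]
  constructor <;> linarith

end ClarksonEnergy

/-! ### Strong locality and the Markovian property -/

variable {M : Type*}

/-- The strongly local part of a `p`-energy form on a space `D` of compactly supported continuous
functions which is uniformly dense in `C_c(M)`. -/
structure LocalForm [TopologicalSpace M] [MeasurableSpace M] (m : Measure M) (p : ℝ)
    (D : Submodule ℝ (M → ℝ)) (E : (M → ℝ) → ℝ) : Prop extends ClarksonEnergy p D E where
  stronglyLocal : StronglyLocal m D E
  markovian : IsMarkovian D E
  continuous : ∀ u ∈ D, Continuous u
  hasCompactSupport : ∀ u ∈ D, HasCompactSupport u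
  dense : ∀ g : M → ℝ, Continuous g → HasCompactSupport g →
    ∀ ε > 0, ∃ f ∈ D, ∀ x, |g x - f x| < ε

lemma MixedForm.localForm [MetricSpace M] [MeasurableSpace M] {m : Measure M} {p : ℝ} (hp : 1 < p)
    (𝓔 : MixedForm m p) : LocalForm m p (ccPart 𝓔.dom) (localPart p 𝓔.jump 𝓔.energy) where
  toIsEnergyOn := 𝓔.local_isEnergy
  one_lt := hp
  clarkson := 𝓔.local_clarkson
  stronglyLocal := 𝓔.local_stronglyLocal
  markovian := 𝓔.local_markovian
  continuous := fun _ hu => hu.2.1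
  hasCompactSupport := fun _ hu => hu.2.2
  dense := 𝓔.regular_cc

/-- `u` is separated from `v - a`: near every point, `u` vanishes or `v` is equal to `a`. -/
def Separated [TopologicalSpace M] (u v : M → ℝ) (a : ℝ) : Prop :=
  ∀ x, u =ᶠ[𝓝 x] 0 ∨ v =ᶠ[𝓝 x] fun _ => a

lemma Separated.smul_left [TopologicalSpace M] {u v : M → ℝ} {a : ℝ} (h : Separated u v a)
    (t : ℝ) : Separated (t • u) v a := fun x => (h x).imp_left fun h => by
  filter_upwards [h] with y hy
  simp [hy]

lemma Separated.smul_right [TopologicalSpace M] {u v : M → ℝ} {a : ℝ} (h : Separated u v a)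
    (t : ℝ) : Separated u (t • v) (t * a) := fun x => (h x).imp_right fun h => by
  filter_upwards [h] with y hy
  simp [hy]

lemma notMem_msupport [TopologicalSpace M] [MeasurableSpace M] [OpensMeasurableSpace M]
    {m : Measure M} {f : M → ℝ} {x : M} (h : f =ᶠ[𝓝 x] 0) : x ∉ msupport m f := by
  rw [msupport, Measure.notMem_support_iff_exists]
  obtain ⟨V, hV, hVo, hxV⟩ := eventually_nhds_iff.1 h
  refine ⟨V, hVo.mem_nhds hxV, ?_⟩
  rw [withDensity_apply _ hVo.measurableSet,
    setLIntegral_congr_fun (g := fun _ => 0) hVo.measurableSet (fun y hy => by simp [hV y hy])]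
  simp

namespace LocalForm

section Topological

variable [TopologicalSpace M] [MeasurableSpace M] [OpensMeasurableSpace M] {m : Measure M} {p : ℝ}
  {D : Submodule ℝ (M → ℝ)} {E : (M → ℝ) → ℝ}

lemma energy_add_of_separated (hE : LocalForm m p D E) {u v : M → ℝ} (hu : u ∈ D) (hv : v ∈ D)
    {a : ℝ} (h : Separated u v a) : E (u + v) = E u + E v := by
  have hc : ∀ w ∈ D, IsCompact (msupport m w) := fun w hw =>
    (hE.hasCompactSupport w hw).of_isClosed_subset Measure.isClosed_support fun x hx => by
      by_contra h'
      exact notMem_msupport (notMem_tsupport_iff_eventuallyEq.1 h') hx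
  refine hE.stronglyLocal u hu v hv (hc u hu) (hc v hv) (-a) ?_
  rw [Set.disjoint_left]
  intro x hxu hxv
  rcases h x with h | h
  · exact notMem_msupport h hxu
  · refine notMem_msupport ?_ hxv
    filter_upwards [h] with y hy
    simp [hy]

lemma pair_eq_zero_of_line (hE : LocalForm m p D E) {u v : M → ℝ} (hv : v ∈ D)
    (h : ∀ t : ℝ, E (u + t • v) = E u + E (t • v)) : pair p E u v = 0 := by
  apply ClarksonEnergy.pair_eq_of_hasDerivAt hE.one_lt
  have h1 : HasDerivAt (fun t : ℝ => E u + |t| ^ p * E v) 0 0 := by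
    simpa using ((hasDerivAt_abs_rpow 0 hE.one_lt).mul_const (E v)).const_add (E u)
  exact hasDerivAt_of_eq h1 (fun t => by rw [h, hE.energy_smul hE.one_lt _ hv]) (by simp)

lemma pair_eq_zero (hE : LocalForm m p D E) {u v : M → ℝ} (hu : u ∈ D) (hv : v ∈ D)
    {a : ℝ} (h : Separated u v a) : pair p E u v = 0 :=
  hE.pair_eq_zero_of_line hv fun t =>
    hE.energy_add_of_separated hu (D.smul_mem t hv) (h.smul_right t)

lemma pair_eq_zero' (hE : LocalForm m p D E) {u v : M → ℝ} (hu : u ∈ D) (hv : v ∈ D)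
    {a : ℝ} (h : Separated v u a) : pair p E u v = 0 :=
  hE.pair_eq_zero_of_line hv fun t => by
    rw [add_comm, hE.energy_add_of_separated (D.smul_mem t hv) hu (h.smul_left t), add_comm]

/-- The Markovian property for a function which is only Lipschitz, with an arbitrary constant, on
an interval that contains the range of `u`. -/
lemma comp_mem_and_root_comp_le (hE : LocalForm m p D E) {u : M → ℝ} (hu : u ∈ D) {ψ : ℝ → ℝ}
    {A B L : ℝ} (hA : A ≤ 0) (hB : 0 ≤ B) (hL : 0 ≤ L) (hr : ∀ x, u x ∈ Set.Icc A B)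
    (h0 : ψ 0 = 0)
    (hψ : ∀ s ∈ Set.Icc A B, ∀ t ∈ Set.Icc A B, |ψ s - ψ t| ≤ L * |s - t|) :
    ψ ∘ u ∈ D ∧ rootEnergy p E (ψ ∘ u) ≤ L * rootEnergy p E u := by
  have hAB : A ≤ B := hA.trans hB
  have h0m : (0 : ℝ) ∈ Set.Icc A B := ⟨hA, hB⟩
  rcases hL.eq_or_lt with rfl | hL
  · have : ψ ∘ u = 0 := by
      ext x
      have := hψ (u x) (hr x) 0 h0m
      rw [h0, zero_mul, sub_zero] at this
      simpa using abs_nonpos_iff.1 this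
    rw [this]
    exact ⟨D.zero_mem, by simp [hE.root_zero]⟩
  · set χ : ℝ → ℝ := fun s => L⁻¹ * ψ (Set.projIcc A B hAB s) with hχ
    have hχL : ∀ s t, |χ s - χ t| ≤ |s - t| := by
      intro s t
      have h1 := hψ _ (Set.projIcc A B hAB s).2 _ (Set.projIcc A B hAB t).2
      have h2 : |(Set.projIcc A B hAB s : ℝ) - Set.projIcc A B hAB t| ≤ |s - t| :=
        Set.abs_projIcc_sub_projIcc hAB
      simp only [hχ]
      rw [← mul_sub, abs_mul, abs_of_pos (inv_pos.2 hL), inv_mul_le_iff₀ hL]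
      exact h1.trans (by gcongr)
    have hχc : Continuous χ := by
      have : LipschitzWith 1 χ := LipschitzWith.of_dist_le_mul fun s t => by
        simpa [Real.dist_eq] using hχL s t
      exact this.continuous
    have hχ0 : χ 0 = 0 := by
      simp [hχ, Set.projIcc_of_mem hAB h0m, h0]
    have hχu : ψ ∘ u = L • (χ ∘ u) := by
      ext x
      simp [hχ, Set.projIcc_of_mem hAB (hr x), hL.ne']
    obtain ⟨h1, h2⟩ := hE.markovian χ hχc hχ0 hχL u hu
    rw [hχu]
    refine ⟨D.smul_mem L h1, ?_⟩
    rw [hE.root_smul L h1, abs_of_pos hL]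
    gcongr
    exact hE.root_le_of_energy_le hE.one_lt h1 h2

lemma exists_bound (hE : LocalForm m p D E) {u : M → ℝ} (hu : u ∈ D) :
    ∃ B, 0 < B ∧ ∀ x, |u x| ≤ B := by
  obtain ⟨C, hC⟩ := (hE.hasCompactSupport u hu).exists_bound_of_continuous (hE.continuous u hu)
  exact ⟨max C 1, by positivity, fun x => (hC x).trans (le_max_left _ _)⟩

/-- Products of bounded functions, by polarization and the Markovian property for `s ↦ s ^ 2`. -/
lemma mul_mem_and_root_mul_le (hE : LocalForm m p D E) {u v : M → ℝ} (hu : u ∈ D) (hv : v ∈ D)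
    {A B : ℝ} (hA : 0 < A) (hB : 0 < B) (huA : ∀ x, |u x| ≤ A) (hvB : ∀ x, |v x| ≤ B) :
    u * v ∈ D ∧ rootEnergy p E (u * v) ≤ 2 * (B * rootEnergy p E u + A * rootEnergy p E v) := by
  have key : ∀ w ∈ D, (∀ x, |w x| ≤ 2) →
      (fun s : ℝ => s ^ 2) ∘ w ∈ D ∧ rootEnergy p E ((fun s : ℝ => s ^ 2) ∘ w) ≤
        4 * rootEnergy p E w := by
    intro w hw hw2
    refine hE.comp_mem_and_root_comp_le hw (A := -2) (B := 2) (by norm_num) (by norm_num)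
      (by norm_num) (fun x => abs_le.1 (hw2 x)) (by norm_num) ?_
    intro s hs t ht
    have e : s ^ 2 - t ^ 2 = (s + t) * (s - t) := by ring
    rw [e, abs_mul]
    gcongr
    rw [abs_le]
    constructor <;> linarith [hs.1, hs.2, ht.1, ht.2]
  have hu' : A⁻¹ • u ∈ D := D.smul_mem _ hu
  have hv' : B⁻¹ • v ∈ D := D.smul_mem _ hv
  have hu1 : ∀ x, |(A⁻¹ • u) x| ≤ 1 := fun x => by
    rw [Pi.smul_apply, smul_eq_mul, abs_mul, abs_of_pos (inv_pos.2 hA), inv_mul_le_iff₀ hA]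
    simpa using huA x
  have hv1 : ∀ x, |(B⁻¹ • v) x| ≤ 1 := fun x => by
    rw [Pi.smul_apply, smul_eq_mul, abs_mul, abs_of_pos (inv_pos.2 hB), inv_mul_le_iff₀ hB]
    simpa using hvB x
  obtain ⟨p1, p2⟩ := key _ (D.add_mem hu' hv') fun x =>
    (abs_add_le _ _).trans (by linarith [hu1 x, hv1 x])
  obtain ⟨q1, q2⟩ := key _ (D.sub_mem hu' hv') fun x =>
    (abs_sub _ _).trans (by linarith [hu1 x, hv1 x])
  set P := (fun s : ℝ => s ^ 2) ∘ (A⁻¹ • u + B⁻¹ • v)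
  set Q := (fun s : ℝ => s ^ 2) ∘ (A⁻¹ • u - B⁻¹ • v)
  have e : u * v = (A * B / 4) • (P - Q) := by
    ext x
    simp [P, Q]
    field_simp
    ring
  have hPQ := D.sub_mem p1 q1
  rw [e]
  refine ⟨D.smul_mem _ hPQ, ?_⟩
  rw [hE.root_smul _ hPQ, abs_of_pos (by positivity)]
  have h1 := hE.root_sub_le p1 q1
  have h2 := hE.root_add_le hu' hv'
  have h3 := hE.root_sub_le hu' hv'
  rw [hE.root_smul _ hu, hE.root_smul _ hv, abs_of_pos (inv_pos.2 hA),
    abs_of_pos (inv_pos.2 hB)] at h2 h3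
  calc A * B / 4 * rootEnergy p E (P - Q)
      ≤ A * B / 4 * (8 * (A⁻¹ * rootEnergy p E u + B⁻¹ * rootEnergy p E v)) := by
        gcongr
        linarith
    _ = _ := by field_simp; ring

lemma mul_mem (hE : LocalForm m p D E) {u v : M → ℝ} (hu : u ∈ D) (hv : v ∈ D) : u * v ∈ D := by
  obtain ⟨A, hA, huA⟩ := hE.exists_bound hu
  obtain ⟨B, hB, hvB⟩ := hE.exists_bound hv
  exact (hE.mul_mem_and_root_mul_le hu hv hA hB huA hvB).1

/-- The domain contains cutoff functions of compact sets in open sets. -/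
lemma exists_cutoff [T2Space M] [LocallyCompactSpace M] (hE : LocalForm m p D E) {K U : Set M}
    (hK : IsCompact K) (hU : IsOpen U) (hKU : K ⊆ U) :
    ∃ χ ∈ D, (∀ x, χ x ∈ Set.Icc (0 : ℝ) 1) ∧ (∀ x ∈ K, χ =ᶠ[𝓝 x] fun _ => 1) ∧
      ∀ x ∉ U, χ =ᶠ[𝓝 x] 0 := by
  obtain ⟨K₁, hK₁, hKK₁, hK₁U⟩ := exists_compact_between hK hU hKU
  obtain ⟨K₂, hK₂, hK₁K₂, hK₂U⟩ := exists_compact_between hK₁ hU hK₁U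
  obtain ⟨g, hg1, hg0, hgs, hg01⟩ := exists_continuous_one_zero_of_isCompact hK₁
    isOpen_interior.isClosed_compl (Set.disjoint_left.2 fun x hx hx' => hx' (hK₁K₂ hx))
  obtain ⟨f, hf, hfg⟩ := hE.dense g g.continuous hgs (1 / 4) (by norm_num)
  obtain ⟨B, hB, hfB⟩ := hE.exists_bound hf
  set ψ : ℝ → ℝ := fun s => max 0 (min 1 (2 * s - 1 / 2)) with hψ
  have h := hE.comp_mem_and_root_comp_le hf (ψ := ψ) (A := -B) (B := B) (L := 2) (by linarith)
    hB.le (by norm_num) (fun x => abs_le.1 (hfB x)) (by norm_num [hψ]) (by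
      intro s _ t _
      simp only [hψ]
      refine (abs_max_sub_max_le_max _ _ _ _).trans (max_le (by simp) ?_)
      refine (abs_min_sub_min_le_max _ _ _ _).trans (max_le (by simp) ?_)
      rw [show 2 * s - 1 / 2 - (2 * t - 1 / 2) = 2 * (s - t) by ring, abs_mul, abs_two])
  refine ⟨ψ ∘ f, h.1, fun x => ⟨le_max_left _ _, max_le zero_le_one (min_le_left _ _)⟩, ?_, ?_⟩
  · intro x hx
    filter_upwards [isOpen_interior.mem_nhds (hKK₁ hx)] with y hy
    have h1 := hfg y
    have h2 : g y = 1 := hg1 (interior_subset hy)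
    rw [h2, abs_lt] at h1
    simp only [Function.comp_apply, hψ]
    rw [min_eq_left (by linarith), max_eq_right zero_le_one]
  · intro x hx
    filter_upwards [hK₂.isClosed.isOpen_compl.mem_nhds (fun h => hx (hK₂U h))] with y hy
    have h1 := hfg y
    have h2 : g y = 0 := hg0 (fun h => hy (interior_subset h))
    rw [h2, abs_lt] at h1
    simp only [Function.comp_apply, hψ, Pi.zero_apply]
    exact max_eq_left ((min_le_right _ _).trans (by linarith))

lemma pair_congr_of_line (hE : LocalForm m p D E) {u w v : M → ℝ} (hu : u ∈ D) (hv : v ∈ D)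
    (c : ℝ) (h : ∀ t : ℝ, E (w + t • v) = E (u + t • v) + c) : pair p E w v = pair p E u v := by
  apply ClarksonEnergy.pair_eq_of_hasDerivAt hE.one_lt
  exact hasDerivAt_of_eq ((hE.hasDerivAt_line hu hv).add_const c) h rfl

/-- The pairing is additive in its first argument on separated functions: after multiplication
of the second argument by a cutoff function, only one of the two summands is felt. -/
lemma pair_add_left [T2Space M] [LocallyCompactSpace M] (hE : LocalForm m p D E) {u v g : M → ℝ}
    (hu : u ∈ D) (hv : v ∈ D) (hg : g ∈ D) {a : ℝ} (h : Separated u v a) :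
    pair p E (u + v) g = pair p E u g + pair p E v g := by
  set U : Set M := {x | v =ᶠ[𝓝 x] fun _ => a}
  have hUo : IsOpen U := isOpen_setOfPred_eventually_nhds
  obtain ⟨χ, hχ, -, hχ1, hχ0⟩ := hE.exists_cutoff (hE.hasCompactSupport u hu) hUo fun x hx =>
    (h x).resolve_left fun h' => notMem_tsupport_iff_eventuallyEq.2 h' hx
  have hχg : χ * g ∈ D := hE.mul_mem hχ hg
  have hχg' : g - χ * g ∈ D := D.sub_mem hg hχg
  have e1 : pair p E (u + v) (χ * g) = pair p E u (χ * g) := by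
    refine hE.pair_congr_of_line hu hχg (E v) fun t => ?_
    rw [add_right_comm]
    refine hE.energy_add_of_separated (IsEnergyOn.line_mem hu hχg t) hv (a := a) fun x => ?_
    by_cases hx : x ∈ U
    · exact Or.inr hx
    · left
      filter_upwards [(h x).resolve_right hx, hχ0 x hx] with y h1 h2
      simp [h1, h2]
  have hsep : ∀ t : ℝ, Separated u (v + t • (g - χ * g)) a := fun t x => by
    by_cases hx : x ∈ tsupport u
    · right
      filter_upwards [hχ1 x hx, (h x).resolve_left
        fun h' => notMem_tsupport_iff_eventuallyEq.2 h' hx] with y h1 h2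
      simp [h1, h2]
    · exact Or.inl (notMem_tsupport_iff_eventuallyEq.1 hx)
  have e2 : pair p E (u + v) (g - χ * g) = pair p E v (g - χ * g) := by
    refine hE.pair_congr_of_line hv hχg' (E u) fun t => ?_
    rw [add_assoc, hE.energy_add_of_separated hu (IsEnergyOn.line_mem hv hχg' t) (hsep t),
      add_comm]
  have e3 : pair p E u (g - χ * g) = 0 := by
    refine hE.pair_eq_zero hu hχg' (a := 0) fun x => ?_
    by_cases hx : x ∈ tsupport u
    · right
      filter_upwards [hχ1 x hx] with y h1
      simp [h1]
    · exact Or.inl (notMem_tsupport_iff_eventuallyEq.1 hx)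
  have e4 : pair p E v (χ * g) = 0 := by
    refine hE.pair_eq_zero' hv hχg (a := a) fun x => ?_
    by_cases hx : x ∈ U
    · exact Or.inr hx
    · left
      filter_upwards [hχ0 x hx] with y h2
      simp [h2]
  have hg' : g = χ * g + (g - χ * g) := by ring
  have f1 := hE.pair_add_right (D.add_mem hu hv) hχg hχg'
  have f2 := hE.pair_add_right hu hχg hχg'
  have f3 := hE.pair_add_right hv hχg hχg'
  rw [← hg'] at f1 f2 f3
  rw [f1, f2, f3, e1, e2, e3, e4]
  ring

end Topological

end LocalForm

/-! ### Slices of the range -/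

/-- The part of `x` between the levels `a` and `b`: for `a ≤ b` it increases from `0` to `b - a`
with slope one on `[a, b]`, and is constant elsewhere. -/
def slice (a b x : ℝ) : ℝ := min x b - min x a

section Slice

variable {a b c x y : ℝ}

lemma slice_nonneg (h : a ≤ b) : 0 ≤ slice a b x := sub_nonneg.2 (min_le_min_left x h)

lemma slice_le (h : a ≤ b) : slice a b x ≤ b - a := by
  unfold slice; rcases min_cases x b with h1 | h1 <;> rcases min_cases x a with h2 | h2 <;> linarith

lemma slice_of_le (h : a ≤ b) (hx : x ≤ a) : slice a b x = 0 := by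
  rw [slice, min_eq_left hx, min_eq_left (hx.trans h), sub_self]

lemma slice_of_ge (h : a ≤ b) (hx : b ≤ x) : slice a b x = b - a := by
  rw [slice, min_eq_right hx, min_eq_right (h.trans hx)]

lemma slice_add_slice : slice a b x + slice b c x = slice a c x := by
  unfold slice; ring

lemma slice_mono (h : a ≤ b) (hxy : y ≤ x) : slice a b y ≤ slice a b x := by
  unfold slice
  rcases min_cases x b with h1 | h1 <;> rcases min_cases x a with h2 | h2 <;>
    rcases min_cases y b with h3 | h3 <;> rcases min_cases y a with h4 | h4 <;> linarith

lemma slice_sub_slice_le (h : a ≤ b) (hxy : y ≤ x) : slice a b x - slice a b y ≤ x - y := by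
  unfold slice
  rcases min_cases x b with h1 | h1 <;> rcases min_cases x a with h2 | h2 <;>
    rcases min_cases y b with h3 | h3 <;> rcases min_cases y a with h4 | h4 <;> linarith

lemma slice_antitone {l : ℝ} (hl : 0 ≤ l) (hab : a ≤ b) :
    slice b (b + l) x ≤ slice a (a + l) x := by
  unfold slice
  rcases min_cases x (b + l) with h1 | h1 <;> rcases min_cases x b with h2 | h2 <;>
    rcases min_cases x (a + l) with h3 | h3 <;> rcases min_cases x a with h4 | h4 <;> linarith

lemma abs_slice_sub_slice_le (h : a ≤ b) : |slice a b x - slice a b y| ≤ |x - y| := by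
  rcases le_total y x with hxy | hxy
  · rw [abs_of_nonneg (sub_nonneg.2 (slice_mono h hxy)), abs_of_nonneg (sub_nonneg.2 hxy)]
    exact slice_sub_slice_le h hxy
  · rw [abs_sub_comm, abs_sub_comm x, abs_of_nonneg (sub_nonneg.2 (slice_mono h hxy)),
      abs_of_nonneg (sub_nonneg.2 hxy)]
    exact slice_sub_slice_le h hxy

end Slice

/-- The piecewise linear function with slope `s i` on `[i τ, i τ + l]` for `i < N` and slope zero
elsewhere. -/
def stair (τ l : ℝ) (N : ℕ) (s : ℕ → ℝ) (x : ℝ) : ℝ :=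
  ∑ i ∈ Finset.range N, s i * slice (i * τ) (i * τ + l) x

section Stair

variable {τ l x y : ℝ} {N : ℕ} {s : ℕ → ℝ}

lemma stair_succ : stair τ l (N + 1) s x =
    stair τ l N s x + s N * slice (N * τ) (N * τ + l) x := by
  rw [stair, Finset.sum_range_succ]; rfl

lemma stair_zero_right (hτ : 0 ≤ τ) (hl : 0 ≤ l) : stair τ l N s 0 = 0 :=
  Finset.sum_eq_zero fun i _ => by
    rw [slice_of_le (by linarith) (by positivity), mul_zero]

lemma sum_slice_sub_le (hτ : 0 ≤ τ) (hlτ : l ≤ τ) (hxy : y ≤ x) :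
    ∑ i ∈ Finset.range N, (slice (i * τ) (i * τ + l) x - slice (i * τ) (i * τ + l) y) ≤ x - y := by
  have key : ∑ i ∈ Finset.range N, (slice (i * τ) (i * τ + l) x - slice (i * τ) (i * τ + l) y) ≤
      slice 0 (N * τ) x - slice 0 (N * τ) y := by
    induction N with
    | zero => simp [slice]
    | succ N ih =>
      rw [Finset.sum_range_succ]
      have e : ∀ z, slice 0 ((N + 1 : ℕ) * τ) z = slice 0 (N * τ) z +
          slice (N * τ) (N * τ + l) z + slice (N * τ + l) ((N + 1 : ℕ) * τ) z := fun z => by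
        unfold slice; ring
      have h1 : slice (N * τ + l) ((N + 1 : ℕ) * τ) y ≤ slice (N * τ + l) ((N + 1 : ℕ) * τ) x :=
        slice_mono (by push_cast; linarith) hxy
      rw [e, e]
      linarith
  exact key.trans (slice_sub_slice_le (by positivity) hxy)

lemma abs_sum_slice_le {t : ℕ → ℝ} {S : ℝ} (hτ : 0 ≤ τ) (hlτ : l ≤ τ) (hxy : y ≤ x)
    (hS : 0 ≤ S) (ht : ∀ i < N, |t i| ≤
      S * (slice (i * τ) (i * τ + l) x - slice (i * τ) (i * τ + l) y)) :
    |∑ i ∈ Finset.range N, t i| ≤ S * |x - y| := by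
  rw [abs_of_nonneg (sub_nonneg.2 hxy)]
  calc |∑ i ∈ Finset.range N, t i| ≤ ∑ i ∈ Finset.range N, |t i| := Finset.abs_sum_le_sum_abs _ _
    _ ≤ ∑ i ∈ Finset.range N, S * (slice (i * τ) (i * τ + l) x - slice (i * τ) (i * τ + l) y) :=
        Finset.sum_le_sum fun i hi => ht i (Finset.mem_range.1 hi)
    _ ≤ _ := by
        rw [← Finset.mul_sum]
        exact mul_le_mul_of_nonneg_left (sum_slice_sub_le hτ hlτ hxy) hS

lemma abs_stair_sub_stair_le {S : ℝ} (hτ : 0 ≤ τ) (hl : 0 ≤ l) (hlτ : l ≤ τ)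
    (hS : 0 ≤ S) (hs : ∀ i < N, |s i| ≤ S) :
    |stair τ l N s x - stair τ l N s y| ≤ S * |x - y| := by
  wlog hxy : y ≤ x generalizing x y with H
  · rw [abs_sub_comm, abs_sub_comm x]
    exact H (le_of_not_ge hxy)
  unfold stair
  rw [← Finset.sum_sub_distrib]
  refine abs_sum_slice_le hτ hlτ hxy hS fun i hi => ?_
  rw [← mul_sub, abs_mul]
  have h := sub_nonneg.2 (slice_mono (a := i * τ) (b := i * τ + l) (by linarith) hxy)
  rw [abs_of_nonneg h]
  exact mul_le_mul_of_nonneg_right (hs i hi) h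

/-- Above its last step, a stair function is constant. -/
lemma stair_of_ge (hτ : 0 ≤ τ) (hl : 0 ≤ l) (hx : (N : ℝ) * τ ≤ x + (τ - l)) :
    stair τ l N s x = l * ∑ i ∈ Finset.range N, s i := by
  unfold stair
  rw [Finset.mul_sum]
  refine Finset.sum_congr rfl fun i hi => ?_
  have h1 : ((i : ℝ) + 1) * τ ≤ N * τ := by
    have : i + 1 ≤ N := Finset.mem_range.1 hi
    have : ((i + 1 : ℕ) : ℝ) ≤ N := by exact_mod_cast this
    push_cast at this
    gcongr
  rw [slice_of_ge (by linarith) (by linarith)]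
  ring

/-- Stair functions with the same slopes agree below the first step in which they differ. -/
lemma stair_sub_stair_of_le (hτ : 0 ≤ τ) (hl : 0 ≤ l) {n : ℕ} (hn : n ≤ N) (hx : x ≤ n * τ) :
    stair τ l N s x - stair τ l n s x = 0 := by
  unfold stair
  rw [sub_eq_zero, ← Finset.sum_range_add_sum_Ico _ hn, add_eq_left]
  refine Finset.sum_eq_zero fun i hi => ?_
  have h1 : (n : ℝ) * τ ≤ i * τ := by
    have : n ≤ i := (Finset.mem_Ico.1 hi).1
    gcongr
  rw [slice_of_le (by linarith) (by linarith), mul_zero]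

end Stair

/-- An alternating sum of a nonnegative antitone sequence lies between zero and its first term. -/
lemma alternating_sum_mem {t : ℕ → ℝ} (h0 : ∀ i, 0 ≤ t i) (ha : ∀ i, t (i + 1) ≤ t i) (N : ℕ) :
    0 ≤ ∑ i ∈ Finset.range N, (-1) ^ i * t i ∧ ∑ i ∈ Finset.range N, (-1) ^ i * t i ≤ t 0 := by
  induction N generalizing t with
  | zero => simpa using h0 0
  | succ N ih =>
    rw [Finset.sum_range_succ']
    have e : ∑ i ∈ Finset.range N, (-1 : ℝ) ^ (i + 1) * t (i + 1) =
        - ∑ i ∈ Finset.range N, (-1 : ℝ) ^ i * t (i + 1) := by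
      rw [← Finset.sum_neg_distrib]
      exact Finset.sum_congr rfl fun i _ => by ring
    obtain ⟨h1, h2⟩ := ih (t := fun i => t (i + 1)) (fun i => h0 _) fun i => ha _
    have h3 := ha 0
    rw [e]
    simp only [pow_zero, one_mul]
    simp only [zero_add] at h2 h3
    constructor <;> linarith

/-! ### Decomposition of the energy along the levels of a function -/

namespace LocalForm

variable {M : Type*} [TopologicalSpace M] [MeasurableSpace M] [OpensMeasurableSpace M]
  {m : Measure M} {p : ℝ} {D : Submodule ℝ (M → ℝ)} {E : (M → ℝ) → ℝ} {u : M → ℝ}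

lemma exists_upper_bound (hE : LocalForm m p D E) (hu : u ∈ D) (hu0 : ∀ x, 0 ≤ u x) :
    ∃ B, 0 < B ∧ ∀ x, u x ∈ Set.Icc 0 B := by
  obtain ⟨B, hB, h⟩ := hE.exists_bound hu
  exact ⟨B, hB, fun x => ⟨hu0 x, (le_abs_self _).trans (h x)⟩⟩

lemma comp_lipschitz (hE : LocalForm m p D E) (hu : u ∈ D) (hu0 : ∀ x, 0 ≤ u x) {ψ : ℝ → ℝ} {L : ℝ}
    (hL : 0 ≤ L) (h0 : ψ 0 = 0) (hψ : ∀ s t, |ψ s - ψ t| ≤ L * |s - t|) :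
    ψ ∘ u ∈ D ∧ rootEnergy p E (ψ ∘ u) ≤ L * rootEnergy p E u := by
  obtain ⟨B, hB, h⟩ := hE.exists_upper_bound hu hu0
  exact hE.comp_mem_and_root_comp_le hu le_rfl hB.le hL h h0 fun s _ t _ => hψ s t

lemma slice_comp (hE : LocalForm m p D E) (hu : u ∈ D) (hu0 : ∀ x, 0 ≤ u x) {a b : ℝ} (ha : 0 ≤ a)
    (hab : a ≤ b) : slice a b ∘ u ∈ D ∧ rootEnergy p E (slice a b ∘ u) ≤ rootEnergy p E u := by
  simpa using hE.comp_lipschitz hu hu0 zero_le_one (slice_of_le hab ha) fun s t => by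
    simpa using abs_slice_sub_slice_le hab

lemma slice_mem (hE : LocalForm m p D E) (hu : u ∈ D) (hu0 : ∀ x, 0 ≤ u x) {τ l : ℝ} (hτ : 0 ≤ τ)
    (hl : 0 ≤ l) (i : ℕ) : slice (i * τ) (i * τ + l) ∘ u ∈ D :=
  (hE.slice_comp hu hu0 (by positivity) (by linarith)).1

lemma stair_comp (hE : LocalForm m p D E) (hu : u ∈ D) (hu0 : ∀ x, 0 ≤ u x) {τ l S : ℝ} {N : ℕ}
    {s : ℕ → ℝ} (hτ : 0 ≤ τ) (hl : 0 ≤ l) (hlτ : l ≤ τ) (hS : 0 ≤ S) (hs : ∀ i < N, |s i| ≤ S) :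
    stair τ l N s ∘ u ∈ D ∧ rootEnergy p E (stair τ l N s ∘ u) ≤ S * rootEnergy p E u :=
  hE.comp_lipschitz hu hu0 hS (stair_zero_right hτ hl) fun _ _ =>
    abs_stair_sub_stair_le hτ hl hlτ hS hs

lemma stair_mem (hE : LocalForm m p D E) (hu : u ∈ D) (hu0 : ∀ x, 0 ≤ u x) {τ l : ℝ} (N : ℕ)
    (s : ℕ → ℝ) (hτ : 0 ≤ τ) (hl : 0 ≤ l) : stair τ l N s ∘ u ∈ D := by
  have e : stair τ l N s ∘ u =
      ∑ i ∈ Finset.range N, s i • (slice (i * τ) (i * τ + l) ∘ u) := by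
    ext x; simp [stair]
  rw [e]
  exact D.sum_mem fun i _ => D.smul_mem _ (hE.slice_mem hu hu0 hτ hl i)

/-- Since the steps of a stair function are separated by gaps, the pairing splits into the
contributions of the individual steps. -/
lemma pair_stair [T2Space M] [LocallyCompactSpace M] (hE : LocalForm m p D E) (hu : u ∈ D)
    (hu0 : ∀ x, 0 ≤ u x) {τ l : ℝ} (N : ℕ) (s : ℕ → ℝ) (hl : 0 ≤ l) (hlτ : l < τ) {g : M → ℝ}
    (hg : g ∈ D) :
    pair p E (stair τ l N s ∘ u) g =
      ∑ i ∈ Finset.range N, pair p E (s i • (slice (i * τ) (i * τ + l) ∘ u)) g := by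
  have hτ : 0 ≤ τ := hl.trans hlτ.le
  have hc := hE.continuous u hu
  induction N with
  | zero =>
    have e : stair τ l 0 s ∘ u = 0 := by ext x; simp [stair]
    rw [e, Finset.sum_range_zero]
    exact hE.pair_eq_zero D.zero_mem hg (a := 0) fun x => Or.inl EventuallyEq.rfl
  | succ N ih =>
    rw [Finset.sum_range_succ, ← ih, add_comm (pair p E _ _)]
    have e : stair τ l (N + 1) s ∘ u =
        s N • (slice (N * τ) (N * τ + l) ∘ u) + stair τ l N s ∘ u := by
      ext x
      simp only [Function.comp_apply, Pi.add_apply, Pi.smul_apply, smul_eq_mul, stair_succ]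
      ring
    rw [e]
    refine hE.pair_add_left (D.smul_mem _ (hE.slice_mem hu hu0 hτ hl N))
      (hE.stair_mem hu hu0 N s hτ hl) hg (a := l * ∑ i ∈ Finset.range N, s i) fun x => ?_
    rcases lt_or_ge (u x) (N * τ) with hx | hx
    · left
      filter_upwards [hc.continuousAt.eventually (gt_mem_nhds hx)] with y hy
      simp [slice_of_le (show (N : ℝ) * τ ≤ N * τ + l by linarith) hy.le]
    · right
      filter_upwards [hc.continuousAt.eventually
        (lt_mem_nhds (show (N : ℝ) * τ - (τ - l) < u x by linarith))] with y hy
      exact stair_of_ge hτ hl (by linarith)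

/-- The contributions of the steps are absolutely summable, as the signs can be absorbed into the
slopes of a stair function. -/
lemma sum_abs_pair_slice_le [T2Space M] [LocallyCompactSpace M] (hE : LocalForm m p D E)
    (hu : u ∈ D) (hu0 : ∀ x, 0 ≤ u x) {τ l : ℝ} (N : ℕ) (hl : 0 ≤ l) (hlτ : l < τ) {g : M → ℝ}
    (hg : g ∈ D) :
    ∑ i ∈ Finset.range N, |pair p E (slice (i * τ) (i * τ + l) ∘ u) g| ≤
      rootEnergy p E u ^ (p - 1) * rootEnergy p E g := by
  have hτ : 0 ≤ τ := hl.trans hlτ.le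
  set L : ℕ → ℝ := fun i => pair p E (slice (i * τ) (i * τ + l) ∘ u) g
  set s : ℕ → ℝ := fun i => if 0 ≤ L i then 1 else -1 with hs
  have hs1 : ∀ i, |s i| ≤ 1 := fun i => by
    simp only [hs]; split_ifs <;> simp
  obtain ⟨h1, h2⟩ := hE.stair_comp hu hu0 (N := N) hτ hl hlτ.le zero_le_one fun i _ => hs1 i
  have h3 : ∑ i ∈ Finset.range N, |L i| = pair p E (stair τ l N s ∘ u) g := by
    rw [hE.pair_stair hu hu0 N s hl hlτ hg]
    refine Finset.sum_congr rfl fun i _ => ?_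
    have hm := hE.slice_mem hu hu0 hτ hl i
    simp only [hs]
    split_ifs with h
    · rw [one_smul, abs_of_nonneg h]
    · rw [neg_one_smul, hE.pair_neg_left hm hg, abs_of_neg (not_le.1 h)]
  rw [h3]
  refine (hE.pair_le_root h1 hg).trans ?_
  have := hE.one_lt
  have h4 := hE.root_nonneg h1
  have h5 := hE.root_nonneg hg
  gcongr
  simpa using h2

/-- Only the `i`-th step of a stair function is felt by the energy of the `i`-th slice. -/
lemma pair_slice_stair_mul (hE : LocalForm m p D E)
    (hu : u ∈ D) (hu0 : ∀ x, 0 ≤ u x) {τ l : ℝ} {N : ℕ} (s : ℕ → ℝ) (hl : 0 ≤ l) (hlτ : l < τ)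
    {f : M → ℝ} (hf : f ∈ D) {i : ℕ} (hi : i < N) :
    pair p E (slice (i * τ) (i * τ + l) ∘ u) ((stair τ l N s ∘ u) * f) =
      l * (∑ j ∈ Finset.range i, s j) * pair p E (slice (i * τ) (i * τ + l) ∘ u) f +
      s i * pair p E (slice (i * τ) (i * τ + l) ∘ u) ((slice (i * τ) (i * τ + l) ∘ u) * f) := by
  have hτ : 0 ≤ τ := hl.trans hlτ.le
  have hc := hE.continuous u hu
  set w := slice (i * τ) (i * τ + l) ∘ u with hw
  set c := l * ∑ j ∈ Finset.range i, s j with hcdef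
  have hwD : w ∈ D := hE.slice_mem hu hu0 hτ hl i
  have hst := fun n => hE.stair_mem hu hu0 n s hτ hl
  have hlow : (stair τ l i s ∘ u) * f - c • f ∈ D :=
    D.sub_mem (hE.mul_mem (hst i) hf) (D.smul_mem _ hf)
  have hhigh : (stair τ l N s ∘ u - stair τ l (i + 1) s ∘ u) * f ∈ D :=
    hE.mul_mem (D.sub_mem (hst _) (hst _)) hf
  have hwf := hE.mul_mem hwD hf
  have e : (stair τ l N s ∘ u) * f = ((stair τ l i s ∘ u) * f - c • f) + c • f + s i • (w * f) +
      (stair τ l N s ∘ u - stair τ l (i + 1) s ∘ u) * f := by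
    ext x
    simp [stair_succ, hw]
    ring
  have z1 : pair p E w ((stair τ l i s ∘ u) * f - c • f) = 0 := by
    refine hE.pair_eq_zero' hwD hlow (a := 0) fun x => ?_
    rcases lt_or_ge (u x) (i * τ) with hx | hx
    · right
      filter_upwards [hc.continuousAt.eventually (gt_mem_nhds hx)] with y hy
      simp [hw, slice_of_le (show (i : ℝ) * τ ≤ i * τ + l by linarith) hy.le]
    · left
      filter_upwards [hc.continuousAt.eventually
        (lt_mem_nhds (show (i : ℝ) * τ - (τ - l) < u x by linarith))] with y hy
      simp [hcdef, stair_of_ge hτ hl (show (i : ℝ) * τ ≤ u y + (τ - l) by linarith)]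
  have z2 : pair p E w ((stair τ l N s ∘ u - stair τ l (i + 1) s ∘ u) * f) = 0 := by
    refine hE.pair_eq_zero' hwD hhigh (a := l) fun x => ?_
    rcases lt_or_ge (u x) ((i + 1 : ℕ) * τ) with hx | hx
    · left
      filter_upwards [hc.continuousAt.eventually (gt_mem_nhds hx)] with y hy
      simp [stair_sub_stair_of_le hτ hl (Nat.succ_le_of_lt hi) hy.le]
    · right
      push_cast at hx
      filter_upwards [hc.continuousAt.eventually
        (lt_mem_nhds (show (i : ℝ) * τ + l < u x by linarith))] with y hy
      simp [hw, slice_of_ge (show (i : ℝ) * τ ≤ i * τ + l by linarith) hy.le]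
  rw [e, hE.pair_add_right hwD (D.add_mem (D.add_mem hlow (D.smul_mem _ hf)) (D.smul_mem _ hwf))
    hhigh, hE.pair_add_right hwD (D.add_mem hlow (D.smul_mem _ hf)) (D.smul_mem _ hwf),
    hE.pair_add_right hwD hlow (D.smul_mem _ hf), z1, z2, hE.pair_smul_right hwD hf,
    hE.pair_smul_right hwD hwf]
  ring

end LocalForm

namespace LocalForm

variable {M : Type*} [TopologicalSpace M] [MeasurableSpace M] [OpensMeasurableSpace M]
  {m : Measure M} {p : ℝ} {D : Submodule ℝ (M → ℝ)} {E : (M → ℝ) → ℝ} {u : M → ℝ}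

/-! ### Generic levels -/

/-- Slices of the range of `u` at separated levels have additive energies. -/
lemma energy_slice_add_le (hE : LocalForm m p D E) (hu : u ∈ D) (hu0 : ∀ x, 0 ≤ u x) {s' s t : ℝ}
    (h0 : 0 ≤ s') (hs : s' < s) (ht : s ≤ t) :
    E (slice s t ∘ u) + E (slice 0 s' ∘ u) ≤ E (slice 0 t ∘ u) := by
  have hc := hE.continuous u hu
  have h0t : 0 ≤ t := by linarith
  have m1 := (hE.slice_comp hu hu0 (h0.trans hs.le) ht).1
  have m2 := (hE.slice_comp hu hu0 le_rfl h0).1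
  have m3 := (hE.slice_comp hu hu0 le_rfl h0t).1
  rw [← hE.energy_add_of_separated m1 m2 (a := s') fun x => ?_]
  · set G : ℝ → ℝ := fun x => slice s t x + slice 0 s' x with hG
    have hGL : ∀ x y, |G x - G y| ≤ |x - y| := by
      intro x y
      wlog hxy : y ≤ x generalizing x y with H
      · rw [abs_sub_comm, abs_sub_comm x]
        exact H _ _ (le_of_not_ge hxy)
      have e : ∀ z, G z = slice 0 t z - slice s' s z := fun z => by
        simp only [hG]; unfold slice; ring
      have i1 := slice_mono ht hxy
      have i2 := slice_mono h0 hxy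
      have i3 := slice_mono hs.le hxy
      have i4 := slice_sub_slice_le h0t hxy
      rw [abs_of_nonneg (sub_nonneg.2 hxy), abs_of_nonneg (by simp only [hG]; linarith), e, e]
      linarith
    have hGc : Continuous G := by
      have : LipschitzWith 1 G := LipschitzWith.of_dist_le_mul fun s t => by
        simpa [Real.dist_eq] using hGL s t
      exact this.continuous
    have hG0 : G 0 = 0 := by
      simp [hG, slice_of_le ht (h0.trans hs.le), slice_of_le h0 le_rfl]
    have e : slice s t ∘ u + slice 0 s' ∘ u = G ∘ (slice 0 t ∘ u) := by
      ext x
      have h1 : slice 0 t (u x) = min (u x) t := by simp [slice, hu0 x]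
      simp only [Pi.add_apply, Function.comp_apply, hG, h1]
      unfold slice
      rw [min_assoc, min_self, min_assoc, min_eq_right ht, min_assoc,
        min_eq_right (hs.le.trans ht), min_assoc, min_eq_right h0t]
    rw [e]
    exact (hE.markovian G hGc hG0 hGL _ m3).2
  · rcases lt_or_ge (u x) s with hx | hx
    · left
      filter_upwards [hc.continuousAt.eventually (gt_mem_nhds hx)] with y hy
      simp [slice_of_le ht hy.le]
    · right
      filter_upwards [hc.continuousAt.eventually (lt_mem_nhds (hs.trans_le hx))] with y hy
      simp [slice_of_ge h0 hy.le]

lemma monotone_energy_slice (hE : LocalForm m p D E) (hu : u ∈ D) (hu0 : ∀ x, 0 ≤ u x) :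
    Monotone fun t : ℝ => E (slice 0 (max t 0) ∘ u) := by
  intro s t hst
  have h0 : ∀ r : ℝ, 0 ≤ max r 0 := fun r => le_max_right _ _
  have hst' : max s 0 ≤ max t 0 := max_le_max_right 0 hst
  have m2 := (hE.slice_comp hu hu0 le_rfl (h0 t)).1
  have e : slice 0 (max s 0) ∘ u = slice 0 (max s 0) ∘ (slice 0 (max t 0) ∘ u) := by
    ext x
    have h1 : slice 0 (max t 0) (u x) = min (u x) (max t 0) := by simp [slice, hu0 x]
    simp only [Function.comp_apply, h1]
    unfold slice
    rw [min_assoc, min_eq_right hst', min_assoc, min_eq_right (h0 t)]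
  change E (slice 0 (max s 0) ∘ u) ≤ _
  rw [e]
  have hL : ∀ x y, |slice 0 (max s 0) x - slice 0 (max s 0) y| ≤ |x - y| := fun x y =>
    abs_slice_sub_slice_le (h0 s)
  refine (hE.markovian _ ?_ (slice_of_le (h0 s) le_rfl) hL _ m2).2
  have : LipschitzWith 1 (slice 0 (max s 0)) := LipschitzWith.of_dist_le_mul fun s t => by
    simpa [Real.dist_eq] using hL s t
  exact this.continuous

/-- At a continuity point `t` of the energy profile of `u`, thin slices below `t` have small
energy. -/
lemma eventually_root_slice_lt (hE : LocalForm m p D E) (hu : u ∈ D) (hu0 : ∀ x, 0 ≤ u x) {t ε : ℝ}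
    (ht : 0 < t) (hε : 0 < ε) (h : ContinuousAt (fun t : ℝ => E (slice 0 (max t 0) ∘ u)) t) :
    ∀ᶠ δ in 𝓝[>] (0 : ℝ), rootEnergy p E (slice (t - δ) t ∘ u) < ε := by
  set H := fun t : ℝ => E (slice 0 (max t 0) ∘ u) with hH
  have h1 : Tendsto (fun δ : ℝ => H t - H (t - 2 * δ)) (𝓝[>] 0) (𝓝 (H t - H t)) := by
    refine Tendsto.sub tendsto_const_nhds ?_
    have : Tendsto (fun δ : ℝ => t - 2 * δ) (𝓝[>] 0) (𝓝 t) := by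
      have : Continuous fun δ : ℝ => t - 2 * δ := by fun_prop
      have := this.tendsto 0
      simp only [mul_zero, sub_zero] at this
      exact this.mono_left nhdsWithin_le_nhds
    exact h.tendsto.comp this
  rw [sub_self] at h1
  have hε' : (0 : ℝ) < ε ^ p := by positivity
  filter_upwards [h1.eventually (gt_mem_nhds hε'), self_mem_nhdsWithin,
    nhdsWithin_le_nhds (gt_mem_nhds (show (0 : ℝ) < t / 2 by positivity))] with δ h2 h3 h4
  have h3' : (0 : ℝ) < δ := h3
  have h5 := hE.energy_slice_add_le hu hu0 (s' := t - 2 * δ) (s := t - δ) (t := t) (by linarith)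
    (by linarith) (by linarith)
  simp only [hH] at h2
  rw [max_eq_left ht.le, max_eq_left (by linarith : 0 ≤ t - 2 * δ)] at h2
  have hm := (hE.slice_comp hu hu0 (a := t - δ) (b := t) (by linarith) (by linarith)).1
  have h6 : rootEnergy p E (slice (t - δ) t ∘ u) ^ p < ε ^ p := by
    rw [hE.root_rpow hE.one_lt hm]
    linarith
  exact (Real.rpow_lt_rpow_iff (hE.root_nonneg hm) hε.le (by linarith [hE.one_lt])).1 h6

/-- A fine family of levels for a function `u` with values in `[0, B]`: the slices `[i τ, i τ + l]`
for `i < N` are separated by gaps `[i τ + l, (i + 1) τ]` that carry little energy of `u`. -/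
structure FineLevels (p : ℝ) (E : (M → ℝ) → ℝ) (u : M → ℝ) (B ε τ l : ℝ) (N : ℕ) : Prop where
  pos : 0 < l
  lt : l < τ
  mesh_lt : τ < ε
  le_top : B ≤ N * τ
  top_le : N * τ ≤ B + 1
  gap_lt : N * (τ - l) < ε
  root_lt : ∑ i ∈ Finset.range N, rootEnergy p E (slice (i * τ + l) (i * τ + τ) ∘ u) < ε

lemma exists_fineLevels (hE : LocalForm m p D E) (hu : u ∈ D) (hu0 : ∀ x, 0 ≤ u x) {B ε : ℝ}
    (hB : 0 < B) (hε : 0 < ε) : ∃ τ l N, FineLevels p E u B ε τ l N := by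
  set H := fun t : ℝ => E (slice 0 (max t 0) ∘ u)
  have hcount := (hE.monotone_energy_slice hu hu0).countable_not_continuousAt
  set S : Set ℝ := {x | ¬ContinuousAt H x}
  -- the multiples of all but countably many `τ` avoid the discontinuities of the energy profile
  set T : Set ℝ := ⋃ i : ℕ, (fun τ : ℝ => ((i : ℝ) + 1) * τ) ⁻¹' S
  have hT : T.Countable := Set.countable_iUnion fun i =>
    hcount.preimage (mul_right_injective₀ (by positivity))
  obtain ⟨τ, hτT, hτ0, hτ1⟩ := (hT.dense_compl ℝ).exists_between
    (show (0 : ℝ) < min ε 1 from lt_min hε one_pos)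
  have hτε : τ < ε := hτ1.trans_le (min_le_left _ _)
  have hτ1' : τ < 1 := hτ1.trans_le (min_le_right _ _)
  set N := ⌈B / τ⌉₊
  have hN1 : B ≤ N * τ := by
    rw [← div_le_iff₀ hτ0]; exact Nat.le_ceil _
  have hN2 : N * τ ≤ B + 1 := by
    have := Nat.ceil_lt_add_one (show 0 ≤ B / τ by positivity)
    have h2 : (N : ℝ) * τ ≤ (B / τ + 1) * τ := by gcongr
    rw [add_mul, div_mul_cancel₀ _ hτ0.ne'] at h2
    linarith
  have h1 : ∀ i ∈ Finset.range N, ∀ᶠ δ in 𝓝[>] (0 : ℝ),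
      rootEnergy p E (slice ((i + 1) * τ - δ) ((i + 1) * τ) ∘ u) < ε / (N + 1) := by
    intro i _
    refine hE.eventually_root_slice_lt hu hu0 (by positivity) (by positivity) ?_
    by_contra h
    exact hτT (Set.mem_iUnion.2 ⟨i, h⟩)
  have h2 := (Filter.eventually_all_finset _).2 h1
  have h3 : ∀ᶠ δ in 𝓝[>] (0 : ℝ), δ < min τ (ε / (N + 1)) :=
    nhdsWithin_le_nhds (gt_mem_nhds (by positivity))
  obtain ⟨δ, ⟨h4, h5⟩, h6⟩ := ((h2.and h3).and self_mem_nhdsWithin).exists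
  have hδ0 : (0 : ℝ) < δ := h6
  have hδτ := h5.trans_le (min_le_left _ _)
  have hδN := h5.trans_le (min_le_right _ _)
  have hlt : (N : ℝ) * (ε / (N + 1)) < ε := by
    rw [mul_div_assoc', div_lt_iff₀ (by positivity)]
    nlinarith
  refine ⟨τ, τ - δ, N, by linarith, by linarith, hτε, hN1, hN2, ?_, ?_⟩
  · rw [sub_sub_cancel]
    refine lt_of_le_of_lt ?_ hlt
    gcongr
  · refine lt_of_le_of_lt (Finset.sum_le_sum (g := fun _ => ε / (N + 1)) fun i hi => ?_) ?_
    · have := h4 i hi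
      rw [show (i : ℝ) * τ + (τ - δ) = (i + 1) * τ - δ by ring,
        show (i : ℝ) * τ + τ = (i + 1) * τ by ring]
      exact this.le
    · rw [Finset.sum_const, Finset.card_range, nsmul_eq_mul]
      exact hlt

lemma comp_min_sub_comp_min {ψ : ℝ → ℝ} {a b x : ℝ} (h : a ≤ b) :
    ψ (min x b) - ψ (min x a) = ψ (a + slice a b x) - ψ a := by
  rcases le_total x a with hx | hx
  · rw [slice_of_le h hx, min_eq_left hx, min_eq_left (hx.trans h), add_zero, sub_self, sub_self]
  · rw [slice, min_eq_right hx, add_sub_cancel]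

/-- A function `ψ` of `u` is close in energy to the stair function whose slopes approximate the
derivative of `ψ`. -/
lemma FineLevels.comp_sub_stair (hE : LocalForm m p D E) (hu : u ∈ D) (hu0 : ∀ x, 0 ≤ u x)
    {B ε τ l : ℝ} {N : ℕ} (hF : FineLevels p E u B ε τ l N) (huB : ∀ x, u x ≤ B) {ψ : ℝ → ℝ}
    {s : ℕ → ℝ} {ω S : ℝ} (hω : 0 ≤ ω) (hS : 0 ≤ S) (h0 : ψ 0 = 0) (hs : ∀ i < N, |s i| ≤ S)
    (hψ : ∀ i < N, ∀ x ∈ Set.Icc (i * τ) (i * τ + τ), ∀ y ∈ Set.Icc (i * τ) (i * τ + τ),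
      |ψ x - ψ y - s i * (x - y)| ≤ ω * |x - y|) :
    ψ ∘ u ∈ D ∧ rootEnergy p E (ψ ∘ u - stair τ l N s ∘ u) ≤ ω * rootEnergy p E u + S * ε := by
  have hl := hF.pos
  have hlτ := hF.lt
  have hτ : 0 < τ := hl.trans hlτ
  have hst := hE.stair_mem hu hu0 N s hτ.le hl.le
  set G : ℝ → ℝ := fun x => ψ x - stair τ τ N s x with hG
  have hG1 : G ∘ u ∈ D ∧ rootEnergy p E (G ∘ u) ≤ ω * rootEnergy p E u := by
    refine hE.comp_mem_and_root_comp_le hu (A := 0) (B := N * τ) le_rfl (by positivity) hω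
      (fun x => ⟨hu0 x, (huB x).trans hF.le_top⟩) ?_ ?_
    · simp [hG, h0, stair_zero_right hτ.le hτ.le]
    · intro x hx y hy
      wlog hxy : y ≤ x generalizing x y with H
      · rw [abs_sub_comm, abs_sub_comm x]
        exact H _ hy _ hx (le_of_not_ge hxy)
      have tele : ∀ z ∈ Set.Icc 0 (N * τ), G z = ∑ i ∈ Finset.range N,
          (ψ (i * τ + slice (i * τ) (i * τ + τ) z) - ψ (i * τ)
            - s i * slice (i * τ) (i * τ + τ) z) := by
        intro z hz
        have h1 := Finset.sum_range_sub (fun i : ℕ => ψ (min z (i * τ))) N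
        simp only [Nat.cast_zero, zero_mul, min_eq_right hz.1, min_eq_left hz.2, h0,
          sub_zero] at h1
        rw [Finset.sum_sub_distrib]
        simp only [hG]
        congr 1
        rw [← h1]
        refine Finset.sum_congr rfl fun i _ => ?_
        rw [← comp_min_sub_comp_min (by linarith)]
        push_cast
        rw [add_mul, one_mul]
      rw [tele x hx, tele y hy, ← Finset.sum_sub_distrib]
      refine abs_sum_slice_le hτ.le le_rfl hxy hω fun i hi => ?_
      have hab : (i : ℝ) * τ ≤ i * τ + τ := by linarith
      have hm : ∀ z, i * τ + slice (i * τ) (i * τ + τ) z ∈ Set.Icc (i * τ) (i * τ + τ) :=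
        fun z => ⟨by linarith [slice_nonneg (x := z) hab], by linarith [slice_le (x := z) hab]⟩
      have h2 := hψ i hi _ (hm x) _ (hm y)
      rw [add_sub_add_left_eq_sub, abs_of_nonneg (sub_nonneg.2 (slice_mono hab hxy))] at h2
      refine le_trans (le_of_eq ?_) h2
      congr 1
      ring
  have hgap : ∀ i : ℕ, slice (i * τ + l) (i * τ + τ) ∘ u ∈ D := fun i =>
    (hE.slice_comp hu hu0 (by positivity) (by linarith)).1
  set R := ∑ i ∈ Finset.range N, s i • (slice (i * τ + l) (i * τ + τ) ∘ u)
  have hR : R ∈ D := D.sum_mem fun i _ => D.smul_mem _ (hgap i)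
  have e : ψ ∘ u - stair τ l N s ∘ u = G ∘ u + R := by
    ext x
    simp only [Pi.sub_apply, Function.comp_apply, hG, Pi.add_apply, R, Finset.sum_apply,
      Pi.smul_apply, smul_eq_mul]
    have : stair τ τ N s (u x) = stair τ l N s (u x) +
        ∑ i ∈ Finset.range N, s i * slice (i * τ + l) (i * τ + τ) (u x) := by
      unfold stair
      rw [← Finset.sum_add_distrib]
      refine Finset.sum_congr rfl fun i _ => ?_
      rw [← mul_add, slice_add_slice]
    rw [this]
    ring
  refine ⟨?_, ?_⟩
  · rw [sub_eq_iff_eq_add.1 e]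
    exact D.add_mem (D.add_mem hG1.1 hR) hst
  · rw [e]
    refine (hE.root_add_le hG1.1 hR).trans (add_le_add hG1.2 ?_)
    refine (hE.root_sum_le _ _ fun i _ => D.smul_mem _ (hgap i)).trans ?_
    calc _ ≤ ∑ i ∈ Finset.range N, S * rootEnergy p E (slice (i * τ + l) (i * τ + τ) ∘ u) := by
          refine Finset.sum_le_sum fun i hi => ?_
          rw [hE.root_smul _ (hgap i)]
          exact mul_le_mul_of_nonneg_right (hs i (Finset.mem_range.1 hi)) (hE.root_nonneg (hgap i))
      _ ≤ S * ε := by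
          rw [← Finset.mul_sum]
          exact mul_le_mul_of_nonneg_left hF.root_lt.le hS

/-- `u` itself is close in energy to the sum of its slices. -/
lemma FineLevels.sub_stair_one (hE : LocalForm m p D E) (hu : u ∈ D) (hu0 : ∀ x, 0 ≤ u x)
    {B ε τ l : ℝ} {N : ℕ} (hF : FineLevels p E u B ε τ l N) (huB : ∀ x, u x ≤ B) :
    rootEnergy p E (u - stair τ l N (fun _ => 1) ∘ u) ≤ ε := by
  simpa using (hF.comp_sub_stair hE hu hu0 huB (ψ := id) (s := fun _ => 1) (ω := 0) (S := 1)
    le_rfl zero_le_one rfl (fun _ _ => by simp) (fun i _ x _ y _ => by simp)).2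

end LocalForm

/-! ### Powers -/

/-- The function `x ↦ (x + a) ^ q - a ^ q`. -/
def powShift (q a x : ℝ) : ℝ := (x + a) ^ q - a ^ q

lemma powShift_zero_right (q a : ℝ) : powShift q a 0 = 0 := by simp [powShift]

lemma exists_abs_powShift_sub_le {q : ℝ} (hq : 1 < q) (a B : ℝ) {ω : ℝ} (hω : 0 < ω) :
    ∃ δ > 0, ∀ c τ : ℝ, 0 ≤ c → τ < δ → c + τ ≤ B → ∀ x ∈ Set.Icc c (c + τ),
      ∀ y ∈ Set.Icc c (c + τ),
        |powShift q a x - powShift q a y - q * (c + a) ^ (q - 1) * (x - y)| ≤ ω * |x - y| := by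
  have hcont : ContinuousOn (fun y : ℝ => q * (y + a) ^ (q - 1)) (Set.Icc 0 B) := by
    refine Continuous.continuousOn ?_
    exact continuous_const.mul ((continuous_id.add continuous_const).rpow_const
      fun x => Or.inr (by linarith))
  have huc := isCompact_Icc.uniformContinuousOn_of_continuous hcont
  obtain ⟨δ, hδ, h⟩ := Metric.uniformContinuousOn_iff.1 huc ω hω
  refine ⟨δ, hδ, fun c τ hc hτ hcB x hx y hy => ?_⟩
  have key := (convex_Icc c (c + τ)).norm_image_sub_le_of_norm_hasDerivWithin_le
    (f := fun z => powShift q a z - q * (c + a) ^ (q - 1) * z)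
    (f' := fun z => q * (z + a) ^ (q - 1) - q * (c + a) ^ (q - 1)) (C := ω)
    (fun z hz => ?_) (fun z hz => ?_) hy hx
  · rw [Real.norm_eq_abs, Real.norm_eq_abs] at key
    refine le_trans (le_of_eq ?_) key
    congr 1
    ring
  · apply HasDerivAt.hasDerivWithinAt
    have h1 : HasDerivAt (fun z : ℝ => (z + a) ^ q) (1 * q * (z + a) ^ (q - 1)) z :=
      ((hasDerivAt_id z).add_const a).rpow_const (Or.inr hq.le)
    have h2 := (h1.sub_const (a ^ q)).sub ((hasDerivAt_id z).const_mul (q * (c + a) ^ (q - 1)))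
    exact hasDerivAt_of_eq h2 (fun t => rfl) (by ring)
  · rw [← dist_eq_norm]
    refine (h z ⟨by linarith [hz.1], by linarith [hz.2]⟩ c ⟨hc, by linarith [hz.1, hz.2]⟩ ?_).le
    rw [Real.dist_eq, abs_of_nonneg (by linarith [hz.1])]
    linarith [hz.2]

/-! ### The energy functional -/

lemma const_mul_rpow_deriv {p y : ℝ} (hp : 1 < p) (hy : 0 ≤ y) :
    ((p - 1) / p) ^ (p - 1) * (p / (p - 1) * y ^ (p / (p - 1) - 1)) ^ (p - 1) = y := by
  have hp1 : 0 < p - 1 := by linarith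
  have hp0 : 0 < p := by linarith
  have e : (p / (p - 1) - 1) * (p - 1) = 1 := by field_simp; ring
  rw [Real.mul_rpow (by positivity) (by positivity), ← Real.rpow_mul hy, e, Real.rpow_one,
    ← mul_assoc, ← Real.mul_rpow (by positivity) (by positivity)]
  have : (p - 1) / p * (p / (p - 1)) = 1 := by field_simp
  rw [this, Real.one_rpow, one_mul]

lemma one_lt_conj {p : ℝ} (hp : 1 < p) : 1 < p / (p - 1) := by
  rw [lt_div_iff₀ (by linarith)]; linarith

/-- The functional `f ↦ E(u; u f) - ((p-1)/p)^{p-1} E(|u|^{p/(p-1)}; f)` that represents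
integration against the energy measure of `u`. -/
def energyFunctional {M : Type*} (p : ℝ) (E : (M → ℝ) → ℝ) (u f : M → ℝ) : ℝ :=
  pair p E u (u * f) - ((p - 1) / p) ^ (p - 1) * pair p E (fun x => |u x| ^ (p / (p - 1))) f

lemma abs_rpow_eq_powShift_comp {M : Type*} {p : ℝ} (hp : 1 < p) {u : M → ℝ} (hu0 : ∀ x, 0 ≤ u x) :
    (fun x => |u x| ^ (p / (p - 1))) = powShift (p / (p - 1)) 0 ∘ u := by
  ext x
  have := one_lt_conj hp
  simp [powShift, abs_of_nonneg (hu0 x), Real.zero_rpow (by linarith : p / (p - 1) ≠ 0)]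

namespace LocalForm

variable {M : Type*} [TopologicalSpace M] [MeasurableSpace M] [OpensMeasurableSpace M]
  {m : Measure M} {p : ℝ} {D : Submodule ℝ (M → ℝ)} {E : (M → ℝ) → ℝ} {u : M → ℝ}

/-- There are finer and finer levels for a nonnegative function. -/
lemma exists_fineLevels_seq (hE : LocalForm m p D E) (hu : u ∈ D) (hu0 : ∀ x, 0 ≤ u x) {B : ℝ}
    (hB : 0 < B) : ∃ (τ l : ℕ → ℝ) (N : ℕ → ℕ),
      ∀ k : ℕ, FineLevels p E u B (1 / ((k : ℝ) + 1)) (τ k) (l k) (N k) := by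
  choose τ l N h using fun k : ℕ =>
    hE.exists_fineLevels hu hu0 hB (show (0 : ℝ) < 1 / ((k : ℝ) + 1) by positivity)
  exact ⟨τ, l, N, h⟩

section Limits

variable {τ l : ℕ → ℝ} {N : ℕ → ℕ} {B : ℝ}

lemma powShift_comp_stair (hE : LocalForm m p D E) (hu : u ∈ D)
    (hu0 : ∀ x, 0 ≤ u x) (huB : ∀ x, u x ≤ B)
    (hF : ∀ k : ℕ, FineLevels p E u B (1 / ((k : ℝ) + 1)) (τ k) (l k) (N k)) {a : ℝ} (ha : 0 ≤ a) :
    powShift (p / (p - 1)) a ∘ u ∈ D ∧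
    Tendsto (fun k => rootEnergy p E (stair (τ k) (l k) (N k)
      (fun i => p / (p - 1) * (i * τ k + a) ^ (p / (p - 1) - 1)) ∘ u -
        powShift (p / (p - 1)) a ∘ u)) atTop (𝓝 0) := by
  have hp := hE.one_lt
  have hq := one_lt_conj hp
  set q := p / (p - 1)
  have hB1 : 0 ≤ B + 1 := by
    have := (hF 0).top_le
    have h1 := (hF 0).pos.trans (hF 0).lt
    exact le_trans (by positivity) this
  set S := q * (B + 1 + a) ^ (q - 1)
  have hS : 0 ≤ S := by positivity
  have hlim : Tendsto (fun k : ℕ => 1 / ((k : ℝ) + 1)) atTop (𝓝 0) :=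
    tendsto_one_div_add_atTop_nhds_zero_nat
  have key : ∀ ω > 0, ∀ᶠ k in atTop, powShift q a ∘ u ∈ D ∧
      rootEnergy p E (powShift q a ∘ u - stair (τ k) (l k) (N k)
        (fun i => q * (i * τ k + a) ^ (q - 1)) ∘ u) ≤
      ω * rootEnergy p E u + S * (1 / ((k : ℝ) + 1)) := by
    intro ω hω
    obtain ⟨δ, hδ, h⟩ := exists_abs_powShift_sub_le hq a (B + 1) hω
    filter_upwards [hlim.eventually (gt_mem_nhds hδ)] with k hk
    have hτ : 0 < τ k := (hF k).pos.trans (hF k).lt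
    have hi : ∀ i < N k, (i : ℝ) * τ k + τ k ≤ B + 1 := fun i hi => by
      refine le_trans ?_ (hF k).top_le
      have : ((i + 1 : ℕ) : ℝ) ≤ N k := by exact_mod_cast hi
      push_cast at this
      calc (i : ℝ) * τ k + τ k = (i + 1) * τ k := by ring
        _ ≤ _ := by gcongr
    refine (hF k).comp_sub_stair hE hu hu0 huB hω.le hS (powShift_zero_right q a) ?_ ?_
    · intro i hiN
      have := hi i hiN
      rw [abs_of_nonneg (by positivity)]
      have h3 : (i : ℝ) * τ k + a ≤ B + 1 + a := by linarith
      have : 0 ≤ q - 1 := by linarith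
      simp only [S]
      gcongr
    · intro i hiN x hx y hy
      exact h _ _ (by positivity) ((hF k).mesh_lt.trans hk) (hi i hiN) x hx y hy
  have hmem : powShift q a ∘ u ∈ D := (key 1 one_pos).exists.choose_spec.1
  refine ⟨hmem, ?_⟩
  have hst : ∀ k, stair (τ k) (l k) (N k) (fun i => q * (i * τ k + a) ^ (q - 1)) ∘ u ∈ D :=
    fun k => hE.stair_mem hu hu0 _ _ ((hF k).pos.trans (hF k).lt).le (hF k).pos.le
  rw [Metric.tendsto_nhds]
  intro η hη
  have hr := hE.root_nonneg hu
  have hω : 0 < η / (2 * (rootEnergy p E u + 1)) := by positivity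
  have h2 : Tendsto (fun k : ℕ => S * (1 / ((k : ℝ) + 1))) atTop (𝓝 (S * 0)) := hlim.const_mul S
  rw [mul_zero] at h2
  filter_upwards [key _ hω, h2.eventually (gt_mem_nhds (half_pos hη))] with k h3 h4
  have h5 := D.sub_mem hmem (hst k)
  rw [Real.dist_eq, sub_zero, ← neg_sub, hE.root_neg h5, abs_of_nonneg (hE.root_nonneg h5)]
  refine lt_of_le_of_lt h3.2 ?_
  have h6 : η / (2 * (rootEnergy p E u + 1)) * rootEnergy p E u ≤ η / 2 := by
    rw [div_mul_eq_mul_div, div_le_div_iff₀ (by positivity) (by positivity)]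
    nlinarith
  linarith

lemma powShift_comp_mem (hE : LocalForm m p D E) (hu : u ∈ D) (hu0 : ∀ x, 0 ≤ u x) {a : ℝ}
    (ha : 0 ≤ a) : powShift (p / (p - 1)) a ∘ u ∈ D := by
  obtain ⟨B, hB, huB⟩ := hE.exists_upper_bound hu hu0
  obtain ⟨τ, l, N, hF⟩ := hE.exists_fineLevels_seq hu hu0 hB
  exact (hE.powShift_comp_stair hu hu0 (fun x => (huB x).2) hF ha).1

lemma root_stair_one_le (hE : LocalForm m p D E) (hu : u ∈ D) (hu0 : ∀ x, 0 ≤ u x)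
    (hF : ∀ k : ℕ, FineLevels p E u B (1 / ((k : ℝ) + 1)) (τ k) (l k) (N k)) (k : ℕ) :
    rootEnergy p E (stair (τ k) (l k) (N k) (fun _ => 1) ∘ u) ≤ rootEnergy p E u := by
  simpa using (hE.stair_comp hu hu0 (N := N k) (s := fun _ => 1)
    ((hF k).pos.trans (hF k).lt).le (hF k).pos.le (hF k).lt.le zero_le_one fun _ _ => by simp).2

lemma tendsto_root_stair_one (hE : LocalForm m p D E) (hu : u ∈ D) (hu0 : ∀ x, 0 ≤ u x)
    (huB : ∀ x, u x ≤ B)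
    (hF : ∀ k : ℕ, FineLevels p E u B (1 / ((k : ℝ) + 1)) (τ k) (l k) (N k)) :
    Tendsto (fun k => rootEnergy p E (stair (τ k) (l k) (N k) (fun _ => 1) ∘ u - u))
      atTop (𝓝 0) := by
  have hst : ∀ k, stair (τ k) (l k) (N k) (fun _ => 1) ∘ u ∈ D :=
    fun k => hE.stair_mem hu hu0 _ _ ((hF k).pos.trans (hF k).lt).le (hF k).pos.le
  refine squeeze_zero (fun k => hE.root_nonneg (D.sub_mem (hst k) hu)) (fun k => ?_)
    tendsto_one_div_add_atTop_nhds_zero_nat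
  rw [← neg_sub, hE.root_neg (D.sub_mem hu (hst k))]
  exact (hF k).sub_stair_one hE hu hu0 huB

variable [T2Space M] [LocallyCompactSpace M]

lemma pair_stair_one (hE : LocalForm m p D E) (hu : u ∈ D) (hu0 : ∀ x, 0 ≤ u x)
    (hF : ∀ k : ℕ, FineLevels p E u B (1 / ((k : ℝ) + 1)) (τ k) (l k) (N k))
    {g : M → ℝ} (hg : g ∈ D)
    (k : ℕ) : pair p E (stair (τ k) (l k) (N k) (fun _ => 1) ∘ u) g = ∑ i ∈ Finset.range (N k),
      pair p E (slice (i * τ k) (i * τ k + l k) ∘ u) g := by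
  rw [hE.pair_stair hu hu0 _ _ (hF k).pos.le (hF k).lt hg]
  simp only [one_smul]

lemma tendsto_sum_pair (hE : LocalForm m p D E) (hu : u ∈ D) (hu0 : ∀ x, 0 ≤ u x)
    (huB : ∀ x, u x ≤ B)
    (hF : ∀ k : ℕ, FineLevels p E u B (1 / ((k : ℝ) + 1)) (τ k) (l k) (N k))
    {g : M → ℝ} (hg : g ∈ D) :
    Tendsto (fun k => ∑ i ∈ Finset.range (N k),
      pair p E (slice (i * τ k) (i * τ k + l k) ∘ u) g) atTop (𝓝 (pair p E u g)) := by
  simp only [← hE.pair_stair_one hu hu0 hF hg]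
  exact hE.tendsto_pair hu hg (fun k => hE.stair_mem hu hu0 _ _
    ((hF k).pos.trans (hF k).lt).le (hF k).pos.le) (hE.tendsto_root_stair_one hu hu0 huB hF)

/-- The chain rule for powers in discretized form. The exponent `p/(p-1)` is such that the
`(p-1)`-th power of the derivative is affine. -/
lemma tendsto_sum_pair_powShift (hE : LocalForm m p D E) (hu : u ∈ D) (hu0 : ∀ x, 0 ≤ u x)
    (huB : ∀ x, u x ≤ B)
    (hF : ∀ k : ℕ, FineLevels p E u B (1 / ((k : ℝ) + 1)) (τ k) (l k) (N k))
    {g : M → ℝ} (hg : g ∈ D)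
    {a : ℝ} (ha : 0 ≤ a) :
    Tendsto (fun k => ∑ i ∈ Finset.range (N k),
      (i * τ k + a) * pair p E (slice (i * τ k) (i * τ k + l k) ∘ u) g) atTop
      (𝓝 (((p - 1) / p) ^ (p - 1) * pair p E (powShift (p / (p - 1)) a ∘ u) g)) := by
  have hp := hE.one_lt
  obtain ⟨h1, h2⟩ := hE.powShift_comp_stair hu hu0 huB hF ha
  have h3 := (hE.tendsto_pair h1 hg (fun k => hE.stair_mem hu hu0 _ _
    ((hF k).pos.trans (hF k).lt).le (hF k).pos.le) h2).const_mul (((p - 1) / p) ^ (p - 1))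
  refine h3.congr fun k => ?_
  have hτ : 0 < τ k := (hF k).pos.trans (hF k).lt
  have hq := one_lt_conj hp
  rw [hE.pair_stair hu hu0 _ _ (hF k).pos.le (hF k).lt hg, Finset.mul_sum]
  refine Finset.sum_congr rfl fun i _ => ?_
  rw [hE.pair_smul_left (hE.slice_mem hu hu0 hτ.le (hF k).pos.le i) hg (by positivity),
    ← mul_assoc, const_mul_rpow_deriv hp (by positivity)]

/-- The effect of adding a constant before taking a power, an instance of the chain rule. -/
lemma pair_powShift (hE : LocalForm m p D E) (hu : u ∈ D) (hu0 : ∀ x, 0 ≤ u x) {g : M → ℝ}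
    (hg : g ∈ D) {a : ℝ} (ha : 0 ≤ a) :
    ((p - 1) / p) ^ (p - 1) * pair p E (powShift (p / (p - 1)) a ∘ u) g =
      ((p - 1) / p) ^ (p - 1) * pair p E (powShift (p / (p - 1)) 0 ∘ u) g + a * pair p E u g := by
  obtain ⟨B, hB, huB⟩ := hE.exists_upper_bound hu hu0
  obtain ⟨τ, l, N, hF⟩ := hE.exists_fineLevels_seq hu hu0 hB
  have hB' := fun x => (huB x).2
  refine tendsto_nhds_unique (hE.tendsto_sum_pair_powShift hu hu0 hB' hF hg ha) ?_
  refine ((hE.tendsto_sum_pair_powShift hu hu0 hB' hF hg le_rfl).add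
    ((hE.tendsto_sum_pair hu hu0 hB' hF hg).const_mul a)).congr fun k => ?_
  rw [Finset.mul_sum, ← Finset.sum_add_distrib]
  exact Finset.sum_congr rfl fun i _ => by ring

/-- Replacing `u` by its zigzag `w = ∑ (-1)^i u_i`, the alternating sum of its slices, changes
the energy functional by a small amount, although `w` is uniformly small. -/
lemma exists_zigzag (hE : LocalForm m p D E) (hu : u ∈ D) (hu0 : ∀ x, 0 ≤ u x)
    {f : M → ℝ} (hf : f ∈ D) :
    ∃ w : ℕ → M → ℝ, (∀ k, w k ∈ D) ∧ (∀ k x, 0 ≤ w k x ∧ w k x ≤ 1 / ((k : ℝ) + 1)) ∧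
      (∀ k, rootEnergy p E (w k) ≤ rootEnergy p E u) ∧
      Tendsto (fun k => pair p E (w k) (w k * f)) atTop (𝓝 (energyFunctional p E u f)) := by
  have hp := hE.one_lt
  obtain ⟨B, hB, huB'⟩ := hE.exists_upper_bound hu hu0
  have huB := fun x => (huB' x).2
  obtain ⟨τ, l, N, hF⟩ := hE.exists_fineLevels_seq hu hu0 hB
  obtain ⟨A, hA, hfA⟩ := hE.exists_bound hf
  have hl := fun k => (hF k).pos
  have hlτ := fun k => (hF k).lt
  have hτ : ∀ k, 0 < τ k := fun k => (hl k).trans (hlτ k)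
  set U : ℕ → M → ℝ := fun k => stair (τ k) (l k) (N k) (fun _ => 1) ∘ u with hU
  set w : ℕ → M → ℝ := fun k => stair (τ k) (l k) (N k) (fun i => (-1) ^ i) ∘ u with hw
  have hUD : ∀ k, U k ∈ D := fun k => hE.stair_mem hu hu0 _ _ (hτ k).le (hl k).le
  have hwD : ∀ k, w k ∈ D := fun k => hE.stair_mem hu hu0 _ _ (hτ k).le (hl k).le
  set L : ℕ → ℕ → ℝ := fun k i => pair p E (slice (i * τ k) (i * τ k + l k) ∘ u) f
  set Q : ℕ → ℕ → ℝ := fun k i => pair p E (slice (i * τ k) (i * τ k + l k) ∘ u)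
    ((slice (i * τ k) (i * τ k + l k) ∘ u) * f)
  have hlim : Tendsto (fun k : ℕ => 1 / ((k : ℝ) + 1)) atTop (𝓝 0) :=
    tendsto_one_div_add_atTop_nhds_zero_nat
  have hr := hE.root_nonneg hu
  have hrf := hE.root_nonneg hf
  refine ⟨w, hwD, fun k x => ?_, fun k => ?_, ?_⟩
  · have h1 := alternating_sum_mem (t := fun i => slice (i * τ k) (i * τ k + l k) (u x))
      (fun i => slice_nonneg (by linarith [hl k]))
      (fun i => slice_antitone (hl k).le (by push_cast; nlinarith [hτ k])) (N k)
    refine ⟨h1.1, h1.2.trans ?_⟩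
    refine (slice_le (by linarith [hl k])).trans ?_
    linarith [hlτ k, (hF k).mesh_lt]
  · simpa using (hE.stair_comp hu hu0 (N := N k) (s := fun i => (-1) ^ i) (hτ k).le (hl k).le
      (hlτ k).le zero_le_one fun i _ => by simp).2
  -- the pairing of the sum of the slices
  have hUU : ∀ k, pair p E (U k) (U k * f) =
      ∑ i ∈ Finset.range (N k), (l k * i * L k i + Q k i) := fun k => by
    rw [hU, hE.pair_stair_one hu hu0 hF (hE.mul_mem (hUD k) hf) k]
    refine Finset.sum_congr rfl fun i hi => ?_
    rw [hE.pair_slice_stair_mul hu hu0 _ (hl k).le (hlτ k) hf (Finset.mem_range.1 hi)]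
    simp [L, Q]
  -- the pairing of the zigzag
  have hww : ∀ k, pair p E (w k) (w k * f) = ∑ i ∈ Finset.range (N k),
      (l k * ((-1) ^ i * ∑ j ∈ Finset.range i, (-1) ^ j) * L k i + Q k i) := fun k => by
    rw [hw, hE.pair_stair hu hu0 _ _ (hl k).le (hlτ k) (hE.mul_mem (hwD k) hf)]
    refine Finset.sum_congr rfl fun i hi => ?_
    have hm := hE.slice_mem hu hu0 (hτ k).le (hl k).le i
    have h1 := hE.pair_slice_stair_mul hu hu0 (fun i => (-1) ^ i) (hl k).le (hlτ k) hf
      (Finset.mem_range.1 hi)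
    have h2 : pair p E ((-1 : ℝ) ^ i • (slice (i * τ k) (i * τ k + l k) ∘ u)) (w k * f) =
        (-1) ^ i * pair p E (slice (i * τ k) (i * τ k + l k) ∘ u) (w k * f) := by
      rcases neg_one_pow_eq_or ℝ i with h | h
      · simp [h]
      · rw [h, neg_one_smul, hE.pair_neg_left hm (hE.mul_mem (hwD k) hf)]; ring
    have h3 : ((-1 : ℝ) ^ i) * (-1) ^ i = 1 := by rw [← mul_pow]; simp
    rw [h2]
    simp only [hw]
    rw [h1]
    linear_combination Q k i * h3
  have hpar : ∀ i : ℕ, |(-1 : ℝ) ^ i * ∑ j ∈ Finset.range i, (-1 : ℝ) ^ j| ≤ 1 := fun i => by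
    have := alternating_sum_mem (t := fun _ => 1) (fun _ => zero_le_one) (fun _ => le_rfl) i
    simp only [mul_one] at this
    rw [abs_mul, abs_pow, abs_neg, abs_one, one_pow, one_mul, abs_of_nonneg this.1]
    exact this.2
  have t1 : Tendsto (fun k => pair p E (U k) (U k * f)) atTop (𝓝 (pair p E u (u * f))) := by
    have huf := hE.mul_mem hu hf
    have h1 := hE.tendsto_pair hu huf hUD (hE.tendsto_root_stair_one hu hu0 huB hF)
    have h2 : Tendsto (fun k => pair p E (U k) ((u - U k) * f)) atTop (𝓝 0) := by
      have hbd : Tendsto (fun k : ℕ => rootEnergy p E u ^ (p - 1) *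
          (2 * (A * (1 / ((k : ℝ) + 1)) + (1 / ((k : ℝ) + 1)) * rootEnergy p E f)))
          atTop (𝓝 (rootEnergy p E u ^ (p - 1) * (2 * (A * 0 + 0 * rootEnergy p E f)))) :=
        (((hlim.const_mul A).add (hlim.mul_const _)).const_mul 2).const_mul _
      simp only [mul_zero, zero_mul, add_zero] at hbd
      refine squeeze_zero_norm (fun k => ?_) hbd
      have hsub := D.sub_mem hu (hUD k)
      have hsmall : ∀ x, |(u - U k) x| ≤ 1 / ((k : ℝ) + 1) := fun x => by
        have e : (u - U k) x = ∑ i ∈ Finset.range (N k),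
            slice (i * τ k + l k) (i * τ k + τ k) (u x) := by
          have h3 := Finset.sum_range_sub (fun i : ℕ => min (u x) (i * τ k)) (N k)
          simp only [Nat.cast_zero, zero_mul, min_eq_right (hu0 x),
            min_eq_left ((huB x).trans (hF k).le_top), sub_zero] at h3
          simp only [Pi.sub_apply, hU, Function.comp_apply, stair, one_mul]
          refine (congrArg (· - _) h3.symm).trans ?_
          rw [← Finset.sum_sub_distrib]
          refine Finset.sum_congr rfl fun i _ => ?_
          unfold slice
          push_cast
          rw [add_mul, one_mul]
          ring
        have hpos : ∀ i : ℕ, i * τ k + l k ≤ i * τ k + τ k := fun i => by linarith [hlτ k]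
        rw [e, abs_of_nonneg (Finset.sum_nonneg fun i _ => slice_nonneg (hpos i))]
        refine (Finset.sum_le_sum (g := fun _ => τ k - l k) fun i _ =>
          (slice_le (hpos i)).trans (by linarith)).trans ?_
        rw [Finset.sum_const, Finset.card_range, nsmul_eq_mul]
        exact (hF k).gap_lt.le
      obtain ⟨h3, h4⟩ := hE.mul_mem_and_root_mul_le hsub hf
        (show (0 : ℝ) < 1 / ((k : ℝ) + 1) by positivity) hA hsmall hfA
      rw [Real.norm_eq_abs]
      refine (hE.abs_pair_le (hUD k) h3).trans ?_
      have h5 := (hF k).sub_stair_one hE hu hu0 huB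
      have h6 := hE.root_stair_one_le hu hu0 hF k
      have h7 := hE.root_nonneg (hUD k)
      have h8 := hE.root_nonneg h3
      have h9 : 0 ≤ p - 1 := by linarith
      refine mul_le_mul (Real.rpow_le_rpow h7 h6 h9) (h4.trans ?_) h8 (by positivity)
      gcongr
    have h3 := h1.sub h2
    rw [sub_zero] at h3
    refine h3.congr fun k => ?_
    have hk := hE.mul_mem (D.sub_mem hu (hUD k)) hf
    rw [← hE.pair_sub_right (hUD k) huf hk]
    congr 1
    ring
  have t2 := hE.tendsto_sum_pair_powShift hu hu0 huB hF hf le_rfl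
  have t3 : Tendsto (fun k => pair p E (w k) (w k * f) - (pair p E (U k) (U k * f) -
      ∑ i ∈ Finset.range (N k), (i * τ k + 0) * L k i)) atTop (𝓝 0) := by
    have hbd : Tendsto (fun k : ℕ => 2 * (1 / ((k : ℝ) + 1)) *
        (rootEnergy p E u ^ (p - 1) * rootEnergy p E f)) atTop
        (𝓝 (2 * 0 * (rootEnergy p E u ^ (p - 1) * rootEnergy p E f))) :=
      (hlim.const_mul 2).mul_const _
    simp only [mul_zero, zero_mul] at hbd
    refine squeeze_zero_norm (fun k => ?_) hbd
    have h1 := hE.sum_abs_pair_slice_le hu hu0 (N k) (hl k).le (hlτ k) hf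
    rw [hww, hUU, ← Finset.sum_sub_distrib, ← Finset.sum_sub_distrib, Real.norm_eq_abs]
    refine (Finset.abs_sum_le_sum_abs _ _).trans ?_
    have h2 : ∀ i ∈ Finset.range (N k),
        |l k * ((-1) ^ i * ∑ j ∈ Finset.range i, (-1) ^ j) * L k i + Q k i -
          (l k * i * L k i + Q k i - (i * τ k + 0) * L k i)| ≤
        2 * (1 / ((k : ℝ) + 1)) * |L k i| := by
      intro i hi
      have e : l k * ((-1) ^ i * ∑ j ∈ Finset.range i, (-1) ^ j) * L k i + Q k i -
          (l k * i * L k i + Q k i - (i * τ k + 0) * L k i) =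
          (l k * ((-1) ^ i * ∑ j ∈ Finset.range i, (-1) ^ j) + i * (τ k - l k)) * L k i := by ring
      rw [e, abs_mul]
      gcongr
      refine (abs_add_le _ _).trans ?_
      have h3 : (i : ℝ) ≤ N k := by exact_mod_cast (Finset.mem_range.1 hi).le
      have h4 : |(i : ℝ) * (τ k - l k)| ≤ 1 / ((k : ℝ) + 1) := by
        have h5 : 0 ≤ τ k - l k := by linarith [hlτ k]
        rw [abs_of_nonneg (by positivity)]
        exact le_trans (by gcongr) (hF k).gap_lt.le
      have h6 : |l k * ((-1 : ℝ) ^ i * ∑ j ∈ Finset.range i, (-1 : ℝ) ^ j)| ≤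
          1 / ((k : ℝ) + 1) := by
        rw [abs_mul, abs_of_pos (hl k)]
        have h7 : l k ≤ 1 / ((k : ℝ) + 1) := by linarith [hlτ k, (hF k).mesh_lt]
        calc l k * _ ≤ 1 / ((k : ℝ) + 1) * 1 := by
              gcongr
              exact hpar i
          _ = _ := mul_one _
      linarith
    refine (Finset.sum_le_sum h2).trans ?_
    rw [← Finset.mul_sum]
    gcongr
  have t4 := (t1.sub t2).add t3
  rw [add_zero] at t4
  rw [energyFunctional, abs_rpow_eq_powShift_comp hp hu0]
  refine t4.congr fun k => ?_
  ring

end Limits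

end LocalForm

/-! ### Positivity, additivity and locality of the energy functional -/

lemma rpow_add_sub_rpow_le {p a h : ℝ} (hp : 1 < p) (ha : 0 ≤ a) (hh : 0 ≤ h) :
    (a + h) ^ p - a ^ p ≤ p * (h * (a + h) ^ (p - 1)) := by
  rcases hh.eq_or_lt with rfl | hh
  · simp
  · have hd : HasDerivAt (fun x : ℝ => x ^ p) (p * (a + h) ^ (p - 1)) (a + h) :=
      Real.hasDerivAt_rpow_const (Or.inr hp.le)
    have := (convexOn_rpow hp.le).slope_le_of_hasDerivAt (x := a) (y := a + h) ha
      (by simp; positivity) (by linarith) hd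
    rw [slope_def_field, div_le_iff₀ (by linarith)] at this
    linarith

namespace LocalForm

variable {M : Type*} [TopologicalSpace M] [MeasurableSpace M] [OpensMeasurableSpace M]
  {m : Measure M} {p : ℝ} {D : Submodule ℝ (M → ℝ)} {E : (M → ℝ) → ℝ} {u : M → ℝ}

/-- A lower bound on `E(w; w f)` for `f ≥ 0` and small `w ≥ 0`. With `v = w + K f` and `R` an upper
bound for `v`, the function `v - v² / (2R)` is a normal contraction of `v`, so that
`w - v² / (2R)` has almost no more energy than `w`, and `E(w; v² / (2R))` is almost nonnegative
by convexity. When `w` is small with respect to `K`, the only terms of `v²` which count are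
`2 K w f` and `K² f²`, and the latter has little energy if `K` is small. -/
lemma le_pair_mul (hE : LocalForm m p D E) {w f : M → ℝ} (hw : w ∈ D) (hf : f ∈ D) {δ B K A : ℝ}
    (hδ : 0 < δ) (hB : 0 < B) (hK : 0 < K) (hwδ : ∀ x, 0 ≤ w x ∧ w x ≤ δ)
    (hfB : ∀ x, 0 ≤ f x ∧ f x ≤ B) (hA : rootEnergy p E w ≤ A) :
    -((B + δ / K) * (2 * K * rootEnergy p E f * (A + 2 * K * rootEnergy p E f) ^ (p - 1)) +
      2 * (δ / K) * A ^ p + K / 2 * (A ^ (p - 1) * rootEnergy p E (f * f))) ≤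
      pair p E w (w * f) := by
  have hp := hE.one_lt
  have hp1 : 0 ≤ p - 1 := by linarith
  set a := rootEnergy p E w with hadef
  set b := rootEnergy p E f
  have ha : 0 ≤ a := hE.root_nonneg hw
  have hA0 : 0 ≤ A := ha.trans hA
  have hb : 0 ≤ b := hE.root_nonneg hf
  set R := δ + K * B with hR
  have hR0 : 0 < R := by positivity
  set v := w + K • f with hv
  have hvD : v ∈ D := D.add_mem hw (D.smul_mem K hf)
  have hvR : ∀ x, v x ∈ Set.Icc 0 R := fun x => by
    simp only [hv, Pi.add_apply, Pi.smul_apply, smul_eq_mul]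
    have h1 := hwδ x
    have h2 := hfB x
    have h3 : K * f x ≤ K * B := by gcongr; exact h2.2
    have h4 : 0 ≤ K * f x := mul_nonneg hK.le h2.1
    exact ⟨by linarith, by linarith⟩
  set η : ℝ → ℝ := fun s => s - s ^ 2 / (2 * R) with hη
  obtain ⟨h1, h2⟩ := hE.comp_mem_and_root_comp_le hvD (ψ := η) le_rfl hR0.le zero_le_one hvR
    (by simp [hη]) (by
      intro s hs t ht
      have e : η s - η t = (1 - (s + t) / (2 * R)) * (s - t) := by
        simp only [hη]; field_simp; ring
      rw [e, abs_mul]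
      gcongr
      have h3 : 0 ≤ (s + t) / (2 * R) := by have := hs.1; have := ht.1; positivity
      have h4 : (s + t) / (2 * R) ≤ 1 := by
        rw [div_le_one (by positivity)]; linarith [hs.2, ht.2]
      rw [abs_le]
      constructor <;> linarith)
  rw [one_mul] at h2
  set T := v - η ∘ v with hT
  have hTD : T ∈ D := D.sub_mem hvD h1
  have hww := hE.mul_mem hw hw
  have hwf := hE.mul_mem hw hf
  have hff := hE.mul_mem hf hf
  have eT : T = (1 / (2 * R)) • (w * w) + (K / R) • (w * f) + (K ^ 2 / (2 * R)) • (f * f) := by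
    ext x
    simp [hT, hη, hv]
    field_simp
    ring
  -- the energy of `w - T`
  have e1 : w + (-1 : ℝ) • T = η ∘ v - K • f := by
    ext x; simp [hT, hv]; ring
  have h3 : rootEnergy p E (w + (-1 : ℝ) • T) ≤ a + 2 * K * b := by
    rw [e1]
    have h4 := hE.root_sub_le h1 (D.smul_mem K hf)
    have h5 := hE.root_add_le hw (D.smul_mem K hf)
    rw [hE.root_smul K hf, abs_of_pos hK] at h4 h5
    linarith
  have h4 := hE.energy_le_of_root_le hp (IsEnergyOn.line_mem hw hTD (-1)) h3
  have h5 := hE.pair_le hw hTD (t := -1)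
  have h6 := rpow_add_sub_rpow_le hp ha (show 0 ≤ 2 * K * b by positivity)
  have h7 : a ^ p = E w := hE.root_rpow hp hw
  have h8 : -(2 * K * b * (a + 2 * K * b) ^ (p - 1)) ≤ pair p E w T := by
    have h9 : p * (-(2 * K * b * (a + 2 * K * b) ^ (p - 1))) ≤ p * pair p E w T := by linarith
    exact le_of_mul_le_mul_left h9 (by linarith)
  have h9 : 2 * K * b * (a + 2 * K * b) ^ (p - 1) ≤ 2 * K * b * (A + 2 * K * b) ^ (p - 1) := by
    gcongr
  have h10 : pair p E w T = 1 / (2 * R) * pair p E w (w * w) + K / R * pair p E w (w * f) +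
      K ^ 2 / (2 * R) * pair p E w (f * f) := by
    rw [eT, hE.pair_add_right hw (D.add_mem (D.smul_mem _ hww) (D.smul_mem _ hwf))
      (D.smul_mem _ hff), hE.pair_add_right hw (D.smul_mem _ hww) (D.smul_mem _ hwf),
      hE.pair_smul_right hw hww, hE.pair_smul_right hw hwf, hE.pair_smul_right hw hff]
  have h11 : pair p E w (w * f) = (B + δ / K) * pair p E w T - 1 / (2 * K) * pair p E w (w * w) -
      K / 2 * pair p E w (f * f) := by
    have e2 : B + δ / K = R / K := by rw [hR]; field_simp; ring
    rw [h10, e2]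
    field_simp
    ring
  have h12 : pair p E w (w * w) ≤ 4 * δ * A ^ p := by
    refine (hE.pair_le_root hw hww).trans ?_
    have h13 := (hE.mul_mem_and_root_mul_le hw hw hδ hδ
      (fun x => by rw [abs_of_nonneg (hwδ x).1]; exact (hwδ x).2)
      (fun x => by rw [abs_of_nonneg (hwδ x).1]; exact (hwδ x).2)).2
    have h14 : A ^ p = A ^ (p - 1) * A := by
      rcases hA0.eq_or_lt with h | h
      · rw [← h, Real.zero_rpow (by linarith), mul_zero]
      · rw [← Real.rpow_add_one h.ne', sub_add_cancel]
    rw [h14]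
    calc a ^ (p - 1) * rootEnergy p E (w * w) ≤ A ^ (p - 1) * (2 * (δ * A + δ * A)) := by
          refine mul_le_mul (by gcongr) (h13.trans ?_) (hE.root_nonneg hww) (by positivity)
          gcongr
      _ = _ := by ring
  have h13 : pair p E w (f * f) ≤ A ^ (p - 1) * rootEnergy p E (f * f) := by
    refine (hE.pair_le_root hw hff).trans ?_
    have := hE.root_nonneg hff
    gcongr
  have h14 : 1 / (2 * K) * pair p E w (w * w) ≤ 2 * (δ / K) * A ^ p := by
    calc 1 / (2 * K) * pair p E w (w * w) ≤ 1 / (2 * K) * (4 * δ * A ^ p) := by gcongr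
      _ = _ := by field_simp; ring
  have h15 : K / 2 * pair p E w (f * f) ≤ K / 2 * (A ^ (p - 1) * rootEnergy p E (f * f)) := by
    gcongr
  have h16 : (B + δ / K) * (-(2 * K * b * (A + 2 * K * b) ^ (p - 1))) ≤
      (B + δ / K) * pair p E w T := by
    gcongr
    linarith
  rw [h11]
  linarith

lemma powShift_mem' (hE : LocalForm m p D E) (hu : u ∈ D) (hu0 : ∀ x, 0 ≤ u x) :
    (fun x => |u x| ^ (p / (p - 1))) ∈ D := by
  rw [abs_rpow_eq_powShift_comp hE.one_lt hu0]
  exact hE.powShift_comp_mem hu hu0 le_rfl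

lemma energyFunctional_add (hE : LocalForm m p D E) (hu : u ∈ D) (hu0 : ∀ x, 0 ≤ u x)
    {f g : M → ℝ} (hf : f ∈ D) (hg : g ∈ D) :
    energyFunctional p E u (f + g) = energyFunctional p E u f + energyFunctional p E u g := by
  have hP := hE.powShift_mem' hu hu0
  unfold energyFunctional
  rw [mul_add, hE.pair_add_right hu (hE.mul_mem hu hf) (hE.mul_mem hu hg),
    hE.pair_add_right hP hf hg]
  ring

lemma energyFunctional_smul (hE : LocalForm m p D E) (hu : u ∈ D) (hu0 : ∀ x, 0 ≤ u x)
    {f : M → ℝ} (hf : f ∈ D) (c : ℝ) :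
    energyFunctional p E u (c • f) = c * energyFunctional p E u f := by
  have hP := hE.powShift_mem' hu hu0
  unfold energyFunctional
  rw [mul_smul_comm, hE.pair_smul_right hu (hE.mul_mem hu hf), hE.pair_smul_right hP hf]
  ring

lemma energyFunctional_eq_zero (hE : LocalForm m p D E) (hu : u ∈ D) (hu0 : ∀ x, 0 ≤ u x)
    {f : M → ℝ} (hf : f ∈ D) (h : Separated f u 0) : energyFunctional p E u f = 0 := by
  have hP := hE.powShift_mem' hu hu0
  have hq := one_lt_conj hE.one_lt
  unfold energyFunctional
  rw [hE.pair_eq_zero' hu (hE.mul_mem hu hf) (a := 0), hE.pair_eq_zero' hP hf (a := 0)]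
  · simp
  · refine fun x => (h x).imp_right fun h => ?_
    filter_upwards [h] with y hy
    rw [hy, abs_zero, Real.zero_rpow (by linarith)]
  · refine fun x => (h x).imp_left fun h => ?_
    filter_upwards [h] with y hy
    simp [hy]

lemma energyFunctional_eq_energy (hE : LocalForm m p D E) (hu : u ∈ D) (hu0 : ∀ x, 0 ≤ u x)
    {f : M → ℝ} (hf : f ∈ D) (h : Separated u f 1) : energyFunctional p E u f = E u := by
  have hP := hE.powShift_mem' hu hu0
  have hq := one_lt_conj hE.one_lt
  have e : u * f = u := by
    ext x
    rcases h x with h | h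
    · simp [h.self_of_nhds]
    · simp [h.self_of_nhds]
  unfold energyFunctional
  rw [e, hE.pair_self hu, hE.pair_eq_zero hP hf (a := 1)]
  · simp
  · refine fun x => (h x).imp_left fun h => ?_
    filter_upwards [h] with y hy
    simp only [Pi.zero_apply] at hy ⊢
    rw [hy, abs_zero, Real.zero_rpow (by linarith)]

lemma energyFunctional_smul_left (hE : LocalForm m p D E) (hu : u ∈ D) (hu0 : ∀ x, 0 ≤ u x)
    {f : M → ℝ} (hf : f ∈ D) {c : ℝ} (hc : 0 ≤ c) :
    energyFunctional p E (c • u) f = c ^ p * energyFunctional p E u f := by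
  have hp := hE.one_lt
  have hp1 : 0 < p - 1 := by linarith
  have hP := hE.powShift_mem' hu hu0
  have e1 : (fun x => |(c • u) x| ^ (p / (p - 1))) =
      c ^ (p / (p - 1)) • fun x => |u x| ^ (p / (p - 1)) := by
    ext x
    simp only [Pi.smul_apply, smul_eq_mul, abs_mul, abs_of_nonneg hc]
    rw [Real.mul_rpow hc (abs_nonneg _)]
  have e2 : (c ^ (p / (p - 1))) ^ (p - 1) = c ^ p := by
    rw [← Real.rpow_mul hc, div_mul_cancel₀ _ hp1.ne']
  have e3 : c ^ (p - 1) * c = c ^ p := by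
    rcases hc.eq_or_lt with h | h
    · rw [← h, Real.zero_rpow (by linarith : p ≠ 0), mul_zero]
    · rw [← Real.rpow_add_one h.ne', sub_add_cancel]
  have huf := hE.mul_mem hu hf
  unfold energyFunctional
  rw [e1, smul_mul_assoc, hE.pair_smul_left hu (D.smul_mem c huf) hc, hE.pair_smul_right hu huf,
    hE.pair_smul_left hP hf (by positivity), e2, ← e3]
  ring

variable [T2Space M] [LocallyCompactSpace M]

/-- The functional is positive, since it is the limit of the values for the zigzags of `u`, which
are uniformly small. -/
lemma energyFunctional_nonneg (hE : LocalForm m p D E) (hu : u ∈ D) (hu0 : ∀ x, 0 ≤ u x)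
    {f : M → ℝ} (hf : f ∈ D) (hf0 : ∀ x, 0 ≤ f x) : 0 ≤ energyFunctional p E u f := by
  have hp := hE.one_lt
  obtain ⟨w, hwD, hw, hwr, hlim⟩ := hE.exists_zigzag hu hu0 hf
  obtain ⟨B, hB, hfB⟩ := hE.exists_bound hf
  set b := rootEnergy p E f
  set A := rootEnergy p E u
  set r := rootEnergy p E (f * f)
  set G : ℝ → ℝ := fun K => -((B + K) * (2 * K * b * (A + 2 * K * b) ^ (p - 1)) +
    2 * K * A ^ p + K / 2 * (A ^ (p - 1) * r)) with hG
  have hGc : Continuous G := by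
    have : Continuous fun K : ℝ => (A + 2 * K * b) ^ (p - 1) :=
      (by fun_prop : Continuous fun K : ℝ => A + 2 * K * b).rpow_const
        fun x => Or.inr (by linarith)
    fun_prop
  have hG0 : G 0 = 0 := by simp [hG]
  -- the parameter `K` of the lower bound is the square root of the size of the zigzag
  have h1 : Tendsto (fun k : ℕ => √(1 / ((k : ℝ) + 1))) atTop (𝓝 0) := by
    have := (Real.continuous_sqrt.tendsto 0).comp
      (tendsto_one_div_add_atTop_nhds_zero_nat (𝕜 := ℝ))
    simpa [Function.comp_def] using this
  have h2 := (hGc.tendsto 0).comp h1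
  rw [hG0] at h2
  refine le_of_tendsto_of_tendsto' h2 hlim fun k => ?_
  have hδ : (0 : ℝ) < 1 / ((k : ℝ) + 1) := by positivity
  have h3 := hE.le_pair_mul (hwD k) hf hδ hB (Real.sqrt_pos.2 hδ) (hw k)
    (fun x => ⟨hf0 x, (le_abs_self _).trans (hfB x)⟩) (hwr k)
  rw [Real.div_sqrt] at h3
  exact h3

lemma abs_energyFunctional_le (hE : LocalForm m p D E) (hu : u ∈ D) (hu0 : ∀ x, 0 ≤ u x)
    {f : M → ℝ} (hf : f ∈ D) {B : ℝ} (hB : 0 < B) (hfB : ∀ x, |f x| ≤ B) :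
    |energyFunctional p E u f| ≤ 2 * B * E u := by
  have hp := hE.one_lt
  obtain ⟨w, hwD, hw, hwr, hlim⟩ := hE.exists_zigzag hu hu0 hf
  set A := rootEnergy p E u with hA
  have hA0 : 0 ≤ A := hE.root_nonneg hu
  have e3 : A ^ (p - 1) * A = E u := by
    rw [← hE.root_rpow hp hu, ← hA]
    rcases hA0.eq_or_lt with h | h
    · rw [← h, Real.zero_rpow (by linarith : p ≠ 0), mul_zero]
    · rw [← Real.rpow_add_one h.ne', sub_add_cancel]
  have h1 : Tendsto (fun k : ℕ => A ^ (p - 1) *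
      (2 * (B * A + (1 / ((k : ℝ) + 1)) * rootEnergy p E f))) atTop
      (𝓝 (A ^ (p - 1) * (2 * (B * A + 0 * rootEnergy p E f)))) :=
    (((tendsto_one_div_add_atTop_nhds_zero_nat (𝕜 := ℝ)).mul_const _).const_add _
      |>.const_mul 2).const_mul _
  have e4 : A ^ (p - 1) * (2 * (B * A + 0 * rootEnergy p E f)) = 2 * B * E u := by
    rw [← e3]; ring
  rw [e4] at h1
  refine le_of_tendsto_of_tendsto' hlim.abs h1 fun k => ?_
  have hδ : (0 : ℝ) < 1 / ((k : ℝ) + 1) := by positivity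
  obtain ⟨h2, h3⟩ := hE.mul_mem_and_root_mul_le (hwD k) hf hδ hB
    (fun x => by rw [abs_of_nonneg (hw k x).1]; exact (hw k x).2) hfB
  refine (hE.abs_pair_le (hwD k) h2).trans ?_
  have h4 := hE.root_nonneg (hwD k)
  refine mul_le_mul (Real.rpow_le_rpow h4 (hwr k) (by linarith)) (h3.trans ?_)
    (hE.root_nonneg h2) (by positivity)
  gcongr
  exact hwr k

/-- The functional is additive on separated functions, even if the second one is a nonzero
constant `a` near the support of the first one. -/
lemma energyFunctional_add_left (hE : LocalForm m p D E) {u₁ u₂ f : M → ℝ} (hu₁ : u₁ ∈ D)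
    (hu₂ : u₂ ∈ D) (h₁ : ∀ x, 0 ≤ u₁ x) (h₂ : ∀ x, 0 ≤ u₂ x) (hf : f ∈ D) {a : ℝ} (ha : 0 ≤ a)
    (h : Separated u₁ u₂ a) :
    energyFunctional p E (u₁ + u₂) f = energyFunctional p E u₁ f + energyFunctional p E u₂ f := by
  have hp := hE.one_lt
  set q := p / (p - 1) with hq
  have hf₁ := hE.mul_mem hu₁ hf
  have hf₂ := hE.mul_mem hu₂ hf
  have e1 : (fun x => |(u₁ + u₂) x| ^ q) = powShift q a ∘ u₁ + powShift q 0 ∘ u₂ := by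
    rw [abs_rpow_eq_powShift_comp (u := u₁ + u₂) hp (fun x => add_nonneg (h₁ x) (h₂ x))]
    ext x
    simp only [Function.comp_apply, Pi.add_apply]
    rcases h x with h | h
    · have : u₁ x = 0 := h.self_of_nhds
      rw [this, powShift_zero_right, zero_add, zero_add]
    · have : u₂ x = a := h.self_of_nhds
      rw [this]
      simp [powShift, hq]
  have s1 : Separated (powShift q a ∘ u₁) (powShift q 0 ∘ u₂) (powShift q 0 a) := fun x => by
    refine (h x).imp (fun h => ?_) fun h => ?_
    · filter_upwards [h] with y hy
      simp [hy, powShift_zero_right]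
    · filter_upwards [h] with y hy
      simp [hy]
  have e2 : pair p E u₁ (u₂ * f) = a * pair p E u₁ f := by
    have e3 : pair p E u₁ (u₂ * f - a • f) = 0 := by
      refine hE.pair_eq_zero hu₁ (D.sub_mem hf₂ (D.smul_mem a hf)) (a := 0) fun x =>
        (h x).imp_right fun h => ?_
      filter_upwards [h] with y hy
      simp [hy]
    rw [hE.pair_sub_right hu₁ hf₂ (D.smul_mem a hf), hE.pair_smul_right hu₁ hf] at e3
    linarith
  have e4 : pair p E u₂ (u₁ * f) = 0 := by
    refine hE.pair_eq_zero' hu₂ hf₁ (a := a) fun x => (h x).imp_left fun h => ?_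
    filter_upwards [h] with y hy
    simp [hy]
  have e5 := hE.pair_powShift hu₁ h₁ hf ha
  unfold energyFunctional
  rw [e1, abs_rpow_eq_powShift_comp hp h₁, abs_rpow_eq_powShift_comp hp h₂,
    hE.pair_add_left (hE.powShift_comp_mem hu₁ h₁ ha) (hE.powShift_comp_mem hu₂ h₂ le_rfl) hf s1,
    add_mul, hE.pair_add_left hu₁ hu₂ (D.add_mem hf₁ hf₂) h, hE.pair_add_right hu₁ hf₁ hf₂,
    hE.pair_add_right hu₂ hf₁ hf₂, e2, e4, mul_add, e5]
  ring

end LocalForm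

/-! ### Energy measures -/

section Compact

variable {M : Type*} [MetricSpace M] [MeasurableSpace M] [BorelSpace M]

lemma measure_le_ofReal_integral {μ : Measure M} [IsFiniteMeasureOnCompacts μ] {χ : M → ℝ}
    (hc : Continuous χ) (hs : HasCompactSupport χ) (h0 : ∀ x, 0 ≤ χ x) {K : Set M}
    (hK : IsCompact K) (h1 : ∀ x ∈ K, 1 ≤ χ x) : μ K ≤ ENNReal.ofReal (∫ x, χ x ∂μ) := by
  rw [ofReal_integral_eq_lintegral_ofReal (hc.integrable_of_hasCompactSupport hs)
    (ae_of_all _ h0), ← lintegral_indicator_one hK.measurableSet]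
  refine lintegral_mono fun x => ?_
  by_cases hx : x ∈ K
  · simp [hx, h1 x hx]
  · simp [hx]

lemma measure_open_le {μ : Measure M} [μ.Regular] {U : Set M} (hU : IsOpen U) {c : ℝ≥0∞}
    (h : ∀ K ⊆ U, IsCompact K → μ K ≤ c) : μ U ≤ c := by
  rw [hU.measure_eq_iSup_isCompact]
  exact iSup₂_le fun K hK => iSup_le fun hc => h K hK hc

end Compact

lemma exists_extension_of_norm_le {X : Type*} [SeminormedAddCommGroup X] [NormedSpace ℝ X]
    {S : Submodule ℝ X} (L : S →ₗ[ℝ] ℝ) {K : ℝ} (hK : 0 ≤ K) (h : ∀ f : S, ‖L f‖ ≤ K * ‖f‖) :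
    ∃ G : X →L[ℝ] ℝ, (∀ f : S, G f = L f) ∧ ‖G‖ ≤ K := by
  obtain ⟨G, hG, hGn⟩ := exists_extension_norm_eq S (L.mkContinuous K h)
  exact ⟨G, hG, hGn.trans_le (L.mkContinuous_norm_le hK h)⟩

lemma exists_extension {M : Type*} [TopologicalSpace M] {D : Submodule ℝ (M → ℝ)}
    (L : (M → ℝ) → ℝ) {K : ℝ}
    (hadd : ∀ f ∈ D, ∀ g ∈ D, L (f + g) = L f + L g)
    (hsmul : ∀ (c : ℝ), ∀ f ∈ D, L (c • f) = c * L f)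
    (hbd : ∀ f ∈ D, ∀ B, 0 < B → (∀ x, |f x| ≤ B) → |L f| ≤ K * B) :
    ∃ G : BoundedContinuousFunction M ℝ →L[ℝ] ℝ,
      (∀ f : BoundedContinuousFunction M ℝ, ⇑f ∈ D → G f = L f) ∧ ‖G‖ ≤ K := by
  have hK : 0 ≤ K := by
    have := hbd 0 D.zero_mem 1 one_pos (by simp)
    linarith [abs_nonneg (L 0)]
  obtain ⟨S, hS⟩ : ∃ S : Submodule ℝ (BoundedContinuousFunction M ℝ), ∀ f, f ∈ S ↔ ⇑f ∈ D :=
    ⟨{ carrier := {f | ⇑f ∈ D}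
       add_mem' := fun ha hb => D.add_mem ha hb
       zero_mem' := D.zero_mem
       smul_mem' := fun c _ ha => D.smul_mem c ha }, fun _ => Iff.rfl⟩
  obtain ⟨L₀, hL₀⟩ : ∃ L₀ : S →ₗ[ℝ] ℝ, ∀ f : S, L₀ f = L f.1 :=
    ⟨{ toFun := fun f => L f.1
       map_add' := fun f g => hadd _ ((hS _).1 f.2) _ ((hS _).1 g.2)
       map_smul' := fun c f => hsmul c _ ((hS _).1 f.2) }, fun _ => rfl⟩
  have hL₀b : ∀ f : S, ‖L₀ f‖ ≤ K * ‖f‖ := by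
    intro f
    refine le_of_forall_pos_le_add fun ε hε => ?_
    have h1 : |L f.1| ≤ K * (‖f‖ + ε / (K + 1)) := by
      refine hbd _ ((hS _).1 f.2) _ (by positivity) fun x => ?_
      have h2 : |f.1 x| ≤ ‖f‖ := f.1.norm_coe_le_norm x
      have : 0 < ε / (K + 1) := by positivity
      linarith
    have h3 : K * (ε / (K + 1)) ≤ ε := by
      rw [← mul_div_assoc, div_le_iff₀ (by positivity)]
      nlinarith
    rw [hL₀, Real.norm_eq_abs]
    linarith
  obtain ⟨G, hG, hGK⟩ := exists_extension_of_norm_le L₀ hK hL₀b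
  exact ⟨G, fun f hf => (hG ⟨f, (hS f).2 hf⟩).trans (hL₀ _), hGK⟩

namespace LocalForm

variable {M : Type*} [MetricSpace M] [MeasurableSpace M] [BorelSpace M]
  [SecondCountableTopology M] [LocallyCompactSpace M]
  {m : Measure M} {p : ℝ} {D : Submodule ℝ (M → ℝ)} {E : (M → ℝ) → ℝ}

lemma measure_compact_le (hE : LocalForm m p D E) {μ : Measure M} [IsFiniteMeasureOnCompacts μ]
    {c : ℝ} (h : ∀ f ∈ D, (∀ x, |f x| ≤ 1) → ∫ x, f x ∂μ ≤ c) {K : Set M} (hK : IsCompact K) :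
    μ K ≤ ENNReal.ofReal c := by
  obtain ⟨χ, hχ, h0, h1, -⟩ := hE.exists_cutoff hK isOpen_univ (Set.subset_univ K)
  refine (measure_le_ofReal_integral (hE.continuous χ hχ) (hE.hasCompactSupport χ hχ)
    (fun x => (h0 x).1) hK fun x hx => (h1 x hx).self_of_nhds.ge).trans ?_
  exact ENNReal.ofReal_le_ofReal (h χ hχ fun x => abs_le.2 ⟨by linarith [(h0 x).1], (h0 x).2⟩)

/-- A positive linear functional on `D` which is bounded for the uniform norm is represented by a
finite measure. It extends to `C_b(M)` by the Hahn–Banach theorem; the restriction of the extension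
to `C_c(M)` is positive by density, and the Riesz–Markov theorem applies. -/
lemma exists_measure (hE : LocalForm m p D E) (L : (M → ℝ) → ℝ) {K : ℝ}
    (hadd : ∀ f ∈ D, ∀ g ∈ D, L (f + g) = L f + L g)
    (hsmul : ∀ (c : ℝ), ∀ f ∈ D, L (c • f) = c * L f)
    (hpos : ∀ f ∈ D, (∀ x, 0 ≤ f x) → 0 ≤ L f)
    (hbd : ∀ f ∈ D, ∀ B, 0 < B → (∀ x, |f x| ≤ B) → |L f| ≤ K * B) :
    ∃ μ : Measure M, IsFiniteMeasure μ ∧ ∀ f ∈ D, ∫ x, f x ∂μ = L f := by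
  obtain ⟨G, hGD, hGK⟩ := exists_extension L hadd hsmul hbd
  let T : CompactlySupportedContinuousMap M ℝ →ₗ[ℝ] ℝ :=
    { toFun := fun g => G g.toBoundedContinuousFunction
      map_add' := fun f g => G.map_add f.toBoundedContinuousFunction g.toBoundedContinuousFunction
      map_smul' := fun c f => G.map_smul c f.toBoundedContinuousFunction }
  have hT : ∀ g : CompactlySupportedContinuousMap M ℝ, 0 ≤ g → 0 ≤ T g := by
    intro g hg
    have hg0 : ∀ x, 0 ≤ g x := fun x => hg x
    refine le_of_forall_pos_le_add fun ε hε => ?_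
    have hK : 0 ≤ K := (norm_nonneg G).trans hGK
    have hε' : 0 < ε / (K + 1) := by positivity
    obtain ⟨f, hf, hfg⟩ := hE.dense g g.continuous g.hasCompactSupport _ hε'
    have hf' := (hE.markovian (fun s => max s 0) (by fun_prop) (by simp)
      (fun s t => abs_max_sub_max_le_abs s t 0) f hf).1
    set h : CompactlySupportedContinuousMap M ℝ :=
      ⟨⟨_, hE.continuous _ hf'⟩, hE.hasCompactSupport _ hf'⟩
    have h1 : 0 ≤ G h.toBoundedContinuousFunction := by
      rw [hGD h.toBoundedContinuousFunction hf']
      exact hpos _ hf' fun x => le_max_right _ _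
    have h2 : ‖h.toBoundedContinuousFunction - g.toBoundedContinuousFunction‖ ≤ ε / (K + 1) := by
      refine (BoundedContinuousFunction.norm_le hε'.le).2 fun x => ?_
      change |max (f x) 0 - g x| ≤ _
      have h3 := abs_max_sub_max_le_abs (f x) (g x) 0
      rw [max_eq_left (hg0 x), abs_sub_comm (f x)] at h3
      exact h3.trans (hfg x).le
    have h3 := (G.le_opNorm (h.toBoundedContinuousFunction - g.toBoundedContinuousFunction)).trans
      (mul_le_mul hGK h2 (norm_nonneg _) hK)
    have h4 : K * (ε / (K + 1)) ≤ ε := by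
      rw [← mul_div_assoc, div_le_iff₀ (by positivity)]
      nlinarith
    rw [map_sub, Real.norm_eq_abs, abs_le] at h3
    change 0 ≤ G g.toBoundedContinuousFunction + ε
    linarith [h3.2]
  let Λ := PositiveLinearMap.mk₀ T hT
  have hΛ : ∀ f ∈ D, ∫ x, f x ∂(RealRMK.rieszMeasure Λ) = L f := fun f hf => by
    let h : CompactlySupportedContinuousMap M ℝ :=
      ⟨⟨_, hE.continuous _ hf⟩, hE.hasCompactSupport _ hf⟩
    have h1 := RealRMK.integral_rieszMeasure Λ h
    exact h1.trans (hGD h.toBoundedContinuousFunction hf)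
  have := RealRMK.regular_rieszMeasure Λ
  refine ⟨RealRMK.rieszMeasure Λ, ⟨?_⟩, hΛ⟩
  refine (measure_open_le (c := ENNReal.ofReal K) isOpen_univ fun C _ hC => ?_).trans_lt
    ENNReal.ofReal_lt_top
  refine hE.measure_compact_le (fun f hf hf1 => ?_) hC
  rw [hΛ f hf]
  simpa using (le_abs_self _).trans (hbd f hf 1 one_pos hf1)

lemma measure_ext (hE : LocalForm m p D E) {μ ν : Measure M} [IsFiniteMeasure μ]
    [IsFiniteMeasure ν] (h : ∀ f ∈ D, ∫ x, f x ∂μ = ∫ x, f x ∂ν) : μ = ν := by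
  refine Measure.ext_of_integral_eq_on_compactlySupported fun g => ?_
  have hi : ∀ (ρ : Measure M) [IsFiniteMeasure ρ] (f : M → ℝ), Continuous f → HasCompactSupport f →
      Integrable f ρ := fun ρ _ f hf hf' => hf.integrable_of_hasCompactSupport hf'
  have key : ∀ ε > 0, |∫ x, g x ∂μ - ∫ x, g x ∂ν| ≤ ε * (μ.real Set.univ + ν.real Set.univ) := by
    intro ε hε
    obtain ⟨f, hf, hfg⟩ := hE.dense g g.continuous g.hasCompactSupport ε hε
    have h1 : ∀ (ρ : Measure M) [IsFiniteMeasure ρ],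
        |∫ x, g x ∂ρ - ∫ x, f x ∂ρ| ≤ ε * ρ.real Set.univ := fun ρ _ => by
      rw [← integral_sub (hi ρ g g.continuous g.hasCompactSupport)
        (hi ρ f (hE.continuous f hf) (hE.hasCompactSupport f hf))]
      exact norm_integral_le_of_norm_le_const (f := fun x => g x - f x)
        (ae_of_all _ fun x => (hfg x).le)
    have h2 := abs_le.1 (h1 μ)
    have h3 := abs_le.1 (h1 ν)
    have h4 := h f hf
    rw [abs_le]
    constructor <;> linarith [h2.1, h2.2, h3.1, h3.2]
  rw [← sub_eq_zero, ← abs_nonpos_iff]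
  refine le_of_forall_pos_le_add fun ε hε => ?_
  have hA : 0 ≤ μ.real Set.univ + ν.real Set.univ := by positivity
  set A := μ.real Set.univ + ν.real Set.univ
  refine (key (ε / (A + 1)) (by positivity)).trans ?_
  rw [zero_add, div_mul_eq_mul_div, div_le_iff₀ (by positivity)]
  nlinarith

lemma exists_energyMeasure (hE : LocalForm m p D E) {u : M → ℝ} (hu : u ∈ D)
    (hu0 : ∀ x, 0 ≤ u x) :
    ∃ μ : Measure M, IsFiniteMeasure μ ∧ ∀ f ∈ D, ∫ x, f x ∂μ = energyFunctional p E u f :=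
  hE.exists_measure (energyFunctional p E u) (K := 2 * E u)
    (fun _ hf _ hg => hE.energyFunctional_add hu hu0 hf hg)
    (fun c _ hf => hE.energyFunctional_smul hu hu0 hf c)
    (fun _ hf hf0 => hE.energyFunctional_nonneg hu hu0 hf hf0)
    (fun _ hf B hB hfB => (hE.abs_energyFunctional_le hu hu0 hf hB hfB).trans_eq (by ring))

variable {u : M → ℝ} {μ : Measure M} [IsFiniteMeasure μ]

lemma energyMeasure_univ_le (hE : LocalForm m p D E) (hu : u ∈ D) (hu0 : ∀ x, 0 ≤ u x)
    (hμ : ∀ f ∈ D, ∫ x, f x ∂μ = energyFunctional p E u f) :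
    μ Set.univ ≤ ENNReal.ofReal (2 * E u) := by
  refine measure_open_le isOpen_univ fun C _ hC => hE.measure_compact_le (fun f hf hf1 => ?_) hC
  rw [hμ f hf]
  simpa using (le_abs_self _).trans (hE.abs_energyFunctional_le hu hu0 hf one_pos hf1)

lemma energyMeasure_compl_tsupport (hE : LocalForm m p D E) (hu : u ∈ D) (hu0 : ∀ x, 0 ≤ u x)
    (hμ : ∀ f ∈ D, ∫ x, f x ∂μ = energyFunctional p E u f) : μ (tsupport u)ᶜ = 0 := by
  have hU : IsOpen (tsupport u)ᶜ := (isClosed_tsupport u).isOpen_compl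
  rw [← nonpos_iff_eq_zero]
  refine measure_open_le hU fun C hC hCc => ?_
  obtain ⟨χ, hχ, h0, h1, h2⟩ := hE.exists_cutoff hCc hU hC
  refine (measure_le_ofReal_integral (hE.continuous χ hχ) (hE.hasCompactSupport χ hχ)
    (fun x => (h0 x).1) hCc fun x hx => (h1 x hx).self_of_nhds.ge).trans_eq ?_
  rw [hμ χ hχ, hE.energyFunctional_eq_zero hu hu0 hχ, ENNReal.ofReal_zero]
  intro x
  by_cases hx : x ∈ (tsupport u)ᶜ
  · exact Or.inr (notMem_tsupport_iff_eventuallyEq.1 hx)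
  · exact Or.inl (h2 x hx)

lemma ofReal_energy_le_energyMeasure (hE : LocalForm m p D E) (hu : u ∈ D) (hu0 : ∀ x, 0 ≤ u x)
    (hμ : ∀ f ∈ D, ∫ x, f x ∂μ = energyFunctional p E u f) {U : Set M} (hU : IsOpen U)
    (hsU : tsupport u ⊆ U) : ENNReal.ofReal (E u) ≤ μ U := by
  obtain ⟨χ, hχ, h0, h1, h2⟩ := hE.exists_cutoff (hE.hasCompactSupport u hu) hU hsU
  have hs : Separated u χ 1 := fun x => by
    by_cases hx : x ∈ tsupport u
    · exact Or.inr (h1 x hx)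
    · exact Or.inl (notMem_tsupport_iff_eventuallyEq.1 hx)
  rw [← hE.energyFunctional_eq_energy hu hu0 hχ hs, ← hμ χ hχ,
    ofReal_integral_eq_lintegral_ofReal ((hE.continuous χ hχ).integrable_of_hasCompactSupport
      (hE.hasCompactSupport χ hχ)) (ae_of_all _ fun x => (h0 x).1),
    ← lintegral_indicator_one hU.measurableSet]
  refine lintegral_mono fun x => ?_
  by_cases hx : x ∈ U
  · simpa [hx] using (h0 x).2
  · simp [hx, (h2 x hx).self_of_nhds]

end LocalForm

namespace MixedForm

variable {M : Type*} [MetricSpace M] [MeasurableSpace M] [BorelSpace M]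
  [SecondCountableTopology M] [LocallyCompactSpace M] {m : Measure M} {p : ℝ}

section

variable (𝓔 : MixedForm m p) {u : M → ℝ}

lemma localEnergyMeasure_spec (hp : 1 < p) (hu : u ∈ ccPart 𝓔.dom) (hu0 : ∀ x, 0 ≤ u x) :
    IsFiniteMeasure (𝓔.localEnergyMeasure u) ∧ ∀ f ∈ ccPart 𝓔.dom,
      ∫ x, f x ∂(𝓔.localEnergyMeasure u) =
        energyFunctional p (localPart p 𝓔.jump 𝓔.energy) u f := by
  have h : ∃ μ : Measure M, 𝓔.IsLocalEnergyMeasure u μ :=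
    (𝓔.localForm hp).exists_energyMeasure hu hu0
  rw [localEnergyMeasure, dif_pos h]
  exact h.choose_spec

lemma localEnergyMeasure_univ_le (hp : 1 < p) (hu : u ∈ ccPart 𝓔.dom) (hu0 : ∀ x, 0 ≤ u x) :
    𝓔.localEnergyMeasure u Set.univ ≤
      ENNReal.ofReal (2 * localPart p 𝓔.jump 𝓔.energy u) := by
  obtain ⟨h1, h2⟩ := 𝓔.localEnergyMeasure_spec hp hu hu0
  exact (𝓔.localForm hp).energyMeasure_univ_le hu hu0 h2

lemma localEnergyMeasure_compl_tsupport (hp : 1 < p) (hu : u ∈ ccPart 𝓔.dom)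
    (hu0 : ∀ x, 0 ≤ u x) : 𝓔.localEnergyMeasure u (tsupport u)ᶜ = 0 := by
  obtain ⟨h1, h2⟩ := 𝓔.localEnergyMeasure_spec hp hu hu0
  exact (𝓔.localForm hp).energyMeasure_compl_tsupport hu hu0 h2

lemma ofReal_localPart_le_localEnergyMeasure (hp : 1 < p) (hu : u ∈ ccPart 𝓔.dom)
    (hu0 : ∀ x, 0 ≤ u x) {U : Set M} (hU : IsOpen U) (hsU : tsupport u ⊆ U) :
    ENNReal.ofReal (localPart p 𝓔.jump 𝓔.energy u) ≤ 𝓔.localEnergyMeasure u U := by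
  obtain ⟨h1, h2⟩ := 𝓔.localEnergyMeasure_spec hp hu hu0
  exact (𝓔.localForm hp).ofReal_energy_le_energyMeasure hu hu0 h2 hU hsU

lemma localEnergyMeasure_smul (hp : 1 < p) (hu : u ∈ ccPart 𝓔.dom) (hu0 : ∀ x, 0 ≤ u x) {c : ℝ}
    (hc : 0 ≤ c) : 𝓔.localEnergyMeasure (c • u) =
      ENNReal.ofReal (c ^ p) • 𝓔.localEnergyMeasure u := by
  obtain ⟨h1, h2⟩ := 𝓔.localEnergyMeasure_spec hp hu hu0
  obtain ⟨h3, h4⟩ := 𝓔.localEnergyMeasure_spec hp ((ccPart 𝓔.dom).smul_mem c hu)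
    fun x => mul_nonneg hc (hu0 x)
  have := Measure.smul_finite (𝓔.localEnergyMeasure u) (ENNReal.ofReal_ne_top (r := c ^ p))
  refine (𝓔.localForm hp).measure_ext fun f hf => ?_
  rw [h4 f hf, (𝓔.localForm hp).energyFunctional_smul_left hu hu0 hf hc, integral_smul_measure,
    h2 f hf, ENNReal.toReal_ofReal (by positivity), smul_eq_mul]

lemma localEnergyMeasure_add (hp : 1 < p) {u₁ u₂ : M → ℝ} (hu₁ : u₁ ∈ ccPart 𝓔.dom)
    (hu₂ : u₂ ∈ ccPart 𝓔.dom) (h₁ : ∀ x, 0 ≤ u₁ x) (h₂ : ∀ x, 0 ≤ u₂ x) {a : ℝ} (ha : 0 ≤ a)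
    (h : Separated u₁ u₂ a) :
    𝓔.localEnergyMeasure (u₁ + u₂) = 𝓔.localEnergyMeasure u₁ + 𝓔.localEnergyMeasure u₂ := by
  obtain ⟨i1, e1⟩ := 𝓔.localEnergyMeasure_spec hp hu₁ h₁
  obtain ⟨i2, e2⟩ := 𝓔.localEnergyMeasure_spec hp hu₂ h₂
  obtain ⟨i3, e3⟩ := 𝓔.localEnergyMeasure_spec hp ((ccPart 𝓔.dom).add_mem hu₁ hu₂)
    fun x => add_nonneg (h₁ x) (h₂ x)
  refine (𝓔.localForm hp).measure_ext fun f hf => ?_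
  rw [e3 f hf, (𝓔.localForm hp).energyFunctional_add_left hu₁ hu₂ h₁ h₂ hf ha h,
    integral_add_measure (hf.2.1.integrable_of_hasCompactSupport hf.2.2)
      (hf.2.1.integrable_of_hasCompactSupport hf.2.2), e1 f hf, e2 f hf]

lemma localEnergyMeasure_zero (hp : 1 < p) : 𝓔.localEnergyMeasure (0 : M → ℝ) = 0 := by
  have h := 𝓔.localEnergyMeasure_univ_le hp (ccPart 𝓔.dom).zero_mem fun _ => le_rfl
  rw [(𝓔.localForm hp).energy_zero hp] at h
  rw [← Measure.measure_univ_eq_zero]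
  simpa using h

end

end MixedForm

/-! ### Layered cutoff functions -/

/-- Cutoff functions `φ n` of the ball of radius `R n` in the ball of radius `R n + r n`, where the
radii satisfy `R (n + 1) = R n + 2 * r n`, so that the transition regions of the `φ n` are pairwise
disjoint. -/
structure Layers {M : Type*} [MetricSpace M] (x₀ : M) (R r : ℕ → ℝ) (φ : ℕ → M → ℝ) : Prop where
  r_pos : ∀ n, 0 < r n
  r_anti : ∀ n, r (n + 1) ≤ r n
  R_succ : ∀ n, R (n + 1) = R n + 2 * r n
  continuous : ∀ n, Continuous (φ n)
  nonneg : ∀ n x, 0 ≤ φ n x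
  le_one : ∀ n x, φ n x ≤ 1
  eq_one : ∀ n x, dist x x₀ < R n → φ n x = 1
  eq_zero : ∀ n x, R n + r n ≤ dist x x₀ → φ n x = 0

/-- The combination of the `φ n` with the geometric weights `(1 - θ) θ ^ n`, of sum `1`. -/
def layerSum {M : Type*} (θ : ℝ) (φ : ℕ → M → ℝ) : M → ℝ := fun x => ∑' n, (1 - θ) * θ ^ n * φ n x

/-- The partial sums of `layerSum`. -/
def layerPartial {M : Type*} (θ : ℝ) (φ : ℕ → M → ℝ) (N : ℕ) : M → ℝ :=
  ∑ n ∈ Finset.range N, ((1 - θ) * θ ^ n) • φ n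

namespace Layers

variable {M : Type*} [MetricSpace M] {x₀ : M} {R r : ℕ → ℝ} {φ : ℕ → M → ℝ} {θ : ℝ}

lemma R_mono (h : Layers x₀ R r φ) : StrictMono R :=
  strictMono_nat_of_lt_succ fun n => by rw [h.R_succ]; linarith [h.r_pos n]

lemma eq_zero_of_le (h : Layers x₀ R r φ) {x : M} {k n : ℕ} (hk : k < n) (hx : R n ≤ dist x x₀) :
    φ k x = 0 :=
  h.eq_zero k x <| by
    have h1 := h.R_mono.monotone (Nat.succ_le_of_lt hk)
    rw [Nat.succ_eq_add_one, h.R_succ] at h1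
    linarith [h.r_pos k]

lemma eq_one_of_lt (h : Layers x₀ R r φ) {x : M} {k n : ℕ} (hk : n ≤ k) (hx : dist x x₀ < R n) :
    φ k x = 1 :=
  h.eq_one k x (hx.trans_le (h.R_mono.monotone hk))

lemma hasSum_weights (h0 : 0 < θ) (h1 : θ < 1) (N : ℕ) :
    HasSum (fun n => (1 - θ) * θ ^ (n + N)) (θ ^ N) := by
  have h2 := (hasSum_geometric_of_lt_one h0.le h1).mul_left ((1 - θ) * θ ^ N)
  rw [mul_right_comm, mul_inv_cancel₀ (by linarith), one_mul] at h2
  have e : (fun n => (1 - θ) * θ ^ (n + N)) = fun n => (1 - θ) * θ ^ N * θ ^ n := by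
    funext n
    ring
  rwa [e]

lemma summable (h : Layers x₀ R r φ) (h0 : 0 < θ) (h1 : θ < 1) (x : M) (N : ℕ) :
    Summable fun n => (1 - θ) * θ ^ (n + N) * φ (n + N) x := by
  refine Summable.of_nonneg_of_le (fun n => ?_) (fun n => ?_) (hasSum_weights h0 h1 N).summable
  · have := h.nonneg (n + N) x
    have : 0 < 1 - θ := by linarith
    positivity
  · have : 0 < 1 - θ := by linarith
    exact mul_le_of_le_one_right (by positivity) (h.le_one _ x)

lemma layerSum_eq (h : Layers x₀ R r φ) (h0 : 0 < θ) (h1 : θ < 1) (x : M) (N : ℕ) :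
    layerSum θ φ x = layerPartial θ φ N x + ∑' n, (1 - θ) * θ ^ (n + N) * φ (n + N) x := by
  have h2 := ((h.summable h0 h1 x 0).sum_add_tsum_nat_add N).symm
  simpa [layerSum, layerPartial, Finset.sum_apply] using h2

lemma tail_nonneg (h : Layers x₀ R r φ) (h0 : 0 < θ) (h1 : θ < 1) (x : M) (N : ℕ) :
    0 ≤ layerSum θ φ x - layerPartial θ φ N x := by
  rw [h.layerSum_eq h0 h1 x N, add_sub_cancel_left]
  refine tsum_nonneg fun n => ?_
  have := h.nonneg (n + N) x
  have : 0 < 1 - θ := by linarith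
  positivity

lemma tail_le (h : Layers x₀ R r φ) (h0 : 0 < θ) (h1 : θ < 1) (x : M) (N : ℕ) :
    layerSum θ φ x - layerPartial θ φ N x ≤ θ ^ N := by
  rw [h.layerSum_eq h0 h1 x N, add_sub_cancel_left, ← (hasSum_weights h0 h1 N).tsum_eq]
  refine (h.summable h0 h1 x N).tsum_le_tsum (fun n => ?_) (hasSum_weights h0 h1 N).summable
  have : 0 < 1 - θ := by linarith
  exact mul_le_of_le_one_right (by positivity) (h.le_one _ x)

lemma tail_eq (h : Layers x₀ R r φ) (h0 : 0 < θ) (h1 : θ < 1) {x : M} {N : ℕ}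
    (hx : dist x x₀ < R N) : layerSum θ φ x - layerPartial θ φ N x = θ ^ N := by
  rw [h.layerSum_eq h0 h1 x N, add_sub_cancel_left, ← (hasSum_weights h0 h1 N).tsum_eq]
  refine tsum_congr fun n => ?_
  rw [h.eq_one_of_lt (Nat.le_add_left N n) hx, mul_one]

lemma layerPartial_eq_zero (h : Layers x₀ R r φ) {x : M} {N : ℕ} (hx : R N ≤ dist x x₀) :
    layerPartial θ φ N x = 0 := by
  rw [layerPartial, Finset.sum_apply]
  refine Finset.sum_eq_zero fun n hn => ?_
  simp [h.eq_zero_of_le (Finset.mem_range.1 hn) hx]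

lemma layerSum_nonneg (h : Layers x₀ R r φ) (h0 : 0 < θ) (h1 : θ < 1) (x : M) :
    0 ≤ layerSum θ φ x := by
  simpa [layerPartial] using h.tail_nonneg h0 h1 x 0

lemma layerSum_le_one (h : Layers x₀ R r φ) (h0 : 0 < θ) (h1 : θ < 1) (x : M) :
    layerSum θ φ x ≤ 1 := by
  simpa [layerPartial] using h.tail_le h0 h1 x 0

lemma layerSum_eq_one (h : Layers x₀ R r φ) (h0 : 0 < θ) (h1 : θ < 1) {x : M}
    (hx : dist x x₀ < R 0) : layerSum θ φ x = 1 := by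
  simpa [layerPartial] using h.tail_eq h0 h1 hx

lemma layerSum_eq_zero (h : Layers x₀ R r φ) {x : M} (hx : ∀ n, R n ≤ dist x x₀) :
    layerSum θ φ x = 0 := by
  have : ∀ n, φ n x = 0 := fun n => h.eq_zero_of_le (Nat.lt_succ_self n) (hx _)
  simp [layerSum, this]

lemma layerSum_le (h : Layers x₀ R r φ) (h0 : 0 < θ) (h1 : θ < 1) {x : M} {N : ℕ}
    (hx : R N ≤ dist x x₀) : layerSum θ φ x ≤ θ ^ N := by
  simpa [h.layerPartial_eq_zero hx] using h.tail_le h0 h1 x N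

lemma layerPartial_nonneg (h : Layers x₀ R r φ) (h0 : 0 < θ) (h1 : θ < 1) (x : M) (N : ℕ) :
    0 ≤ layerPartial θ φ N x := by
  rw [layerPartial, Finset.sum_apply]
  refine Finset.sum_nonneg fun n _ => ?_
  have := h.nonneg n x
  have : 0 < 1 - θ := by linarith
  simp only [Pi.smul_apply, smul_eq_mul]
  positivity

lemma le_layerSum (h : Layers x₀ R r φ) (h0 : 0 < θ) (h1 : θ < 1) {x : M} {N : ℕ}
    (hx : dist x x₀ < R N) : θ ^ N ≤ layerSum θ φ x := by
  linarith [h.tail_eq h0 h1 hx, h.layerPartial_nonneg h0 h1 x N]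

/-- The value in the layer of index `n`. -/
lemma layerSum_eq_of_mem (h : Layers x₀ R r φ) (h0 : 0 < θ) (h1 : θ < 1) {x : M} {n : ℕ}
    (hx : n = 0 ∨ R n ≤ dist x x₀) (hx' : dist x x₀ < R (n + 1)) :
    layerSum θ φ x = (1 - θ) * θ ^ n * φ n x + θ ^ (n + 1) := by
  have h2 := h.tail_eq h0 h1 hx'
  have h3 : layerPartial θ φ n x = 0 := by
    rcases hx with rfl | hx
    · simp [layerPartial]
    · exact h.layerPartial_eq_zero hx
  have h4 : layerPartial θ φ (n + 1) x = layerPartial θ φ n x + (1 - θ) * θ ^ n * φ n x := by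
    simp [layerPartial, Finset.sum_range_succ]
  linarith

lemma tendsto_layerPartial (h : Layers x₀ R r φ) (h0 : 0 < θ) (h1 : θ < 1) :
    TendstoUniformly (layerPartial θ φ) (layerSum θ φ) atTop := by
  rw [Metric.tendstoUniformly_iff]
  intro ε hε
  filter_upwards [(tendsto_pow_atTop_nhds_zero_of_lt_one h0.le h1).eventually_lt_const hε]
    with N hN x
  rw [Real.dist_eq, abs_of_nonneg (h.tail_nonneg h0 h1 x N)]
  exact (h.tail_le h0 h1 x N).trans_lt hN

lemma continuous_layerSum (h : Layers x₀ R r φ) (h0 : 0 < θ) (h1 : θ < 1) :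
    Continuous (layerSum θ φ) := by
  refine (h.tendsto_layerPartial h0 h1).continuous (Frequently.of_forall fun N => ?_)
  have e : layerPartial θ φ N = fun x => ∑ n ∈ Finset.range N, (1 - θ) * θ ^ n * φ n x := by
    ext x
    simp [layerPartial, Finset.sum_apply]
  rw [e]
  exact continuous_finsetSum _ fun n _ => (h.continuous n).const_mul _

lemma layerPartial_eventuallyEq_zero (h : Layers x₀ R r φ) {x : M} {N : ℕ}
    (hx : R N ≤ dist x x₀) : layerPartial θ φ N =ᶠ[𝓝 x] 0 := by
  rcases N with _ | N
  · simp [layerPartial]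
  have h1 : R N + r N < dist x x₀ := by
    have := h.R_succ N
    linarith [h.r_pos N]
  filter_upwards [(continuous_id.dist continuous_const).continuousAt.eventually_const_lt h1]
    with y hy
  rw [layerPartial, Finset.sum_apply]
  refine Finset.sum_eq_zero fun n hn => ?_
  rcases (Nat.lt_succ_iff.1 (Finset.mem_range.1 hn)).eq_or_lt with rfl | hn
  · simp [h.eq_zero n y hy.le]
  · have : R N ≤ dist y x₀ := by
      have := h.r_pos N
      simp only [id] at hy
      linarith
    simp [h.eq_zero_of_le hn this]

lemma eventually_dist_lt {x : M} {a : ℝ} (hx : dist x x₀ < a) : ∀ᶠ y in 𝓝 x, dist y x₀ < a :=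
  (continuous_id.dist continuous_const).continuousAt.eventually_lt_const hx

lemma separated_succ (h : Layers x₀ R r φ) (N : ℕ) :
    Separated (layerPartial θ φ N) (((1 - θ) * θ ^ N) • φ N) ((1 - θ) * θ ^ N) := fun x => by
  rcases le_or_gt (R N) (dist x x₀) with hx | hx
  · exact Or.inl (h.layerPartial_eventuallyEq_zero hx)
  · right
    filter_upwards [eventually_dist_lt hx] with y hy
    simp [h.eq_one N y hy]

lemma separated_tail (h : Layers x₀ R r φ) (h0 : 0 < θ) (h1 : θ < 1) (N : ℕ) :
    Separated (layerPartial θ φ N) (layerSum θ φ - layerPartial θ φ N) (θ ^ N) := fun x => by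
  rcases le_or_gt (R N) (dist x x₀) with hx | hx
  · exact Or.inl (h.layerPartial_eventuallyEq_zero hx)
  · right
    filter_upwards [eventually_dist_lt hx] with y hy
    exact h.tail_eq h0 h1 hy

/-- The increments of the sum: either the two points lie in the same ball and the increment is
at most that of one of the terms, or the points are far from each other with respect to the width
of the layers. Indeed, the supports of the gradients of the `φ n` are at a distance comparable to
`r n` of each other. -/
lemma increment (h : Layers x₀ R r φ) (h0 : 0 < θ) (h1 : θ < 1) (x y : M) :
    layerSum θ φ x = layerSum θ φ y ∨
    (∃ n, dist x x₀ < R (n + 1) ∧ dist y x₀ < R (n + 1) ∧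
      |layerSum θ φ x - layerSum θ φ y| ≤ (1 - θ) * θ ^ n * |φ n x - φ n y|) ∨
    ∃ n, r (n + 1) ≤ dist x y ∧ |layerSum θ φ x - layerSum θ φ y| ≤ θ ^ n := by
  wlog hxy : dist x x₀ ≤ dist y x₀ generalizing x y
  · rcases this y x (le_of_not_ge hxy) with h2 | ⟨n, h2, h3, h4⟩ | ⟨n, h2, h3⟩
    · exact Or.inl h2.symm
    · rw [abs_sub_comm, abs_sub_comm (φ n y)] at h4
      exact Or.inr (Or.inl ⟨n, h3, h2, h4⟩)
    · rw [abs_sub_comm] at h3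
      rw [dist_comm] at h2
      exact Or.inr (Or.inr ⟨n, h2, h3⟩)
  by_cases hx : ∀ n, R n ≤ dist x x₀
  · left
    rw [h.layerSum_eq_zero hx, h.layerSum_eq_zero fun n => (hx n).trans hxy]
  right
  have hθ : 0 < 1 - θ := by linarith
  -- the index of the layer of `x`
  obtain ⟨n, hn, hn'⟩ : ∃ n, (n = 0 ∨ R n ≤ dist x x₀) ∧ dist x x₀ < R (n + 1) := by
    push Not at hx
    have hx' : ∃ n, dist x x₀ < R (n + 1) := by
      obtain ⟨n, hn⟩ := hx
      exact ⟨n, hn.trans (h.R_mono (Nat.lt_succ_self n))⟩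
    classical
    refine ⟨Nat.find hx', ?_, Nat.find_spec hx'⟩
    by_cases h2 : Nat.find hx' = 0
    · exact Or.inl h2
    · right
      obtain ⟨k, hk⟩ := Nat.exists_eq_succ_of_ne_zero h2
      have := Nat.find_min hx' (m := k) (by omega)
      rw [hk]
      exact not_lt.1 this
  have ex := h.layerSum_eq_of_mem h0 h1 hn hn'
  rcases lt_or_ge (dist y x₀) (R (n + 1)) with hy | hy
  · left
    refine ⟨n, hn', hy, ?_⟩
    have ey := h.layerSum_eq_of_mem h0 h1 (hn.imp_right fun h => h.trans hxy) hy
    rw [ex, ey, add_sub_add_right_eq_sub, ← mul_sub, abs_mul, abs_of_pos (by positivity)]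
  rcases le_or_gt (r (n + 1)) (dist x y) with hd | hd
  · right
    refine ⟨n, hd, ?_⟩
    have h2 : layerSum θ φ y ≤ θ ^ (n + 1) := h.layerSum_le h0 h1 hy
    have h3 : θ ^ (n + 1) ≤ layerSum θ φ x := h.le_layerSum h0 h1 hn'
    have h4 : layerSum θ φ x ≤ θ ^ n := by
      rw [ex, pow_succ]
      have : (1 - θ) * θ ^ n * φ n x ≤ (1 - θ) * θ ^ n :=
        mul_le_of_le_one_right (by positivity) (h.le_one n x)
      linarith
    rw [abs_of_nonneg (by linarith)]
    linarith [h.layerSum_nonneg h0 h1 y]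
  · left
    have h2 := h.R_succ n
    have h3 := h.r_anti n
    have h4 : dist y x₀ ≤ dist x y + dist x x₀ := by
      rw [dist_comm x y]; exact dist_triangle y x x₀
    have hy' : dist y x₀ < R (n + 1 + 1) := by
      rw [h.R_succ (n + 1)]; linarith [h.r_pos (n + 1)]
    refine ⟨n + 1, hn'.trans (h.R_mono (Nat.lt_succ_self _)), hy', ?_⟩
    have ey := h.layerSum_eq_of_mem h0 h1 (Or.inr hy) hy'
    rw [ex, ey, h.eq_zero n x (by linarith), h.eq_one (n + 1) x hn']
    have e : (1 - θ) * θ ^ n * 0 + θ ^ (n + 1) -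
        ((1 - θ) * θ ^ (n + 1) * φ (n + 1) y + θ ^ (n + 1 + 1)) =
        (1 - θ) * θ ^ (n + 1) * (1 - φ (n + 1) y) := by ring
    rw [e, abs_mul, abs_of_pos (by positivity)]

end Layers

/-! ### Jump measures and the energy of a cutoff function -/

namespace MixedForm

variable {M : Type*} [MetricSpace M] [MeasurableSpace M] [BorelSpace M]
  [SecondCountableTopology M] {m : Measure M} {p : ℝ} (𝓔 : MixedForm m p)

lemma jumpEnergyMeasure_apply {Ω s : Set M} (hs : MeasurableSet s)
    (u : M → ℝ) : 𝓔.jumpEnergyMeasure Ω u s =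
      ∫⁻ z in s ×ˢ Ω, ENNReal.ofReal (|u z.1 - u z.2| ^ p) ∂𝓔.jump := by
  have h1 : MeasurableSet (Prod.fst ⁻¹' s : Set (M × M)) := measurable_fst hs
  rw [jumpEnergyMeasure, Measure.map_apply measurable_fst hs, withDensity_apply _ h1,
    Measure.restrict_restrict h1]
  congr 2
  ext z
  simp

lemma energyMeasure_mono {Ω Ω' : Set M} (h : Ω ⊆ Ω') (u : M → ℝ) :
    𝓔.energyMeasure Ω u ≤ 𝓔.energyMeasure Ω' u := by
  refine add_le_add le_rfl (Measure.le_iff.2 fun s hs => ?_)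
  rw [𝓔.jumpEnergyMeasure_apply hs, 𝓔.jumpEnergyMeasure_apply hs]
  exact lintegral_mono_set (Set.prod_mono le_rfl h)

lemma energyMeasure_zero [LocallyCompactSpace M] (hp : 1 < p) (Ω : Set M) :
    𝓔.energyMeasure Ω 0 = 0 := by
  have h : (fun z : M × M => ENNReal.ofReal (|(0 : M → ℝ) z.1 - (0 : M → ℝ) z.2| ^ p)) = 0 := by
    ext z
    simp [Real.zero_rpow (by linarith : p ≠ 0)]
  rw [energyMeasure, 𝓔.localEnergyMeasure_zero hp, jumpEnergyMeasure, h]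
  simp

lemma quasiContinuous_zero (hp : 1 < p) : 𝓔.QuasiContinuous 0 := fun ε hε => by
  refine ⟨∅, isOpen_empty, lt_of_le_of_lt ?_ hε, continuousOn_const⟩
  refine (iInf₂_le (0 : M → ℝ) ⟨𝓔.dom.zero_mem, by simp⟩).trans ?_
  simp [energyOne, 𝓔.isEnergy.energy_zero hp, Real.zero_rpow (by linarith : p ≠ 0)]

/-- The inequality for the constant function `1` bounds the energy of the cutoff function. -/
lemma CutoffInequality.energyMeasure_le [LocallyCompactSpace M] {𝓔 : MixedForm m p} (hp : 1 < p)
    {W : M → ℝ → ℝ} {η C r : ℝ} {Ω : Set M} {φ g : M → ℝ}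
    (h : 𝓔.CutoffInequality W η C r Ω φ g) :
    𝓔.energyMeasure Ω φ Ω ≤ (⨆ x ∈ Ω, ENNReal.ofReal (C / W x r)) * m Ω := by
  have := h 0 𝓔.dom.zero_mem (𝓔.quasiContinuous_zero hp) MemLp.zero 1
  simpa [𝓔.energyMeasure_zero hp] using this

section Tail

variable {W : M → ℝ → ℝ} {J : Kernel M M} {C : ℝ}

lemma jump_far_le
    (hJ : ∀ E : Set (M × M), MeasurableSet E → 𝓔.jump E = ∫⁻ x, J x (Prod.mk x ⁻¹' E) ∂m)
    (hC : ∀ (x : M) (r : ℝ), 0 < r → J x (Metric.ball x r)ᶜ ≤ ENNReal.ofReal (C / W x r))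
    {s : Set M} (hs : MeasurableSet s) {ρ : ℝ} (hρ : 0 < ρ) :
    𝓔.jump {z | z.1 ∈ s ∧ ρ ≤ dist z.1 z.2} ≤ ∫⁻ x in s, ENNReal.ofReal (C / W x ρ) ∂m := by
  have hm : MeasurableSet {z : M × M | z.1 ∈ s ∧ ρ ≤ dist z.1 z.2} :=
    (measurable_fst hs).inter (measurableSet_le measurable_const measurable_dist)
  rw [hJ _ hm, ← lintegral_indicator hs]
  refine lintegral_mono fun x => ?_
  by_cases hx : x ∈ s
  · rw [Set.indicator_of_mem hx]
    refine le_trans (measure_mono fun y hy => ?_) (hC x ρ hρ)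
    simpa [dist_comm] using hy.2
  · have : Prod.mk x ⁻¹' {z : M × M | z.1 ∈ s ∧ ρ ≤ dist z.1 z.2} = ∅ := by
      ext y
      simp [hx]
    simp [this]

lemma jump_far_le'
    (hJ : ∀ E : Set (M × M), MeasurableSet E → 𝓔.jump E = ∫⁻ x, J x (Prod.mk x ⁻¹' E) ∂m)
    (hC : ∀ (x : M) (r : ℝ), 0 < r → J x (Metric.ball x r)ᶜ ≤ ENNReal.ofReal (C / W x r))
    {s : Set M} (hs : MeasurableSet s) {ρ : ℝ} (hρ : 0 < ρ) :
    𝓔.jump {z | z.2 ∈ s ∧ ρ ≤ dist z.1 z.2} ≤ ∫⁻ x in s, ENNReal.ofReal (C / W x ρ) ∂m := by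
  have hm : MeasurableSet {z : M × M | z.2 ∈ s ∧ ρ ≤ dist z.1 z.2} :=
    (measurable_snd hs).inter (measurableSet_le measurable_const measurable_dist)
  refine le_trans (le_of_eq ?_) (𝓔.jump_far_le hJ hC hs hρ)
  conv_lhs => rw [← 𝓔.jump_symm, Measure.map_apply measurable_swap hm]
  congr 1
  ext z
  simp [dist_comm]

lemma setLIntegral_le_iSup_mul {s : Set M} (hs : MeasurableSet s) (f : M → ℝ≥0∞) :
    ∫⁻ x in s, f x ∂m ≤ (⨆ x ∈ s, f x) * m s := by
  calc ∫⁻ x in s, f x ∂m ≤ ∫⁻ _ in s, (⨆ x ∈ s, f x) ∂m :=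
        setLIntegral_mono' hs fun x hx => le_iSup₂ (f := fun x (_ : x ∈ s) => f x) x hx
    _ = _ := by simp

/-- The jumps out of the ball of radius `R + 2 * r` start at a distance at least `r` from its
complement, if they contribute to the energy. -/
lemma lintegral_jump_le (hp : 1 < p) {x₀ : M} {R r : ℝ} (hr : 0 < r) {φ : M → ℝ}
    (h0 : ∀ x, 0 ≤ φ x) (h1 : ∀ x, φ x ≤ 1) (h2 : ∀ x, R + r ≤ dist x x₀ → φ x = 0)
    (hJ : ∀ E : Set (M × M), MeasurableSet E → 𝓔.jump E = ∫⁻ x, J x (Prod.mk x ⁻¹' E) ∂m)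
    (hC : ∀ (x : M) (r : ℝ), 0 < r → J x (Metric.ball x r)ᶜ ≤ ENNReal.ofReal (C / W x r)) :
    ∫⁻ z, ENNReal.ofReal (|φ z.1 - φ z.2| ^ p) ∂𝓔.jump ≤
      𝓔.jumpEnergyMeasure (Metric.ball x₀ (R + 2 * r)) φ (Metric.ball x₀ (R + 2 * r)) +
      2 * ((⨆ x ∈ Metric.ball x₀ (R + 2 * r), ENNReal.ofReal (C / W x r)) *
        m (Metric.ball x₀ (R + 2 * r))) := by
  set Ω := Metric.ball x₀ (R + 2 * r) with hΩ
  have hΩm : MeasurableSet Ω := Metric.isOpen_ball.measurableSet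
  set A : Set (M × M) := {z | z.1 ∈ Ω ∧ r ≤ dist z.1 z.2}
  set B : Set (M × M) := {z | z.2 ∈ Ω ∧ r ≤ dist z.1 z.2}
  have hA : MeasurableSet A :=
    (measurable_fst hΩm).inter (measurableSet_le measurable_const measurable_dist)
  have hB : MeasurableSet B :=
    (measurable_snd hΩm).inter (measurableSet_le measurable_const measurable_dist)
  have hp0 : (0 : ℝ) ≤ p := by linarith
  have hle : ∀ x y, ENNReal.ofReal (|φ x - φ y| ^ p) ≤ 1 := fun x y => by
    rw [← ENNReal.ofReal_one]
    refine ENNReal.ofReal_le_ofReal (Real.rpow_le_one (abs_nonneg _) ?_ hp0)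
    rw [abs_le]
    constructor <;> linarith [h0 x, h1 x, h0 y, h1 y]
  have hpt : ∀ z : M × M, ENNReal.ofReal (|φ z.1 - φ z.2| ^ p) ≤
      (Ω ×ˢ Ω).indicator (fun z => ENNReal.ofReal (|φ z.1 - φ z.2| ^ p)) z +
        (A.indicator 1 z + B.indicator 1 z) := by
    rintro ⟨x, y⟩
    by_cases hx : x ∈ Ω <;> by_cases hy : y ∈ Ω
    · rw [Set.indicator_of_mem (Set.mk_mem_prod hx hy)]
      exact le_self_add
    · have hy' : R + 2 * r ≤ dist y x₀ := by simpa [hΩ] using hy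
      have ey : φ y = 0 := h2 y (by linarith)
      by_cases hx' : R + r ≤ dist x x₀
      · simp [h2 x hx', ey, Real.zero_rpow (by linarith : p ≠ 0)]
      · have : (x, y) ∈ A := ⟨hx, by
          have := dist_triangle y x x₀
          rw [dist_comm y x] at this
          change r ≤ dist x y
          linarith [not_le.1 hx']⟩
        rw [Set.indicator_of_mem this]
        refine (hle x y).trans ?_
        rw [Pi.one_apply, add_left_comm]
        exact le_self_add
    · have hx' : R + 2 * r ≤ dist x x₀ := by simpa [hΩ] using hx
      have ex : φ x = 0 := h2 x (by linarith)
      by_cases hy' : R + r ≤ dist y x₀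
      · simp [h2 y hy', ex, Real.zero_rpow (by linarith : p ≠ 0)]
      · have : (x, y) ∈ B := ⟨hy, by
          have := dist_triangle x y x₀
          change r ≤ dist x y
          linarith [not_le.1 hy']⟩
        rw [Set.indicator_of_mem this]
        refine (hle x y).trans ?_
        rw [Pi.one_apply, ← add_assoc]
        exact le_add_self
    · have hx' : R + 2 * r ≤ dist x x₀ := by simpa [hΩ] using hx
      have hy' : R + 2 * r ≤ dist y x₀ := by simpa [hΩ] using hy
      simp [h2 x (by linarith), h2 y (by linarith), Real.zero_rpow (by linarith : p ≠ 0)]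
  refine (lintegral_mono hpt).trans ?_
  have hAB : Measurable fun z => A.indicator (1 : M × M → ℝ≥0∞) z + B.indicator 1 z :=
    (measurable_one.indicator hA).add (measurable_one.indicator hB)
  rw [lintegral_add_right _ hAB,
    lintegral_add_right _ (measurable_one.indicator hB), lintegral_indicator_one hA,
    lintegral_indicator_one hB, lintegral_indicator (hΩm.prod hΩm),
    ← 𝓔.jumpEnergyMeasure_apply hΩm, two_mul]
  have hS := setLIntegral_le_iSup_mul (m := m) hΩm fun x => ENNReal.ofReal (C / W x r)
  exact add_le_add le_rfl (add_le_add ((𝓔.jump_far_le hJ hC hΩm hr).trans hS)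
    ((𝓔.jump_far_le' hJ hC hΩm hr).trans hS))

/-- The energy of a cutoff function which satisfies the cutoff inequality. -/
lemma ofReal_energy_le [LocallyCompactSpace M] (hp : 1 < p) {x₀ : M} {R r η C₀ : ℝ} (hr : 0 < r)
    {φ g : M → ℝ}
    (hφ : φ ∈ 𝓔.cutoff (Metric.ball x₀ R) (Metric.ball x₀ (R + r)))
    (h : 𝓔.CutoffInequality W η C₀ r (Metric.ball x₀ (R + 2 * r)) φ g)
    (hJ : ∀ E : Set (M × M), MeasurableSet E → 𝓔.jump E = ∫⁻ x, J x (Prod.mk x ⁻¹' E) ∂m)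
    (hC : ∀ (x : M) (r : ℝ), 0 < r → J x (Metric.ball x r)ᶜ ≤ ENNReal.ofReal (C / W x r)) :
    ENNReal.ofReal (𝓔.energy φ) ≤
      ((⨆ x ∈ Metric.ball x₀ (R + 2 * r), ENNReal.ofReal (C₀ / W x r)) +
        2 * ⨆ x ∈ Metric.ball x₀ (R + 2 * r), ENNReal.ofReal (C / W x r)) *
        m (Metric.ball x₀ (R + 2 * r)) := by
  obtain ⟨hφD, hφ01, hφ1, hφ0⟩ := hφ
  have hz : ∀ x, R + r ≤ dist x x₀ → φ x = 0 := fun x hx => hφ0 x (by simpa using hx)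
  have h2 := 𝓔.lintegral_jump_le hp hr (fun x => (hφ01 x).1) (fun x => (hφ01 x).2) hz hJ hC
  have hs : tsupport φ ⊆ Metric.ball x₀ (R + 2 * r) := by
    refine (closure_minimal (t := Metric.closedBall x₀ (R + r)) (fun x hx => ?_)
      Metric.isClosed_closedBall).trans (Metric.closedBall_subset_ball (by linarith))
    by_contra h'
    exact hx (hz x (by simpa using (not_le.1 h').le))
  have h3 := 𝓔.ofReal_localPart_le_localEnergyMeasure hp hφD (fun x => (hφ01 x).1)
    Metric.isOpen_ball hs
  have h4 := h.energyMeasure_le hp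
  rw [energyMeasure, Measure.add_apply] at h4
  have e : 𝓔.energy φ = localPart p 𝓔.jump 𝓔.energy φ + jumpEnergy p 𝓔.jump φ := by
    rw [localPart]; ring
  have h5 : ENNReal.ofReal (jumpEnergy p 𝓔.jump φ) =
      ∫⁻ z, ENNReal.ofReal (|φ z.1 - φ z.2| ^ p) ∂𝓔.jump :=
    ofReal_integral_eq_lintegral_ofReal (𝓔.jump_integrable φ hφD)
      (ae_of_all _ fun z => by positivity)
  rw [e, add_mul]
  refine ENNReal.ofReal_add_le.trans ?_
  rw [h5, mul_assoc]
  calc _ ≤ 𝓔.localEnergyMeasure φ (Metric.ball x₀ (R + 2 * r)) +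
        (𝓔.jumpEnergyMeasure (Metric.ball x₀ (R + 2 * r)) φ (Metric.ball x₀ (R + 2 * r)) +
      2 * ((⨆ x ∈ Metric.ball x₀ (R + 2 * r), ENNReal.ofReal (C / W x r)) *
        m (Metric.ball x₀ (R + 2 * r)))) := add_le_add h3 h2
    _ ≤ _ := by
      rw [← add_assoc]
      exact add_le_add h4 le_rfl

end Tail

end MixedForm

/-! ### The energy measure of a layered cutoff function -/

lemma abs_sub_rpow_le {p : ℝ} (hp : 0 ≤ p) (a b : ℝ) :
    |a - b| ^ p ≤ 2 ^ p * (|a| ^ p + |b| ^ p) := by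
  have h1 : |a - b| ≤ 2 * max |a| |b| := by
    have := abs_sub a b
    linarith [le_max_left |a| |b|, le_max_right |a| |b|]
  refine (Real.rpow_le_rpow (abs_nonneg _) h1 hp).trans ?_
  rw [Real.mul_rpow zero_le_two (le_max_of_le_left (abs_nonneg _))]
  gcongr
  have ha : 0 ≤ |a| ^ p := by positivity
  have hb : 0 ≤ |b| ^ p := by positivity
  rcases max_choice |a| |b| with h | h <;> rw [h] <;> linarith

lemma integral_abs_sub_rpow_le {M : Type*} [MeasurableSpace M] {m : Measure M} {p : ℝ} (hp : 1 < p)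
    {f g : M → ℝ} (hf : MemLp f (ENNReal.ofReal p) m) (hg : MemLp g (ENNReal.ofReal p) m) :
    ∫ x, |f x - g x| ^ p ∂m ≤ 2 ^ p * (∫ x, |f x| ^ p ∂m + ∫ x, |g x| ^ p ∂m) := by
  have hp0 : ENNReal.ofReal p ≠ 0 := by simpa using by linarith
  have h : ∀ {f : M → ℝ}, MemLp f (ENNReal.ofReal p) m → Integrable (fun x => |f x| ^ p) m :=
    fun hf => by
      simpa [ENNReal.toReal_ofReal (by linarith : 0 ≤ p)] using
        hf.integrable_norm_rpow hp0 ENNReal.ofReal_ne_top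
  rw [← integral_add (h hf) (h hg), ← integral_const_mul]
  exact integral_mono (h (hf.sub hg)) (((h hf).add (h hg)).const_mul _)
    fun x => abs_sub_rpow_le (by linarith) (f x) (g x)

namespace MixedForm

variable {M : Type*} [MetricSpace M] [MeasurableSpace M] {m : Measure M} {p : ℝ}
  (𝓔 : MixedForm m p)

/-- The domain contains the `L^p` limit of any of its sequences which is a Cauchy sequence for the
energy. -/
lemma mem_dom_of_tendsto (hp : 1 < p) {u : ℕ → M → ℝ} (hu : ∀ n, u n ∈ 𝓔.dom) {w : M → ℝ}
    (hw : MemLp w (ENNReal.ofReal p) m)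
    (hc : ∀ ε > 0, ∃ N, ∀ n ≥ N, ∀ k ≥ N, rootEnergy p 𝓔.energy (u n - u k) < ε)
    (hl : Tendsto (fun n => ∫ x, |u n x - w x| ^ p ∂m) atTop (𝓝 0)) :
    w ∈ 𝓔.dom ∧ Tendsto (fun n => 𝓔.energy (w - u n)) atTop (𝓝 0) := by
  have hp0 : 0 < p := by linarith
  have hpos : ∀ f : M → ℝ, 0 ≤ ∫ x, |f x| ^ p ∂m := fun f =>
    integral_nonneg fun x => by positivity
  have hL := fun n => 𝓔.memLp _ (hu n)
  have h2p : (0 : ℝ) < 2 ^ p := by positivity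
  obtain ⟨v, hv, hvl⟩ := 𝓔.closed u hu fun ε hε => by
    obtain ⟨N, hN⟩ := hc ((ε / 2) ^ (1 / p)) (by positivity)
    have h1 : 0 < ε / (4 * 2 ^ p) := by positivity
    obtain ⟨N', hN'⟩ := eventually_atTop.1 (hl.eventually_lt_const h1)
    refine ⟨max N N', fun n hn k hk => ?_⟩
    have h2 : 𝓔.energy (u n - u k) < ε / 2 := by
      have hm := 𝓔.dom.sub_mem (hu n) (hu k)
      rw [← 𝓔.isEnergy.root_rpow hp hm]
      have := hN n (le_of_max_le_left hn) k (le_of_max_le_left hk)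
      have := Real.rpow_lt_rpow (𝓔.isEnergy.root_nonneg hm) this hp0
      rwa [← Real.rpow_mul (by positivity), one_div_mul_cancel hp0.ne', Real.rpow_one] at this
    have h3 := integral_abs_sub_rpow_le hp ((hL n).sub hw) ((hL k).sub hw)
    simp only [Pi.sub_apply, sub_sub_sub_cancel_right] at h3
    have h4 := hN' n (le_of_max_le_right hn)
    have h5 := hN' k (le_of_max_le_right hk)
    have h6 : 2 ^ p * (∫ x, |u n x - w x| ^ p ∂m + ∫ x, |u k x - w x| ^ p ∂m) < ε / 2 := by
      calc _ < 2 ^ p * (ε / (4 * 2 ^ p) + ε / (4 * 2 ^ p)) := by gcongr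
        _ = ε / 2 := by field_simp; norm_num
    rw [energyOne]
    simp only [Pi.sub_apply]
    linarith
  have hv' := 𝓔.memLp v hv
  have hn : ∀ n, 0 ≤ 𝓔.energy (u n - v) := fun n => 𝓔.isEnergy.nonneg _ (𝓔.dom.sub_mem (hu n) hv)
  have h1 : Tendsto (fun n => ∫ x, |u n x - v x| ^ p ∂m) atTop (𝓝 0) :=
    squeeze_zero (fun n => hpos fun x => u n x - v x)
      (fun n => by have := hn n; simp only [energyOne, Pi.sub_apply]; linarith) hvl
  have h2 : ∫ x, |v x - w x| ^ p ∂m = 0 := by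
    refine le_antisymm ?_ (hpos fun x => v x - w x)
    have h3 := (hl.add h1).const_mul (2 ^ p)
    rw [add_zero, mul_zero] at h3
    refine ge_of_tendsto' h3 fun n => ?_
    have h4 := integral_abs_sub_rpow_le hp ((hL n).sub hw) ((hL n).sub hv')
    simpa using h4
  have h3 : v =ᵐ[m] w := by
    rw [integral_eq_zero_iff_of_nonneg (fun x => by positivity)] at h2
    · filter_upwards [h2] with x hx
      have := (Real.rpow_eq_zero (abs_nonneg _) hp0.ne').1 hx
      linarith [abs_eq_zero.1 this]
    · simpa [ENNReal.toReal_ofReal hp0.le] using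
        (hv'.sub hw).integrable_norm_rpow (by simpa using hp0) ENNReal.ofReal_ne_top
  have hw' := 𝓔.dom_congr v hv w h3
  refine ⟨hw', ?_⟩
  have e : ∀ n, 𝓔.energy (w - u n) = 𝓔.energy (u n - v) := fun n => by
    have h4 := 𝓔.isEnergy.energy_neg hp (𝓔.dom.sub_mem (hu n) hw')
    rw [neg_sub] at h4
    rw [h4]
    refine (𝓔.energy_congr _ (𝓔.dom.sub_mem (hu n) hv) _ ?_).symm
    filter_upwards [h3] with x hx
    simp [hx]
  simp only [e]
  exact squeeze_zero hn (fun n => le_add_of_nonneg_right (hpos _)) hvl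

end MixedForm

namespace Layers

variable {M : Type*} [MetricSpace M] {x₀ : M} {R r : ℕ → ℝ} {φ : ℕ → M → ℝ} {θ : ℝ}

lemma hasCompactSupport_layerSum (h : Layers x₀ R r φ) {K : Set M} (hK : IsCompact K)
    (hRK : ∀ n, Metric.ball x₀ (R n) ⊆ K) : HasCompactSupport (layerSum θ φ) :=
  HasCompactSupport.intro hK fun x hx => h.layerSum_eq_zero fun n => by
    by_contra h'
    exact hx (hRK n (by simpa using h'))

variable [MeasurableSpace M] [BorelSpace M] {m : Measure M} {p : ℝ} {𝓔 : MixedForm m p}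

lemma layerPartial_mem (hφ : ∀ n, φ n ∈ ccPart 𝓔.dom) (N : ℕ) :
    layerPartial θ φ N ∈ ccPart 𝓔.dom :=
  (ccPart 𝓔.dom).sum_mem fun n _ => (ccPart 𝓔.dom).smul_mem _ (hφ n)

lemma rootEnergy_layerPartial_sub_le (h0 : 0 < θ) (h1 : θ < 1) (hφ : ∀ n, φ n ∈ ccPart 𝓔.dom)
    {k n : ℕ} (hkn : k ≤ n) :
    rootEnergy p 𝓔.energy (layerPartial θ φ n - layerPartial θ φ k) ≤
      ∑ i ∈ Finset.range n, (1 - θ) * θ ^ i * rootEnergy p 𝓔.energy (φ i) -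
      ∑ i ∈ Finset.range k, (1 - θ) * θ ^ i * rootEnergy p 𝓔.energy (φ i) := by
  have hθ : 0 < 1 - θ := by linarith
  rw [layerPartial, layerPartial, ← Finset.sum_Ico_eq_sub _ hkn, ← Finset.sum_Ico_eq_sub _ hkn]
  refine (𝓔.isEnergy.root_sum_le _ _ fun i _ => 𝓔.dom.smul_mem _ (hφ i).1).trans_eq
    (Finset.sum_congr rfl fun i _ => ?_)
  rw [𝓔.isEnergy.root_smul _ (hφ i).1, abs_of_pos (by positivity)]

variable [SecondCountableTopology M] [IsLocallyFiniteMeasure m]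

lemma layerSum_mem (h : Layers x₀ R r φ) (hp : 1 < p) (h0 : 0 < θ) (h1 : θ < 1)
    (hφ : ∀ n, φ n ∈ ccPart 𝓔.dom) {K : Set M} (hK : IsCompact K)
    (hRK : ∀ n, Metric.ball x₀ (R n) ⊆ K)
    (hs : Summable fun n => (1 - θ) * θ ^ n * rootEnergy p 𝓔.energy (φ n)) :
    layerSum θ φ ∈ ccPart 𝓔.dom ∧
      Tendsto (fun N => 𝓔.energy (layerSum θ φ - layerPartial θ φ N)) atTop (𝓝 0) := by
  have hp0 : 0 < p := by linarith
  have hcont := h.continuous_layerSum h0 h1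
  have hcomp : HasCompactSupport (layerSum θ φ) := h.hasCompactSupport_layerSum hK hRK
  have hL : MemLp (layerSum θ φ) (ENNReal.ofReal p) m := hcont.memLp_of_hasCompactSupport hcomp
  have hint : Integrable (fun x => |layerSum θ φ x| ^ p) m := by
    simpa [ENNReal.toReal_ofReal hp0.le] using
      hL.integrable_norm_rpow (by simpa using hp0) ENNReal.ofReal_ne_top
  obtain ⟨h2, h3⟩ := 𝓔.mem_dom_of_tendsto hp (fun N => (layerPartial_mem (θ := θ) hφ N).1) hL
    (fun ε hε => by
      obtain ⟨N, hN⟩ := Metric.cauchySeq_iff.1 hs.hasSum.tendsto_sum_nat.cauchySeq ε hε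
      refine ⟨N, fun n hn k hk => lt_of_le_of_lt ?_ (hN n hn k hk)⟩
      rcases le_total k n with hkn | hkn
      · exact (rootEnergy_layerPartial_sub_le h0 h1 hφ hkn).trans (le_abs_self _)
      · rw [← neg_sub, 𝓔.isEnergy.root_neg
          (𝓔.dom.sub_mem (layerPartial_mem hφ k).1 (layerPartial_mem hφ n).1), dist_comm]
        exact (rootEnergy_layerPartial_sub_le h0 h1 hφ hkn).trans (le_abs_self _))
    (by
      have h4 := tendsto_integral_of_dominated_convergence (μ := m)
        (F := fun N x => |layerPartial θ φ N x - layerSum θ φ x| ^ p) (f := fun _ => 0)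
        (fun x => |layerSum θ φ x| ^ p)
        (fun N => (((layerPartial_mem hφ N).2.1.sub hcont).abs.rpow_const
          fun x => Or.inr hp0.le).aestronglyMeasurable) hint
        (fun N => ae_of_all _ fun x => by
          rw [Real.norm_of_nonneg (by positivity), abs_sub_comm]
          refine Real.rpow_le_rpow (abs_nonneg _) ?_ hp0.le
          rw [abs_of_nonneg (h.tail_nonneg h0 h1 x N), abs_of_nonneg (h.layerSum_nonneg h0 h1 x)]
          linarith [h.layerPartial_nonneg h0 h1 x N])
        (ae_of_all _ fun x => by
          have h5 := ((h.tendsto_layerPartial h0 h1).tendsto_at x).sub_const (layerSum θ φ x)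
          rw [sub_self] at h5
          have h6 := h5.abs.rpow_const (p := p) (Or.inr hp0.le)
          simpa [Real.zero_rpow hp0.ne'] using h6)
      simpa using h4)
  exact ⟨⟨h2, hcont, hcomp⟩, h3⟩

variable [LocallyCompactSpace M]

lemma localEnergyMeasure_layerPartial (h : Layers x₀ R r φ) (hp : 1 < p) (h0 : 0 < θ) (h1 : θ < 1)
    (hφ : ∀ n, φ n ∈ ccPart 𝓔.dom) (N : ℕ) (s : Set M) :
    𝓔.localEnergyMeasure (layerPartial θ φ N) s = ∑ n ∈ Finset.range N,
      ENNReal.ofReal (((1 - θ) * θ ^ n) ^ p) * 𝓔.localEnergyMeasure (φ n) s := by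
  have hθ : 0 < 1 - θ := by linarith
  induction N with
  | zero =>
    have : layerPartial θ φ 0 = 0 := by simp [layerPartial]
    simp [this, 𝓔.localEnergyMeasure_zero hp]
  | succ N ih =>
    have e : layerPartial θ φ (N + 1) = layerPartial θ φ N + ((1 - θ) * θ ^ N) • φ N := by
      simp [layerPartial, Finset.sum_range_succ]
    rw [e, 𝓔.localEnergyMeasure_add hp (layerPartial_mem hφ N)
      ((ccPart 𝓔.dom).smul_mem _ (hφ N)) (fun x => h.layerPartial_nonneg h0 h1 x N)
      (fun x => mul_nonneg (by positivity) (h.nonneg N x)) (by positivity) (h.separated_succ N),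
      𝓔.localEnergyMeasure_smul hp (hφ N) (h.nonneg N) (by positivity), Measure.add_apply, ih,
      Finset.sum_range_succ, Measure.smul_apply, smul_eq_mul]

/-- The tails of the sum are separated from the partial sums and have little energy. -/
lemma localEnergyMeasure_layerSum_le (h : Layers x₀ R r φ) (hp : 1 < p) (h0 : 0 < θ) (h1 : θ < 1)
    (hφ : ∀ n, φ n ∈ ccPart 𝓔.dom) (hm : layerSum θ φ ∈ ccPart 𝓔.dom)
    (hlim : Tendsto (fun N => 𝓔.energy (layerSum θ φ - layerPartial θ φ N)) atTop (𝓝 0))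
    (s : Set M) :
    𝓔.localEnergyMeasure (layerSum θ φ) s ≤
      ∑' n, ENNReal.ofReal (((1 - θ) * θ ^ n) ^ p) * 𝓔.localEnergyMeasure (φ n) s := by
  have key : ∀ N, 𝓔.localEnergyMeasure (layerSum θ φ) s ≤
      (∑' n, ENNReal.ofReal (((1 - θ) * θ ^ n) ^ p) * 𝓔.localEnergyMeasure (φ n) s) +
        ENNReal.ofReal (2 * 𝓔.energy (layerSum θ φ - layerPartial θ φ N)) := by
    intro N
    have hP := layerPartial_mem (θ := θ) hφ N
    have hT := (ccPart 𝓔.dom).sub_mem hm hP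
    have e : layerSum θ φ = layerPartial θ φ N + (layerSum θ φ - layerPartial θ φ N) := by simp
    conv_lhs => rw [e]
    rw [𝓔.localEnergyMeasure_add hp hP hT (fun x => h.layerPartial_nonneg h0 h1 x N)
      (fun x => h.tail_nonneg h0 h1 x N) (by positivity) (h.separated_tail h0 h1 N),
      Measure.add_apply, h.localEnergyMeasure_layerPartial hp h0 h1 hφ]
    refine add_le_add (ENNReal.sum_le_tsum _) ?_
    refine (measure_mono (Set.subset_univ s)).trans
      ((𝓔.localEnergyMeasure_univ_le hp hT fun x => h.tail_nonneg h0 h1 x N).trans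
        (ENNReal.ofReal_le_ofReal ?_))
    have : 0 ≤ jumpEnergy p 𝓔.jump (layerSum θ φ - layerPartial θ φ N) :=
      integral_nonneg fun z => by positivity
    rw [localPart]
    linarith
  have h2 := (ENNReal.continuous_ofReal.tendsto _).comp (hlim.const_mul 2)
  rw [mul_zero, ENNReal.ofReal_zero] at h2
  have h3 := h2.const_add
    (∑' n, ENNReal.ofReal (((1 - θ) * θ ^ n) ^ p) * 𝓔.localEnergyMeasure (φ n) s)
  rw [add_zero] at h3
  exact ge_of_tendsto' h3 key

lemma jumpEnergyMeasure_layerSum_le (h : Layers x₀ R r φ) (hp : 1 < p) (h0 : 0 < θ) (h1 : θ < 1)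
    {W : M → ℝ → ℝ} {J : Kernel M M} {C : ℝ}
    (hJ : ∀ E : Set (M × M), MeasurableSet E → 𝓔.jump E = ∫⁻ x, J x (Prod.mk x ⁻¹' E) ∂m)
    (hC : ∀ (x : M) (r : ℝ), 0 < r → J x (Metric.ball x r)ᶜ ≤ ENNReal.ofReal (C / W x r))
    {Ω s : Set M} (hs : MeasurableSet s) :
    𝓔.jumpEnergyMeasure Ω (layerSum θ φ) s ≤
      (∑' n, ENNReal.ofReal (((1 - θ) * θ ^ n) ^ p) *
        𝓔.jumpEnergyMeasure (Metric.ball x₀ (R (n + 1))) (φ n)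
          (s ∩ Metric.ball x₀ (R (n + 1)))) +
      ∑' n, ENNReal.ofReal ((θ ^ n) ^ p) *
        ∫⁻ x in s, ENNReal.ofReal (C / W x (r (n + 1))) ∂m := by
  have hp0 : 0 < p := by linarith
  have hθ : 0 < 1 - θ := by linarith
  set B : ℕ → Set M := fun n => Metric.ball x₀ (R (n + 1)) with hB
  have hBm : ∀ n, MeasurableSet (B n) := fun n => Metric.isOpen_ball.measurableSet
  set P : ℕ → Set (M × M) := fun n => (s ∩ B n) ×ˢ B n with hP
  have hPm : ∀ n, MeasurableSet (P n) := fun n => (hs.inter (hBm n)).prod (hBm n)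
  set Q : ℕ → Set (M × M) := fun n => {z | z.1 ∈ s ∧ r (n + 1) ≤ dist z.1 z.2} with hQ
  have hQm : ∀ n, MeasurableSet (Q n) := fun n =>
    (measurable_fst hs).inter (measurableSet_le measurable_const measurable_dist)
  set F : ℕ → M × M → ℝ≥0∞ := fun n => (P n).indicator fun z =>
    ENNReal.ofReal (((1 - θ) * θ ^ n) ^ p) * ENNReal.ofReal (|φ n z.1 - φ n z.2| ^ p) with hF
  set G : ℕ → M × M → ℝ≥0∞ := fun n => (Q n).indicator fun _ => ENNReal.ofReal ((θ ^ n) ^ p)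
    with hG
  have hφm : ∀ n, Measurable fun z : M × M => ENNReal.ofReal (|φ n z.1 - φ n z.2| ^ p) :=
      fun n => by
    have h2 : Continuous fun z : M × M => |φ n z.1 - φ n z.2| ^ p :=
      (((h.continuous n).comp continuous_fst).sub ((h.continuous n).comp
        continuous_snd)).abs.rpow_const fun _ => Or.inr hp0.le
    exact h2.measurable.ennreal_ofReal
  have hFm : ∀ n, Measurable (F n) := fun n => ((hφm n).const_mul _).indicator (hPm n)
  have hGm : ∀ n, Measurable (G n) := fun n => measurable_const.indicator (hQm n)
  have hpt : ∀ z ∈ s ×ˢ Ω, ENNReal.ofReal (|layerSum θ φ z.1 - layerSum θ φ z.2| ^ p) ≤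
      (∑' n, F n z) + ∑' n, G n z := by
    rintro ⟨x, y⟩ ⟨hx, -⟩
    simp only at hx ⊢
    rcases h.increment h0 h1 x y with h2 | ⟨n, h2, h3, h4⟩ | ⟨n, h2, h3⟩
    · simp [h2, Real.zero_rpow hp0.ne']
    · refine le_trans ?_ ((ENNReal.le_tsum n).trans le_self_add)
      have : (x, y) ∈ P n := ⟨⟨hx, h2⟩, h3⟩
      simp only [hF]
      rw [Set.indicator_of_mem this, ← ENNReal.ofReal_mul (by positivity),
        ← Real.mul_rpow (by positivity) (abs_nonneg _)]
      exact ENNReal.ofReal_le_ofReal (Real.rpow_le_rpow (abs_nonneg _) h4 hp0.le)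
    · refine le_trans ?_ ((ENNReal.le_tsum n).trans le_add_self)
      have : (x, y) ∈ Q n := ⟨hx, h2⟩
      simp only [hG]
      rw [Set.indicator_of_mem this]
      exact ENNReal.ofReal_le_ofReal (Real.rpow_le_rpow (abs_nonneg _) h3 hp0.le)
  have hsum : Measurable fun z => (∑' n, F n z) + ∑' n, G n z :=
    (Measurable.tsum hFm).add (Measurable.tsum hGm)
  rw [𝓔.jumpEnergyMeasure_apply hs]
  refine (setLIntegral_mono hsum hpt).trans ((setLIntegral_le_lintegral _ _).trans ?_)
  rw [lintegral_add_left (Measurable.tsum hFm), lintegral_tsum fun n => (hFm n).aemeasurable,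
    lintegral_tsum fun n => (hGm n).aemeasurable]
  refine add_le_add (ENNReal.tsum_le_tsum fun n => ?_) (ENNReal.tsum_le_tsum fun n => ?_)
  · rw [lintegral_indicator (hPm n), lintegral_const_mul _ (hφm n),
      𝓔.jumpEnergyMeasure_apply (hs.inter (hBm n))]
  · rw [lintegral_indicator_const (hQm n)]
    gcongr
    exact 𝓔.jump_far_le hJ hC hs (h.r_pos _)

/-- The integral with respect to the energy measure of the sum is controlled by the integrals with
respect to the energy measures of the terms, and by a zero order term due to the long jumps. -/
lemma lintegral_energyMeasure_le (h : Layers x₀ R r φ) (hp : 1 < p) (h0 : 0 < θ) (h1 : θ < 1)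
    (hφ : ∀ n, φ n ∈ ccPart 𝓔.dom) (hm : layerSum θ φ ∈ ccPart 𝓔.dom)
    (hlim : Tendsto (fun N => 𝓔.energy (layerSum θ φ - layerPartial θ φ N)) atTop (𝓝 0))
    {W : M → ℝ → ℝ} {J : Kernel M M} {C : ℝ}
    (hJ : ∀ E : Set (M × M), MeasurableSet E → 𝓔.jump E = ∫⁻ x, J x (Prod.mk x ⁻¹' E) ∂m)
    (hC : ∀ (x : M) (r : ℝ), 0 < r → J x (Metric.ball x r)ᶜ ≤ ENNReal.ofReal (C / W x r))
    {Ω : Set M} (hΩ : MeasurableSet Ω) {k : ℕ → ℝ≥0∞}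
    (hk : ∀ n, ∀ x ∈ Ω, ENNReal.ofReal (C / W x (r (n + 1))) ≤ k n) (g : M → ℝ≥0∞) :
    ∫⁻ x in Ω, g x ∂(𝓔.energyMeasure Ω (layerSum θ φ)) ≤
      (∑' n, ENNReal.ofReal (((1 - θ) * θ ^ n) ^ p) *
        ∫⁻ x in Metric.ball x₀ (R (n + 1)), g x
          ∂(𝓔.energyMeasure (Metric.ball x₀ (R (n + 1))) (φ n))) +
      (∑' n, ENNReal.ofReal ((θ ^ n) ^ p) * k n) * ∫⁻ x in Ω, g x ∂m := by
  have key : (𝓔.energyMeasure Ω (layerSum θ φ)).restrict Ω ≤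
      Measure.sum (fun n => ENNReal.ofReal (((1 - θ) * θ ^ n) ^ p) •
        (𝓔.energyMeasure (Metric.ball x₀ (R (n + 1))) (φ n)).restrict
          (Metric.ball x₀ (R (n + 1)))) +
      (∑' n, ENNReal.ofReal ((θ ^ n) ^ p) * k n) • m.restrict Ω := by
    refine Measure.le_iff.2 fun s hs => ?_
    have hsΩ : MeasurableSet (s ∩ Ω) := hs.inter hΩ
    rw [Measure.restrict_apply hs, MixedForm.energyMeasure, Measure.add_apply, Measure.add_apply,
      Measure.sum_apply _ hs, Measure.smul_apply, Measure.restrict_apply hs, smul_eq_mul,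
      ← ENNReal.tsum_mul_right]
    have hL := h.localEnergyMeasure_layerSum_le hp h0 h1 hφ hm hlim (s ∩ Ω)
    have hJ' := h.jumpEnergyMeasure_layerSum_le hp h0 h1 hJ hC (Ω := Ω) hsΩ
    refine (add_le_add hL hJ').trans ?_
    rw [← add_assoc, ← ENNReal.tsum_add]
    refine add_le_add (ENNReal.tsum_le_tsum fun n => ?_) (ENNReal.tsum_le_tsum fun n => ?_)
    · rw [Measure.smul_apply, Measure.restrict_apply hs, MixedForm.energyMeasure, Measure.add_apply,
        smul_eq_mul, ← mul_add]
      gcongr ENNReal.ofReal _ * (?_ + ?_)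
      · -- the local energy measure of `φ n` does not charge the complement of the ball
        have h2 : tsupport (φ n) ⊆ Metric.ball x₀ (R (n + 1)) := by
          rw [h.R_succ]
          refine (closure_minimal (t := Metric.closedBall x₀ (R n + r n)) (fun x hx => ?_)
            Metric.isClosed_closedBall).trans
            (Metric.closedBall_subset_ball (by linarith [h.r_pos n]))
          by_contra h'
          exact hx (h.eq_zero n x (by simpa using (not_le.1 h').le))
        have h3 := 𝓔.localEnergyMeasure_compl_tsupport hp (hφ n) (h.nonneg n)
        have h4 : s ∩ Ω ⊆ (s ∩ Metric.ball x₀ (R (n + 1))) ∪ (tsupport (φ n))ᶜ := fun x hx => by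
          by_cases hx' : x ∈ tsupport (φ n)
          · exact Or.inl ⟨hx.1, h2 hx'⟩
          · exact Or.inr hx'
        refine (measure_mono h4).trans ((measure_union_le _ _).trans_eq ?_)
        rw [h3, add_zero]
      · exact measure_mono fun x hx => ⟨hx.1.1, hx.2⟩
    · rw [mul_assoc]
      gcongr
      calc ∫⁻ x in s ∩ Ω, ENNReal.ofReal (C / W x (r (n + 1))) ∂m ≤ ∫⁻ _ in s ∩ Ω, k n ∂m :=
            setLIntegral_mono' hsΩ fun x hx => hk n x hx.2
        _ = _ := by simp
  refine (lintegral_mono' key le_rfl).trans_eq ?_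
  rw [lintegral_add_measure, lintegral_sum_measure, lintegral_smul_measure, smul_eq_mul]
  congr 1
  exact tsum_congr fun n => by rw [lintegral_smul_measure, smul_eq_mul]

end Layers

/-! ### Choice of the layers -/

/-- The sum of `((1 - θ) θ ^ n) ^ p` is `(1 - θ) ^ p / (1 - θ ^ p)`, which is at most
`(1 - θ) ^ (p - 1)` and thus small when `θ` is close to `1`. -/
lemma exists_ratio {p η₀ η : ℝ} (hp : 1 < p) (hη : 0 < η) :
    ∃ θ : ℝ, 0 < θ ∧ θ < 1 ∧ η₀ * (1 - θ) ^ p / (1 - θ ^ p) ≤ η * θ ^ p := by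
  have hp0 : 0 < p := by linarith
  have h1 : Tendsto (fun θ : ℝ => η₀ * (1 - θ) ^ (p - 1) - η * θ ^ p) (𝓝[<] 1) (𝓝 (-η)) := by
    have h2 : Continuous fun θ : ℝ => η₀ * (1 - θ) ^ (p - 1) - η * θ ^ p :=
      (((continuous_const.sub continuous_id).rpow_const fun _ => Or.inr (by linarith)).const_mul
        _).sub ((continuous_id.rpow_const fun _ => Or.inr hp0.le).const_mul _)
    have h3 := (h2.tendsto 1).mono_left (nhdsWithin_le_nhds (s := Set.Iio 1))
    simpa [Real.zero_rpow (by linarith : p - 1 ≠ 0)] using h3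
  have h4 := h1.eventually_lt_const (show -η < 0 by linarith)
  have h5 : ∀ᶠ θ : ℝ in 𝓝[<] 1, θ ∈ Set.Ioo 0 1 := Ioo_mem_nhdsLT one_pos
  obtain ⟨θ, h6, h7, h8⟩ := (h4.and h5).exists
  refine ⟨θ, h7, h8, ?_⟩
  have h9 : θ ^ p ≤ θ := by
    simpa using Real.rpow_le_rpow_of_exponent_ge h7 h8.le hp.le
  have h10 : 0 < 1 - θ := by linarith
  have h11 : (1 - θ) ^ p = (1 - θ) ^ (p - 1) * (1 - θ) := by
    rw [← Real.rpow_add_one h10.ne', sub_add_cancel]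
  rw [div_le_iff₀ (by linarith)]
  have h12 : 0 ≤ (1 - θ) ^ (p - 1) := by positivity
  calc η₀ * (1 - θ) ^ p = η₀ * (1 - θ) ^ (p - 1) * (1 - θ) := by rw [h11]; ring
    _ ≤ η * θ ^ p * (1 - θ ^ p) := by
      exact mul_le_mul (by linarith) (by linarith) h10.le (by positivity)

lemma tsum_ofReal_geometric {a κ : ℝ} (ha : 0 ≤ a) (h0 : 0 < κ) (h1 : κ < 1) :
    ∑' n : ℕ, ENNReal.ofReal (a * κ ^ n) = ENNReal.ofReal (a / (1 - κ)) := by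
  have h := (hasSum_geometric_of_lt_one h0.le h1).mul_left a
  rw [← ENNReal.ofReal_tsum_of_nonneg (fun n => by positivity) h.summable, h.tsum_eq,
    div_eq_mul_inv]

section Scale

variable {M : Type*} [MetricSpace M] {W : M → ℝ → ℝ}

lemma IsScaleFunction.pos (hW : IsScaleFunction W) (x : M) {r : ℝ} (hr : 0 < r) : 0 < W x r := by
  rw [← hW.zero x]
  exact hW.strictMono x (by simp) hr.le hr

lemma IsScaleFunction.exists_le (hW : IsScaleFunction W) : ∃ A β : ℝ, 0 < A ∧ 0 < β ∧
    ∀ (x y : M) (r R : ℝ), 0 < r → r ≤ R → dist x y ≤ R →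
      1 / W y r ≤ A * (R / r) ^ β * (1 / W x R) := by
  obtain ⟨C, β₁, β₂, hC, hβ₁, hβ, h⟩ := hW.scaling
  refine ⟨C, β₂, by linarith, by linarith, fun x y r R hr hrR hxy => ?_⟩
  have h1 := (h x y r R hr hrR hxy).2
  have h2 := hW.pos x (hr.trans_le hrR)
  rw [mul_one_div, le_div_iff₀ h2, one_div_mul_eq_div]
  exact h1

lemma IsScaleFunction.iSup_ball_lt_top (hW : IsScaleFunction W) (x₀ : M) {r ρ : ℝ} (hr : 0 < r)
    (hrρ : r ≤ ρ) : ⨆ x ∈ Metric.ball x₀ ρ, ENNReal.ofReal (1 / W x r) < ∞ := by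
  obtain ⟨A, β, -, -, h⟩ := hW.exists_le
  refine lt_of_le_of_lt (iSup₂_le fun x hx => ENNReal.ofReal_le_ofReal
    (h x₀ x r ρ hr hrρ ?_)) ENNReal.ofReal_lt_top
  rw [dist_comm]
  exact (Metric.mem_ball.1 hx).le

end Scale

section Cutoff

variable {M : Type*} [MetricSpace M] [MeasurableSpace M] {m : Measure M} {p : ℝ}
  {𝓔 : MixedForm m p}

lemma MixedForm.ball_subset_tsupport {x₀ : M} {R : ℝ} {V : Set M} {φ : M → ℝ}
    (hφ : φ ∈ 𝓔.cutoff (Metric.ball x₀ R) V) : Metric.ball x₀ R ⊆ tsupport φ := fun x hx =>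
  subset_tsupport φ (by simp [hφ.2.2.1 x hx])

/-- The cutoff functions have compact support, hence small balls are relatively compact. -/
lemma MixedForm.CS.locallyCompactSpace {Rbar : ℝ≥0∞} {W : M → ℝ → ℝ} (h : 𝓔.CS Rbar W)
    (hR : 0 < Rbar) : LocallyCompactSpace M := by
  obtain ⟨η, C, -, -, h⟩ := h
  obtain ⟨ε, hε, hεR⟩ := ENNReal.lt_iff_exists_real_btwn.1 hR
  have hε0 : 0 < ε := by simpa using hεR.1
  have : WeaklyLocallyCompactSpace M := ⟨fun x => by
    obtain ⟨φ, hφ, -⟩ := h x (ε / 3) (ε / 3) (by positivity) (by positivity) (by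
      convert hεR.2 using 2; ring)
    exact ⟨tsupport φ, hφ.1.2.2, mem_of_superset (Metric.ball_mem_nhds x (by positivity))
      (ball_subset_tsupport hφ)⟩⟩
  infer_instance

end Cutoff

/-- The radii: the widths `r n` of the layers decrease geometrically with ratio `s`, and the total
width is `r`. -/
lemma layers_of_cutoff {M : Type*} [MetricSpace M] [MeasurableSpace M] {m : Measure M} {p : ℝ}
    {𝓔 : MixedForm m p} {x₀ : M} {R r s : ℝ} (hr : 0 < r) (hs : 0 < s) (hs1 : s < 1)
    {φ : ℕ → M → ℝ}
    (hφ : ∀ n, φ n ∈ 𝓔.cutoff (Metric.ball x₀ (R + r * (1 - s ^ n)))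
      (Metric.ball x₀ (R + r * (1 - s ^ n) + r * (1 - s) * s ^ n / 2))) :
    Layers x₀ (fun n => R + r * (1 - s ^ n)) (fun n => r * (1 - s) * s ^ n / 2) φ where
  r_pos n := by
    have : 0 < 1 - s := by linarith
    positivity
  r_anti n := by
    have : 0 < 1 - s := by linarith
    have : s ^ (n + 1) ≤ s ^ n := pow_le_pow_of_le_one hs.le hs1.le (Nat.le_succ n)
    gcongr
  R_succ n := by ring
  continuous n := (hφ n).1.2.1
  nonneg n x := ((hφ n).2.1 x).1
  le_one n x := ((hφ n).2.1 x).2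
  eq_one n x hx := (hφ n).2.2.1 x hx
  eq_zero n x hx := (hφ n).2.2.2 x (by simpa using hx)

/-- The weights `(1 - θ) θ ^ n` of the layers of index at least `n₀` are small with respect to the
sum in the layer of index `n₀`. -/
lemma Layers.tsum_weights_indicator_le {M : Type*} [MetricSpace M] {x₀ : M} {R r : ℕ → ℝ}
    {φ : ℕ → M → ℝ} {θ p η₀ η : ℝ} (h : Layers x₀ R r φ) (hp : 1 < p) (h0 : 0 < θ) (h1 : θ < 1)
    (hη₀ : 0 < η₀) (hη : η₀ * (1 - θ) ^ p / (1 - θ ^ p) ≤ η * θ ^ p) (hη' : 0 < η) (x : M) :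
    ∑' n, ENNReal.ofReal (((1 - θ) * θ ^ n) ^ p) * ENNReal.ofReal η₀ *
      (Metric.ball x₀ (R (n + 1))).indicator 1 x ≤
      ENNReal.ofReal η * ENNReal.ofReal (layerSum θ φ x ^ p) := by
  have hp0 : 0 < p := by linarith
  have hθ : 0 < 1 - θ := by linarith
  by_cases hx : ∃ n, dist x x₀ < R (n + 1)
  · classical
    have hκ0 : 0 < θ ^ p := by positivity
    have hκ1 : θ ^ p < 1 := Real.rpow_lt_one h0.le h1 hp0
    set N := Nat.find hx with hN
    have hxN : dist x x₀ < R (N + 1) := Nat.find_spec hx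
    have e : ∀ n, ((1 - θ) * θ ^ n) ^ p = (1 - θ) ^ p * (θ ^ p) ^ n := fun n => by
      rw [Real.mul_rpow hθ.le (by positivity), ← Real.rpow_natCast_mul h0.le,
        ← Real.rpow_mul_natCast h0.le, mul_comm p]
    have h2 : ∑' n, ENNReal.ofReal (((1 - θ) * θ ^ n) ^ p) * ENNReal.ofReal η₀ *
        (Metric.ball x₀ (R (n + 1))).indicator (1 : M → ℝ≥0∞) x ≤
        ∑' n, ENNReal.ofReal (η₀ * (1 - θ) ^ p * (θ ^ p) ^ N * (θ ^ p) ^ n) := by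
      rw [← ENNReal.summable.sum_add_tsum_nat_add' (k := N)]
      have h3 : ∑ n ∈ Finset.range N, ENNReal.ofReal (((1 - θ) * θ ^ n) ^ p) * ENNReal.ofReal η₀ *
          (Metric.ball x₀ (R (n + 1))).indicator (1 : M → ℝ≥0∞) x = 0 :=
        Finset.sum_eq_zero fun n hn => by
          have := Nat.find_min hx (Finset.mem_range.1 hn)
          rw [Set.indicator_of_notMem (by simpa using this), mul_zero]
      rw [h3, zero_add]
      refine ENNReal.tsum_le_tsum fun n => ?_
      calc _ ≤ ENNReal.ofReal (((1 - θ) * θ ^ (n + N)) ^ p) * ENNReal.ofReal η₀ * 1 := by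
            gcongr
            exact Set.indicator_le_self' (fun _ _ => zero_le_one) x
        _ = _ := by
            rw [mul_one, ← ENNReal.ofReal_mul (by positivity), e, pow_add]
            congr 1
            ring
    refine h2.trans ?_
    rw [tsum_ofReal_geometric (by positivity) hκ0 hκ1, ← ENNReal.ofReal_mul hη'.le]
    refine ENNReal.ofReal_le_ofReal ?_
    have h4 : (θ ^ (N + 1)) ^ p ≤ layerSum θ φ x ^ p :=
      Real.rpow_le_rpow (by positivity) (h.le_layerSum h0 h1 hxN) hp0.le
    have h5 : (θ ^ (N + 1)) ^ p = θ ^ p * (θ ^ p) ^ N := by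
      rw [← Real.rpow_natCast_mul h0.le, mul_comm, Real.rpow_mul_natCast h0.le, pow_succ']
    calc η₀ * (1 - θ) ^ p * (θ ^ p) ^ N / (1 - θ ^ p) =
          η₀ * (1 - θ) ^ p / (1 - θ ^ p) * (θ ^ p) ^ N := by ring
      _ ≤ η * θ ^ p * (θ ^ p) ^ N := by gcongr
      _ = η * (θ ^ (N + 1)) ^ p := by rw [h5]; ring
      _ ≤ η * layerSum θ φ x ^ p := by gcongr
  · push Not at hx
    have : ∀ n, (Metric.ball x₀ (R (n + 1))).indicator (1 : M → ℝ≥0∞) x = 0 := fun n =>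
      Set.indicator_of_notMem (by simpa using hx n) _
    simp [this]

/-- The cutoff inequalities of the terms add up to an improved inequality for the sum. -/
lemma Layers.cutoffInequality {M : Type*} [MetricSpace M] [MeasurableSpace M] [BorelSpace M]
    [SecondCountableTopology M] [LocallyCompactSpace M] {m : Measure M} [IsLocallyFiniteMeasure m]
    {p : ℝ} {𝓔 : MixedForm m p} {x₀ : M} {R r : ℕ → ℝ} {φ : ℕ → M → ℝ} {θ η₀ η C₀ C C' ρ : ℝ}
    {W : M → ℝ → ℝ} {J : Kernel M M}
    (h : Layers x₀ R r φ) (hp : 1 < p) (h0 : 0 < θ) (h1 : θ < 1)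
    (hη₀ : 0 < η₀) (hη : η₀ * (1 - θ) ^ p / (1 - θ ^ p) ≤ η * θ ^ p) (hη' : 0 < η)
    (hφ : ∀ n, φ n ∈ ccPart 𝓔.dom) (hm : layerSum θ φ ∈ ccPart 𝓔.dom)
    (hlim : Tendsto (fun N => 𝓔.energy (layerSum θ φ - layerPartial θ φ N)) atTop (𝓝 0))
    (hJ : ∀ E : Set (M × M), MeasurableSet E → 𝓔.jump E = ∫⁻ x, J x (Prod.mk x ⁻¹' E) ∂m)
    (hC : ∀ (x : M) (r : ℝ), 0 < r → J x (Metric.ball x r)ᶜ ≤ ENNReal.ofReal (C / W x r))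
    (hφC : ∀ n, 𝓔.CutoffInequality W η₀ C₀ (r n) (Metric.ball x₀ (R (n + 1))) (φ n) fun _ => 1)
    {Ω : Set M} (hΩ : MeasurableSet Ω) (hRΩ : ∀ n, Metric.ball x₀ (R n) ⊆ Ω) {a k : ℕ → ℝ≥0∞}
    (ha : ∀ n, ∀ x ∈ Ω, ENNReal.ofReal (C₀ / W x (r n)) ≤ a n)
    (hk : ∀ n, ∀ x ∈ Ω, ENNReal.ofReal (C / W x (r (n + 1))) ≤ k n)
    (hak : (∑' n, ENNReal.ofReal (((1 - θ) * θ ^ n) ^ p) * a n) +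
      ∑' n, ENNReal.ofReal ((θ ^ n) ^ p) * k n ≤ ⨆ x ∈ Ω, ENNReal.ofReal (C' / W x ρ)) :
    𝓔.CutoffInequality W η C' ρ Ω (layerSum θ φ) fun x => layerSum θ φ x ^ p := by
  intro v hv hvq hvb b
  set g : M → ℝ≥0∞ := fun x => ENNReal.ofReal (|v x + b| ^ p)
  set c : ℕ → ℝ≥0∞ := fun n => ENNReal.ofReal (((1 - θ) * θ ^ n) ^ p) with hc
  set B : ℕ → Set M := fun n => Metric.ball x₀ (R (n + 1)) with hB
  have hBm : ∀ n, MeasurableSet (B n) := fun n => Metric.isOpen_ball.measurableSet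
  have hBΩ : ∀ n, B n ⊆ Ω := fun n => hRΩ (n + 1)
  set Γ := 𝓔.energyMeasure Ω v
  set I := ∫⁻ x in Ω, g x ∂m
  have hterm : ∀ n, ∫⁻ x in B n, g x ∂(𝓔.energyMeasure (B n) (φ n)) ≤
      ENNReal.ofReal η₀ * Γ (B n) + a n * I := fun n => by
    refine (hφC n v hv hvq hvb b).trans ?_
    simp only [ENNReal.ofReal_one, lintegral_const, one_mul, Measure.restrict_apply_univ]
    gcongr
    · exact 𝓔.energyMeasure_mono (hBΩ n) v
    · exact iSup₂_le fun x hx => ha n x (hBΩ n hx)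
    · exact lintegral_mono_set (hBΩ n)
  have hφp : Measurable fun x => ENNReal.ofReal (layerSum θ φ x ^ p) :=
    (hm.2.1.rpow_const fun _ => Or.inr (by linarith)).measurable.ennreal_ofReal
  have hmain : ∑' n, c n * ENNReal.ofReal η₀ * Γ (B n) ≤
      ENNReal.ofReal η * ∫⁻ x in Ω, ENNReal.ofReal (layerSum θ φ x ^ p) ∂Γ := by
    have e : ∀ n, c n * ENNReal.ofReal η₀ * Γ (B n) =
        ∫⁻ x in Ω, c n * ENNReal.ofReal η₀ * (B n).indicator 1 x ∂Γ := fun n => by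
      rw [lintegral_const_mul _ (measurable_one.indicator (hBm n)),
        lintegral_indicator_one (hBm n), Measure.restrict_apply (hBm n),
        Set.inter_eq_left.2 (hBΩ n)]
    simp only [e]
    rw [← lintegral_tsum fun n =>
        ((measurable_one.indicator (hBm n)).const_mul _).aemeasurable,
      ← lintegral_const_mul _ hφp]
    exact lintegral_mono fun x => h.tsum_weights_indicator_le hp h0 h1 hη₀ hη hη' x
  refine (h.lintegral_energyMeasure_le hp h0 h1 hφ hm hlim hJ hC hΩ hk g).trans ?_
  calc _ ≤ (∑' n, c n * (ENNReal.ofReal η₀ * Γ (B n) + a n * I)) +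
        (∑' n, ENNReal.ofReal ((θ ^ n) ^ p) * k n) * I := by
        gcongr with n
        exact hterm n
    _ = (∑' n, c n * ENNReal.ofReal η₀ * Γ (B n)) + ((∑' n, c n * a n) +
        ∑' n, ENNReal.ofReal ((θ ^ n) ^ p) * k n) * I := by
        simp only [mul_add, ← mul_assoc]
        rw [ENNReal.tsum_add, ENNReal.tsum_mul_right, add_mul, add_assoc]
    _ ≤ _ := by gcongr

lemma one_div_width_le {A β w W r s : ℝ} (hr : 0 < r) (hs : 0 < s) (hs1 : s < 1) (n : ℕ)
    (h : 1 / w ≤ A * (r / (r * (1 - s) * s ^ n / 2)) ^ β * (1 / W)) :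
    1 / w ≤ A * (2 / (1 - s)) ^ β * ((s ^ β) ^ n)⁻¹ * (1 / W) := by
  have h1 : 0 < 1 - s := by linarith
  have e : r / (r * (1 - s) * s ^ n / 2) = 2 / (1 - s) * (s ^ n)⁻¹ := by
    field_simp
  rwa [e, Real.mul_rpow (by positivity) (by positivity), Real.inv_rpow (by positivity),
    ← Real.rpow_natCast_mul hs.le, mul_comm (n : ℝ), Real.rpow_mul_natCast hs.le, ← mul_assoc] at h

end PEnergy

end

open PEnergy

theorem proposition3p2 {M : Type*} [MetricSpace M] [CompleteSpace M]
    [TopologicalSpace.SeparableSpace M] [MeasurableSpace M] [BorelSpace M]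
    (m : MeasureTheory.Measure M) [MeasureTheory.IsLocallyFiniteMeasure m]
    (p : ℝ) (hp : 1 < p) (𝓔 : PEnergy.MixedForm m p)
    (Rbar : ENNReal) (hRbar : 0 < Rbar) (hRbar' : Rbar ≤ Metric.ediam (Set.univ : Set M))
    (W : M → ℝ → ℝ) (hW : PEnergy.IsScaleFunction W)
    (hTJ : 𝓔.TJ W) (hCS : 𝓔.CS Rbar W) :
    ∀ η : ℝ, 0 < η → 𝓔.ImprovedCS Rbar W η := by
  intro η hη
  have hp0 : 0 < p := by linarith
  have := hCS.locallyCompactSpace hRbar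
  obtain ⟨J, CJ, hCJ, hJ, hJC⟩ := hTJ
  obtain ⟨η₀, C₀, hη₀, hC₀, hcut⟩ := hCS
  obtain ⟨A, β, hA, hβ, hWA⟩ := hW.exists_le
  obtain ⟨θ, h0, h1, hθ⟩ := exists_ratio (η₀ := η₀) hp hη
  have hθ1 : 0 < 1 - θ := by linarith
  -- the widths of the layers decrease slowly enough for `θ ^ (n * p) / W(x, r n)` to be summable
  set κ := θ ^ (p / 2) with hκ
  have hκ0 : 0 < κ := by positivity
  have hκ1 : κ < 1 := Real.rpow_lt_one h0.le h1 (by positivity)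
  have hκ' : 0 < 1 - κ := by linarith
  have hκ2 : ∀ n : ℕ, (θ ^ n) ^ p = κ ^ n * κ ^ n := fun n => by
    rw [← Real.rpow_natCast_mul h0.le, mul_comm, Real.rpow_mul_natCast h0.le, ← mul_pow, hκ,
      ← Real.rpow_add h0, add_halves]
  set s := κ ^ (1 / β) with hs
  have hs0 : 0 < s := by positivity
  have hs1 : s < 1 := Real.rpow_lt_one hκ0.le hκ1 (by positivity)
  have hs' : 0 < 1 - s := by linarith
  have hsκ : s ^ β = κ := by
    rw [hs, ← Real.rpow_mul hκ0.le, one_div_mul_cancel hβ.ne', Real.rpow_one]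
  set B := A * (2 / (1 - s)) ^ β with hB
  have hB0 : 0 < B := by positivity
  set w : ℝ → ℕ → ℝ := fun r n => r * (1 - s) * s ^ n / 2 with hw
  have hw0 : ∀ {r : ℝ}, 0 < r → ∀ n, 0 < w r n := fun hr n => by positivity
  have hwr : ∀ {r : ℝ}, 0 < r → ∀ n, w r n ≤ r := fun {r} hr n => by
    have h2 : (1 - s) * s ^ n ≤ 1 * 1 := by
      gcongr
      · linarith
      · exact pow_le_one₀ hs0.le hs1.le
    have h3 : r * ((1 - s) * s ^ n) ≤ r * (1 * 1) := by gcongr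
    simp only [hw]
    rw [mul_assoc]
    linarith
  refine ⟨(1 - θ) ^ p * C₀ * B / (1 - κ) + CJ * B * κ⁻¹ / (1 - κ), by positivity,
    fun x₀ R r hR hr hRr => ?_⟩
  set Ω := Metric.ball x₀ (R + 2 * r) with hΩ
  set S := ⨆ x ∈ Ω, ENNReal.ofReal (1 / W x r) with hS
  have hWn : ∀ {c : ℝ}, 0 ≤ c → ∀ n, ∀ x ∈ Ω,
      ENNReal.ofReal (c / W x (w r n)) ≤ ENNReal.ofReal (c * B * (κ ^ n)⁻¹) * S := by
    intro c hc n x hx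
    have h2 := one_div_width_le hr hs0 hs1 n
      (hWA x x _ r (hw0 hr n) (hwr hr n) (by simpa using hr.le))
    rw [hsκ] at h2
    calc ENNReal.ofReal (c / W x (w r n)) ≤ ENNReal.ofReal (c * B * (κ ^ n)⁻¹ * (1 / W x r)) := by
          refine ENNReal.ofReal_le_ofReal ?_
          rw [← mul_one_div, mul_assoc c, mul_assoc c]
          exact mul_le_mul_of_nonneg_left h2 hc
      _ = ENNReal.ofReal (c * B * (κ ^ n)⁻¹) * ENNReal.ofReal (1 / W x r) :=
          ENNReal.ofReal_mul (by positivity)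
      _ ≤ _ := by
          gcongr
          exact le_iSup₂ (f := fun x (_ : x ∈ Ω) => ENNReal.ofReal (1 / W x r)) x hx
  have hlt : ∀ n, s ^ n ≤ 1 := fun n => pow_le_one₀ hs0.le hs1.le
  have hRn : ∀ n, R ≤ R + r * (1 - s ^ n) := fun n => by
    have := mul_nonneg hr.le (sub_nonneg.2 (hlt n))
    linarith
  have hRn' : ∀ n, R + r * (1 - s ^ n) ≤ R + r := fun n => by
    have : 0 < r * s ^ n := by positivity
    linarith
  have hRs : ∀ n, R + r * (1 - s ^ n) + 2 * w r n = R + r * (1 - s ^ (n + 1)) := fun n => by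
    simp only [hw]; ring
  choose φ hφ hφC using fun n => hcut x₀ (R + r * (1 - s ^ n)) (w r n)
    (by linarith [hRn n]) (hw0 hr n) (lt_of_le_of_lt (ENNReal.ofReal_le_ofReal
      (by rw [hRs]; linarith [hRn' (n + 1)])) hRr)
  have hφD : ∀ n, φ n ∈ ccPart 𝓔.dom := fun n => (hφ n).1
  have hLay := layers_of_cutoff hr hs0 hs1 hφ
  -- a cutoff function of the largest ball
  obtain ⟨χ, hχ, -⟩ := hcut x₀ (R + r) (r / 2) (by positivity) (by positivity) (by
    convert hRr using 2; ring)
  have hK := hχ.1.2.2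
  have hRK : Metric.ball x₀ (R + r) ⊆ tsupport χ := MixedForm.ball_subset_tsupport hχ
  have hmK : m (Metric.ball x₀ (R + r)) < ∞ :=
    (measure_mono hRK).trans_lt (IsCompact.measure_lt_top hK)
  have hSt : S < ∞ := hW.iSup_ball_lt_top x₀ hr (by linarith)
  -- the energies of the terms
  set F := (S * m (Metric.ball x₀ (R + r))).toReal with hF
  have hFe : ENNReal.ofReal F = S * m (Metric.ball x₀ (R + r)) :=
    ENNReal.ofReal_toReal (ENNReal.mul_ne_top hSt.ne hmK.ne)
  have hF0 : 0 ≤ F := ENNReal.toReal_nonneg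
  have hen : ∀ n, 𝓔.energy (φ n) ≤ (C₀ + 2 * CJ) * B * F * (κ ^ n)⁻¹ := by
    intro n
    have h2 := 𝓔.ofReal_energy_le hp (hw0 hr n) (hφ n) (hφC n) hJ hJC
    rw [hRs] at h2
    have hsub : Metric.ball x₀ (R + r * (1 - s ^ (n + 1))) ⊆ Ω :=
      Metric.ball_subset_ball (by linarith [hRn' (n + 1)])
    have h3 : ∀ {c : ℝ}, 0 ≤ c → (⨆ x ∈ Metric.ball x₀ (R + r * (1 - s ^ (n + 1))),
        ENNReal.ofReal (c / W x (w r n))) ≤ ENNReal.ofReal (c * B * (κ ^ n)⁻¹) * S := fun hc =>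
      iSup₂_le fun x hx => hWn hc n x (hsub hx)
    have h4 : ENNReal.ofReal (𝓔.energy (φ n)) ≤
        (ENNReal.ofReal (C₀ * B * (κ ^ n)⁻¹) * S + 2 * (ENNReal.ofReal (CJ * B * (κ ^ n)⁻¹) * S)) *
          m (Metric.ball x₀ (R + r)) := by
      refine h2.trans ?_
      gcongr
      · exact h3 hC₀.le
      · exact h3 hCJ.le
      · linarith [hRn' (n + 1)]
    rw [← ENNReal.ofReal_le_ofReal_iff (by positivity)]
    refine h4.trans_eq ?_
    have e : (C₀ + 2 * CJ) * B * F * (κ ^ n)⁻¹ =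
        (C₀ * B * (κ ^ n)⁻¹ + 2 * (CJ * B * (κ ^ n)⁻¹)) * F := by ring
    have e' : ∀ {a b : ℝ}, 0 ≤ a → 0 ≤ b → ENNReal.ofReal ((a + 2 * b) * F) =
        (ENNReal.ofReal a + 2 * ENNReal.ofReal b) * ENNReal.ofReal F := fun ha hb => by
      rw [ENNReal.ofReal_mul (by positivity), ENNReal.ofReal_add ha (by positivity),
        ENNReal.ofReal_mul zero_le_two, ENNReal.ofReal_ofNat]
    rw [e, e' (by positivity) (by positivity), hFe]
    ring
  have hsum : Summable fun n => (1 - θ) * θ ^ n * rootEnergy p 𝓔.energy (φ n) := by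
    set ρ := θ ^ (1 / 2 : ℝ) with hρ
    have hρ0 : 0 < ρ := by positivity
    have hρ1 : ρ < 1 := Real.rpow_lt_one h0.le h1 (by positivity)
    have hρθ : ρ * ρ = θ := by rw [hρ, ← Real.rpow_add h0]; norm_num
    have hκρ : κ ^ (1 / p) = ρ := by
      rw [hκ, hρ, ← Real.rpow_mul h0.le]
      congr 1
      field_simp
    set G := ((C₀ + 2 * CJ) * B * F) ^ (1 / p) with hG
    refine Summable.of_nonneg_of_le (fun n => ?_) (fun n => ?_)
      ((summable_geometric_of_lt_one hρ0.le hρ1).mul_left ((1 - θ) * G))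
    · have := 𝓔.isEnergy.root_nonneg (hφD n).1
      positivity
    · have h2 : rootEnergy p 𝓔.energy (φ n) ≤ G * (ρ ^ n)⁻¹ := by
        refine (Real.rpow_le_rpow (𝓔.isEnergy.nonneg _ (hφD n).1) (hen n)
          (by positivity)).trans_eq ?_
        rw [Real.mul_rpow (by positivity) (by positivity), Real.inv_rpow (by positivity),
          ← Real.rpow_natCast_mul hκ0.le, mul_comm (n : ℝ), Real.rpow_mul_natCast hκ0.le, hκρ]
      calc (1 - θ) * θ ^ n * rootEnergy p 𝓔.energy (φ n) ≤ (1 - θ) * θ ^ n * (G * (ρ ^ n)⁻¹) := by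
            gcongr
        _ = (1 - θ) * G * ρ ^ n := by
            rw [← hρθ, mul_pow]
            field_simp
  obtain ⟨hm, hlim⟩ := hLay.layerSum_mem hp h0 h1 hφD hK
    (fun n => (Metric.ball_subset_ball (hRn' n)).trans hRK) hsum
  refine ⟨layerSum θ φ, ⟨hm, fun x => ⟨hLay.layerSum_nonneg h0 h1 x, hLay.layerSum_le_one h0 h1 x⟩,
    fun x hx => hLay.layerSum_eq_one h0 h1 (by simpa using hx),
    fun x hx => hLay.layerSum_eq_zero fun n => ?_⟩, ?_⟩
  · exact (hRn' n).trans (by simpa using hx)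
  refine hLay.cutoffInequality hp h0 h1 hη₀ hθ hη hφD hm hlim hJ hJC (fun n => ?_)
    Metric.isOpen_ball.measurableSet
    (fun n => Metric.ball_subset_ball (by linarith [hRn' n]))
    (a := fun n => ENNReal.ofReal (C₀ * B * (κ ^ n)⁻¹) * S)
    (k := fun n => ENNReal.ofReal (CJ * B * (κ ^ (n + 1))⁻¹) * S)
    (fun n => hWn hC₀.le n) (fun n => hWn hCJ.le (n + 1)) (le_of_eq ?_)
  · rw [← hRs n]
    exact hφC n
  · simp only [← mul_assoc, ENNReal.tsum_mul_right, ← add_mul]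
    have e1 : ∀ n : ℕ, ENNReal.ofReal (((1 - θ) * θ ^ n) ^ p) *
        ENNReal.ofReal (C₀ * B * (κ ^ n)⁻¹) = ENNReal.ofReal ((1 - θ) ^ p * C₀ * B * κ ^ n) :=
      fun n => by
        rw [← ENNReal.ofReal_mul (by positivity), Real.mul_rpow hθ1.le (by positivity), hκ2]
        congr 1
        field_simp
    have e2 : ∀ n : ℕ, ENNReal.ofReal ((θ ^ n) ^ p) *
        ENNReal.ofReal (CJ * B * (κ ^ (n + 1))⁻¹) = ENNReal.ofReal (CJ * B * κ⁻¹ * κ ^ n) :=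
      fun n => by
        rw [← ENNReal.ofReal_mul (by positivity), hκ2, pow_succ]
        congr 1
        field_simp
    simp only [e1, e2]
    rw [tsum_ofReal_geometric (by positivity) hκ0 hκ1,
      tsum_ofReal_geometric (by positivity) hκ0 hκ1,
      ← ENNReal.ofReal_add (by positivity) (by positivity), hS]
    simp only [ENNReal.mul_iSup]
    refine iSup_congr fun x => iSup_congr fun hx => ?_
    rw [← ENNReal.ofReal_mul (by positivity), mul_one_div]
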